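/- **Notation.** Write $\|\cdot\|$ for the norm of $L^2(\mathbb R^2;\mathbb C)$, $e_1=(1,0)$, and let $\Lambda^s$, $|D|^p$ be the Fourier multipliers with symbols $(1+|\xi|^2)^{s/2}$, $|\xi|^p$; $\|f\|_{H^s}=\|\Lambda^sf\|$. For $k,\epsilon>0$ let $\Lambda^s_\epsilon$ have symbol $(1+|(\xi-ke_1)/\epsilon|^2)^{s/2}$ and let $\mathcal B_k$ have as symbol the characteristic function of $\{\xi:|\xi-ke_1|\le k/2\}$. Let $q\ge3$ be an odd integer, $s>1-\frac2{q-1}$ real, $p>0$, $k>0$, $\nu\in(1,2)$, $\mathbf T>0$, and put $\omega=k^{p/2}$, $C_k=\omega^{2-4/p}$, $g(\lambda)=1-\sqrt{1-\lambda}$ for $\lambda<1$. Let $0\ne A_0\in H^N(\mathbb R^2)$ with $N>s+21$, let $T_1>0$, $\mathscr T_1\ge0$ satisfy $T_1+\mathscr T_1\le 2\omega^{4/p-1}\mathbf T$, and define $$\lambda(f)=\frac{\|\Lambda^s_\epsilon f\|^2}{\nu^2\omega^4\|A_0\|_{H^s}^2},\qquad \mathcal N(z,t)=\omega^2\mathcal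 B_k\bigl(\epsilon^{q+4}z+2i(\epsilon^7t+\epsilon^5(T_1+\mathscr T_1))\,z|z|^{q-1}\bigr).$$ The progenitor equation is $$z_{tt}+|D|^pz+C_k\epsilon^2\mathcal B_k(z|z/\epsilon|^{q-1})+\mathcal N(z,t)\,g(\lambda(z_{tt}))=0,\tag{E}$$ and $\mathfrak w\in L^2$ is called compatible with $\mathfrak z\in L^2$ if $$\mathfrak w=-|D|^p\mathfrak z-C_k\epsilon^2\mathcal B_k(\mathfrak z|\mathfrak z/\epsilon|^{q-1})-\mathcal N(\mathfrak z,0)\,g(\lambda(\mathfrak w)).$$ **Proposition.** There are a universal constant $\mathscr C>1$, a constant $K>0$ depending only on $s,q$, and a positive function $t_0=t_0(\epsilon,k,s,p,q,\delta)$ such that the following holds. (a) There is an $\epsilon_0>0$ depending only on $s,p,q,k,\nu,\mathbf T,N,\|A_0\|_{H^s},\|A_0\|_{H^N}$ such that for all $0<\epsilon<\epsilon_0$, with $z(0)=\mathcal B_k\bigl(\epsilon A_0(\epsilon x,\epsilon y)e^{ikx}\bigr)$, there is a $\mathfrak w_0\in L^2$ compatible with $z(0)$ and satisfying $\lambda(\mathfrak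 w_0)\le\frac12+\frac1{2\nu^2}<1$. (b) There is an $\epsilon_0>0$ depending only on $s,p,q,k,\nu,\mathbf T,\|A_0\|_{H^s}$ such that the following holds for all $0<\epsilon<\epsilon_0$, provided that $K\omega^{4/p-1}\mathbf T\|A_0\|_{L^\infty}^{q-1}\le1$. Let $u_0,v_0,w_0\in L^2$ satisfy $u_0=\mathcal B_ku_0$, $v_0=\mathcal B_kv_0$, $w_0=\mathcal B_kw_0$, $$\max(\|u_0\|,\omega^{-1}\|v_0\|,\omega^{-2}\|w_0\|)\le2\|A_0\|_{H^s},\qquad\|\Lambda^{-s}_\epsilon u_0\|_{L^\infty}\le2\epsilon\|A_0\|_{L^\infty},$$ let $\Lambda^{-s}_\epsilon w_0$ be compatible with $\Lambda^{-s}_\epsilon u_0$, and suppose that $\lambda_0:=\lambda(\Lambda^{-s}_\epsilon w_0)<1$ satisfies $g'(\lambda_0)\le16\,\epsilon^{-(q+4)}/\mathscr C$. Then there are a time $\mathbf t>t_0(\epsilon,k,s,p,q,1-\lambda_0)$ and a function $z$ on $\mathbb R^2\times[0,\mathbf t]$, differentiable in time as a map into $L^2$, whose derivative $z_t$ is absolutely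 continuous, $z_t(t)=z_t(0)+\int_0^tz_{tt}$, with an everywhere defined $z_{tt}$, such that $(z,z_t,z_{tt})(0)=(\Lambda^{-s}_\epsilon u_0,\Lambda^{-s}_\epsilon v_0,\Lambda^{-s}_\epsilon w_0)$ and 1. $\Lambda^s_\epsilon z_{tt}(x,y,t)$ is a bounded measurable function on $\mathbb R^2\times[0,\mathbf t]$, $\Lambda^s_\epsilon z_{tt}\in L^\infty([0,\mathbf t],L^2)$, and (E) holds for every $(x,y)\in\mathbb R^2$ and almost every $t\in[0,\mathbf t]$, and in particular at $t=\mathbf t$; 2. $z(t)=\mathcal B_kz(t)$, and likewise for $z_t(t)$ and $z_{tt}(t)$, for every $t\in[0,\mathbf t]$; 3. $\Lambda^s_\epsilon z,\Lambda^s_\epsilon z_t\in C([0,\mathbf t],L^2)$ and $\max(\|\Lambda^s_\epsilon z(t)\|,\omega^{-1}\|\Lambda^s_\epsilon z_t(t)\|)\le3\|A_0\|_{H^s}$ for every $t\in[0,\mathbf t]$; 4. $|\lambda(z_{tt}(t))-\lambda_0|\le\frac12(1-\lambda_0)$ for every $t\in[0,\mathbf t]$. -/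

import Mathlib

open MeasureTheory FourierTransform

namespace Progenitor

noncomputable section

/-- The Euclidean plane, the space of the variables `(x, y)` and of the frequencies `ξ`. -/
abbrev Plane : Type := EuclideanSpace ℝ (Fin 2)

/-- The complex Hilbert space `L²(ℝ²)`. -/
abbrev L2 : Type := Lp (α := Plane) ℂ 2 volume

open Classical in
/-- The class in `L²` of a square integrable function (and `0` if it is not square integrable). -/
def toL2 (f : Plane → ℂ) : L2 :=
  if h : MemLp f 2 volume then h.toLp f else 0

/-! ### Fourier multipliers

Mathlib's Fourier transform uses the character `exp (-2πi x·η)`, so that the frequency `ξ` of the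
character `exp (-i x·ξ)` is `ξ = 2πη`: the multiplier with symbol `m(ξ)` acts as multiplication by
`m(2πη)`. -/

/-- The function `η ↦ m(2πη) 𝓕f(η)`. -/
def symbolMul (m : Plane → ℝ) (f : L2) : Plane → ℂ :=
  fun η => (m ((2 * Real.pi) • η) : ℂ) * (𝓕 f : L2) η

/-- `f` lies in the `L²`-domain of the Fourier multiplier with symbol `m`. -/
def InDomain (m : Plane → ℝ) (f : L2) : Prop :=
  MemLp (symbolMul m f) 2 volume

/-- The Fourier multiplier with symbol `m`, on its `L²`-domain (and `0` off that domain). -/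
def multiplier (m : Plane → ℝ) (f : L2) : L2 :=
  (𝓕⁻ (toL2 (symbolMul m f)) : L2)

/-- The unit vector `e₁ = (1, 0)`. -/
def e1 : Plane := EuclideanSpace.single 0 1

/-- The symbol `(|ξ|² + 1)^(s/2)` of `Λˢ`. -/
def besselSymbol (s : ℝ) : Plane → ℝ := fun ξ => (‖ξ‖ ^ 2 + 1) ^ (s / 2)

/-- The symbol `|ξ|ᵖ` of `|D|ᵖ`. -/
def rieszSymbol (p : ℝ) : Plane → ℝ := fun ξ => ‖ξ‖ ^ p

/-- The symbol of `𝓑ₖ`: the characteristic function of `{ξ : |ξ - k e₁| ≤ k/2}`. -/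
def bandSymbol (k : ℝ) : Plane → ℝ :=
  Set.indicator (Metric.closedBall (k • e1) (k / 2)) 1

/-- The rescaled symbol `m_ε(ξ) = m((ξ - k e₁)/ε)`. -/
def rescaledSymbol (k ε : ℝ) (m : Plane → ℝ) : Plane → ℝ :=
  fun ξ => m (ε⁻¹ • (ξ - k • e1))

/-- `Λˢ_ε`. -/
def Lam (s k ε : ℝ) (f : L2) : L2 := multiplier (rescaledSymbol k ε (besselSymbol s)) f

/-- `|D|ᵖ`. -/
def absD (p : ℝ) (f : L2) : L2 := multiplier (rieszSymbol p) f

/-- The mode filter `𝓑ₖ`. -/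
def band (k : ℝ) (f : L2) : L2 := multiplier (bandSymbol k) f

/-- `f ∈ Hˢ(ℝ²)` (for `s ≥ 0`). -/
def MemH (s : ℝ) (f : L2) : Prop := InDomain (besselSymbol s) f

/-- `‖f‖_{Hˢ} = ‖Λˢ f‖`. -/
def sobNorm (s : ℝ) (f : L2) : ℝ := ‖multiplier (besselSymbol s) f‖

/-- `‖f‖_{L^∞}` as a real number, for an essentially bounded `f`. -/
def supNorm (f : L2) : ℝ := (eLpNorm f ⊤ volume).toReal

/-- The value at `x` of the continuous representative of `f`, by Fourier inversion. It is used for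
functions `f = 𝓑ₖ f`, whose Fourier transform is integrable since it has compact support. -/
def pointValue (f : L2) (x : Plane) : ℂ := 𝓕⁻ ((𝓕 f : L2) : Plane → ℂ) x

/-! ### The progenitor equation -/

/-- The frequency `ω > 0`, given by `ω² = kᵖ`. -/
def freq (p k : ℝ) : ℝ := k ^ (p / 2)

/-- The coefficient `C_k = ω^(2 - 4/p)` of the power nonlinearity. -/
def powCoeff (p k : ℝ) : ℝ := freq p k ^ (2 - 4 / p)

/-- The nonlinearity `z |z/r|^(q-1)`. -/
def powTerm (q : ℕ) (r : ℝ) (z : L2) : L2 :=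
  toL2 fun x => z x * (((‖z x‖ / r) ^ (q - 1) : ℝ) : ℂ)

/-- The term `C_k ε² 𝓑ₖ(z |z/ε|^(q-1))`. -/
def semilinear (q : ℕ) (p k ε : ℝ) (z : L2) : L2 :=
  ((powCoeff p k * ε ^ 2 : ℝ) : ℂ) • band k (powTerm q ε z)

/-- The coefficient
`𝒩 = ω² 𝓑ₖ(ε^(q+4) z + 2i (ε⁷ t + ε⁵ T) z |z|^(q-1))` of the penalization term. -/
def penal (q : ℕ) (p k ε T t : ℝ) (z : L2) : L2 :=
  ((freq p k ^ 2 : ℝ) : ℂ) •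
    band k (((ε ^ (q + 4) : ℝ) : ℂ) • z +
      (2 * Complex.I * ((ε ^ 7 * t + ε ^ 5 * T : ℝ) : ℂ)) • powTerm q 1 z)

/-- `g(λ) = 1 - √(1 - λ)`, used for `0 ≤ λ < 1`. -/
def pen (l : ℝ) : ℝ := 1 - Real.sqrt (1 - l)

/-- The control functional `λ(f) = ‖Λˢ_ε f‖² / (ν² ω⁴ ‖A₀‖²_{Hˢ})`. -/
def controlNorm (s p k ε ν : ℝ) (A₀ : L2) (f : L2) : ℝ :=
  ‖Lam s k ε f‖ ^ 2 / (ν ^ 2 * freq p k ^ 4 * sobNorm s A₀ ^ 2)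

/-- The datum `z(0) = 𝓑ₖ z̃(0)`, where `z̃(0) = ε A₀(εx, εy) e^{ikx}`. -/
def packetDatum (k ε : ℝ) (A₀ : L2) : L2 :=
  band k (toL2 fun x => (ε : ℂ) * A₀ (ε • x) * Complex.exp (Complex.I * ((k * x 0 : ℝ) : ℂ)))

/-- The compatibility condition
`𝔴 = -|D|ᵖ 𝔷 - C_k ε² 𝓑ₖ(𝔷 |𝔷/ε|^(q-1)) - g(λ(𝔴)) 𝒩(0)` between `𝔷 = z(0)` and `𝔴 = z_tt(0)`. -/
def Compatible (q : ℕ) (s p k ε ν T : ℝ) (A₀ 𝔷 𝔴 : L2) : Prop :=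
  𝔴 = -absD p 𝔷 - semilinear q p k ε 𝔷
    - ((pen (controlNorm s p k ε ν A₀ 𝔴) : ℝ) : ℂ) • penal q p k ε T 0 𝔷

/-- At time `t` the progenitor equation
`z_tt + |D|ᵖ z + C_k ε² 𝓑ₖ(z |z/ε|^(q-1)) + g(λ(z_tt)) 𝒩 = 0`
holds at every point of the plane, for the values `z = z(t)` and `ztt = z_tt(t)`. -/
def EquationAt (q : ℕ) (s p k ε ν T : ℝ) (A₀ : L2) (t : ℝ) (z ztt : L2) : Prop :=
  ∀ x : Plane,
    pointValue ztt x + pointValue (absD p z) x + pointValue (semilinear q p k ε z) x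
      + ((pen (controlNorm s p k ε ν A₀ ztt) : ℝ) : ℂ) * pointValue (penal q p k ε T t z) x = 0

/-- `z`, with first and second time derivatives `zt` and `ztt`, is a solution on `[0, t₁]` of the
progenitor equation, for every point of the plane and almost every time, and also at the time
`t = t₁`. -/
structure IsSolution (q : ℕ) (s p k ε ν T : ℝ) (A₀ : L2) (t₁ : ℝ) (z zt ztt : ℝ → L2) : Prop where
  /-- `z` is differentiable in time with values in `L²`, with derivative `zt`. -/
  hasDeriv : ∀ t ∈ Set.Icc 0 t₁, HasDerivWithinAt z (zt t) (Set.Icc 0 t₁) t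
  /-- `ztt` is integrable and `zt` is absolutely continuous in time with derivative `ztt`. -/
  integrable : IntervalIntegrable ztt volume 0 t₁
  eq_integral : ∀ t ∈ Set.Icc 0 t₁, zt t = zt 0 + ∫ τ in (0 : ℝ)..t, ztt τ
  /-- `Λˢ_ε z_tt(x, y, t)` is a bounded measurable function on `ℝ² × [0, t₁]`. -/
  measurable_ztt : Measurable fun y : Set.Icc 0 t₁ × Plane =>
    pointValue (Lam s k ε (ztt y.1)) y.2
  bounded_ztt : ∃ B : ℝ, ∀ t ∈ Set.Icc 0 t₁, ∀ x, ‖pointValue (Lam s k ε (ztt t)) x‖ ≤ B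
  /-- `Λˢ_ε z_tt ∈ L^∞([0, t₁], L²)`. -/
  memLp_ztt : MemLp (fun t => Lam s k ε (ztt t)) ⊤ (volume.restrict (Set.Icc 0 t₁))
  /-- The equation holds almost everywhere in time, and at the final time. -/
  equation : ∀ᵐ t ∂volume.restrict (Set.Icc 0 t₁), EquationAt q s p k ε ν T A₀ t (z t) (ztt t)
  equation_end : EquationAt q s p k ε ν T A₀ t₁ (z t₁) (ztt t₁)

end

end Progenitor

open Progenitor

/-! Equation (E) is implicit in `z_tt`, but only through one scalar. Put γ = g(λ(z_tt)), so that λ =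
2γ - γ² with γ ≤ 1. If F is the force -|D|ᵖz - C_k ε² 𝓑ₖ(z|z/ε|^(q-1)), and f, n are the images of F
and 𝒩 under Λˢ_ε, then (E) says z_tt = F - γ𝒩 with ‖f - γn‖² = M(2γ - γ²), where M = ν²ω⁴‖A₀‖²_{Hˢ}.
This is a quadratic equation for γ. Its smaller root `penRoot` is explicit, and it is Lipschitz in
the data while the discriminant stays away from zero. With γ eliminated, (E) is an ordinary
differential equation z'' = V(t, z) in L². On band limited functions all the multipliers are bounded
and the L² norm controls the sup norm, so V is locally Lipschitz and Picard iteration applies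
(`exists_second_order`, `exists_uniform_solution`).

The discriminant must be bounded below at time zero. At a root, a quarter of it is the square of M(1
- γ) + ⟨f - γn, n⟩ (`penDisc_of_root`). The bound on g'(λ₀) says 1 - γ₀ ≥ 6ε^(q+4). The tame
estimate `exists_tame`, together with the smallness condition on the time and the envelope, gives
‖n‖ ≤ 3ω²‖A₀‖_{Hˢ} ε^(q+4). Since ν > 1, the first term dominates the inner product
(`nondegenerate_of_bounds`).

The constant of the tame estimate must not depend on k or ε. An odd power z|z|^(2m) has m + 1
factors z and m conjugates, so it sends a spectrum in a disc about the carrier to a disc about the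
same carrier with 2m + 1 times the radius. The high frequencies of the power are therefore
controlled by those of z (`lintegral_tail_powTerm_le`), and integrating over all radii gives the
weighted norm.

The existence time depends only on ε, k, s, p, q and 1 - λ₀ because small ε confines ‖A₀‖_{Hˢ} to
[ε, 1/ε] and 𝐓 to (0, 1/ε], and M is treated as one more bounded variable of the vector field.

For part (a), compatibility is a fixed point problem for λ on an interval (`exists_pen_fixedPoint`).
The interval is mapped into itself because |D|ᵖ acts on the wave packet as ω² up to O(ε) while the
other terms are O(ε), and ν > 1 leaves room for these errors. -/

namespace Progenitor

/-! ### The Fourier transform of square integrable and of integrable functions -/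

section Fourier

open SchwartzMap

/-- Two locally integrable functions with the same pairings against Schwartz functions agree. -/
theorem ae_eq_of_forall_schwartz {f g : Plane → ℂ} (hf : LocallyIntegrable f)
    (hg : LocallyIntegrable g) (h : ∀ φ : 𝓢(Plane, ℂ), ∫ x, φ x * f x = ∫ x, φ x * g x) :
    f =ᵐ[volume] g := by
  refine ae_eq_of_integral_contDiff_smul_eq hf hg fun u hu hc => ?_
  have h1 : HasCompactSupport (fun x => (u x : ℂ)) := hc.comp_left (g := Complex.ofReal) (by simp)
  have h2 : ContDiff ℝ ((⊤ : ℕ∞) : WithTop ℕ∞) (fun x => (u x : ℂ)) :=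
    Complex.ofRealCLM.contDiff.comp hu
  simpa using h (h1.toSchwartzMap h2)

theorem locallyIntegrable_L2 (f : L2) : LocallyIntegrable f :=
  (Lp.memLp f).locallyIntegrable (by norm_num)

theorem integral_schwartz_mul_fourierInv_L2 (φ : 𝓢(Plane, ℂ)) (g : L2) :
    ∫ x, φ x * (𝓕⁻ g : L2) x = ∫ x, (𝓕⁻ φ : 𝓢(Plane, ℂ)) x * g x := by
  have h := congrArg (fun T => T φ) (Lp.fourierInv_toTemperedDistribution_eq g)
  simp only [TemperedDistribution.fourierInv_apply, Lp.toTemperedDistribution_apply,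
    smul_eq_mul] at h
  exact h.symm

theorem integral_fourierInv_mul_of_integrable {f g : Plane → ℂ} (hf : Integrable f)
    (hg : Integrable g) : ∫ x, 𝓕⁻ f x * g x = ∫ x, f x * 𝓕⁻ g x := by
  have hc : Continuous fun p : Plane × Plane => (-innerₗ Plane) p.1 p.2 :=
    (continuous_inner (𝕜 := ℝ) (E := Plane)).neg
  have h := VectorFourier.integral_fourierIntegral_smul_eq_flip (μ := volume) (ν := volume)
    (L := -innerₗ Plane) Real.continuous_fourierChar hc hf hg
  have hflip : (-innerₗ Plane).flip = -innerₗ Plane := by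
    ext x y
    simp [real_inner_comm]
  rw [hflip] at h
  exact h

theorem continuous_fourierInv {g : Plane → ℂ} (hg : Integrable g) : Continuous (𝓕⁻ g) := by
  have hc : Continuous fun p : Plane × Plane => (-innerₗ Plane) p.1 p.2 :=
    (continuous_inner (𝕜 := ℝ) (E := Plane)).neg
  exact VectorFourier.fourierIntegral_continuous Real.continuous_fourierChar hc hg

theorem norm_fourierInv_le (g : Plane → ℂ) (x : Plane) : ‖𝓕⁻ g x‖ ≤ ∫ η, ‖g η‖ :=
  VectorFourier.norm_fourierIntegral_le_integral_norm _ _ _ _ _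

/-- The transform on L² is an abstract extension. Pairing with Schwartz functions, where the
transform can be moved to the other factor in both theories, identifies it with the integral. -/
theorem coe_fourierInv_ae (g : L2) (hg : Integrable g) :
    ((𝓕⁻ g : L2) : Plane → ℂ) =ᵐ[volume] 𝓕⁻ (g : Plane → ℂ) := by
  refine ae_eq_of_forall_schwartz (locallyIntegrable_L2 _)
    (continuous_fourierInv hg).locallyIntegrable fun φ => ?_
  rw [integral_schwartz_mul_fourierInv_L2, ← integral_fourierInv_mul_of_integrable φ.integrable hg,
    SchwartzMap.fourierInv_coe]

theorem fourier_ae_of_eq_fourierInv {f : L2} {c : Plane → ℂ} (hc : Integrable c)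
    (h : (f : Plane → ℂ) =ᵐ[volume] 𝓕⁻ c) : ((𝓕 f : L2) : Plane → ℂ) =ᵐ[volume] c := by
  refine ae_eq_of_forall_schwartz (locallyIntegrable_L2 _) hc.locallyIntegrable fun φ => ?_
  have h1 := integral_schwartz_mul_fourierInv_L2 (𝓕 φ) (𝓕 f : L2)
  rw [FourierTransform.fourierInv_fourier_eq, FourierTransform.fourierInv_fourier_eq] at h1
  rw [← h1]
  have h2 : ∫ x, (𝓕 φ : 𝓢(Plane, ℂ)) x * f x = ∫ x, (𝓕 φ : 𝓢(Plane, ℂ)) x * 𝓕⁻ c x := by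
    refine integral_congr_ae ?_
    filter_upwards [h] with x hx
    rw [hx]
  rw [h2, ← integral_fourierInv_mul_of_integrable (𝓕 φ : 𝓢(Plane, ℂ)).integrable hc,
    ← SchwartzMap.fourierInv_coe, FourierTransform.fourierInv_fourier_eq]

end Fourier

/-! ### Functions with compactly supported integrable spectrum -/

section Spectrum

open scoped ComplexConjugate Convolution

/-- `F` is the inverse Fourier transform of an integrable function supported in the frequency disc
`{ξ : |ξ - c| ≤ ρ}`. -/
def HasSpec (F : Plane → ℂ) (c : Plane) (ρ : ℝ) : Prop :=
  ∃ a : Plane → ℂ, Integrable a ∧ (∀ η, ρ < ‖(2 * Real.pi) • η - c‖ → a η = 0) ∧ F = 𝓕⁻ a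

/-- The spectrum of a product is the convolution of the spectra, so centres and radii add. -/
theorem HasSpec.mul {F G : Plane → ℂ} {c d : Plane} {ρ σ : ℝ} (hF : HasSpec F c ρ)
    (hG : HasSpec G d σ) : HasSpec (fun x => F x * G x) (c + d) (ρ + σ) := by
  obtain ⟨a, ha, has, rfl⟩ := hF
  obtain ⟨b, hb, hbs, rfl⟩ := hG
  refine ⟨a ⋆[ContinuousLinearMap.mul ℂ ℂ] b, ha.integrable_convolution _ hb, fun η hη => ?_, ?_⟩
  · refine integral_eq_zero_of_ae (Filter.Eventually.of_forall fun t => ?_)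
    by_cases h1 : ρ < ‖(2 * Real.pi) • t - c‖
    · simp [has t h1]
    · have h2 : σ < ‖(2 * Real.pi) • (η - t) - d‖ := by
        have h3 : (2 * Real.pi) • η - (c + d)
            = ((2 * Real.pi) • t - c) + ((2 * Real.pi) • (η - t) - d) := by
          rw [smul_sub]; abel
        have h4 := norm_add_le ((2 * Real.pi) • t - c) ((2 * Real.pi) • (η - t) - d)
        rw [← h3] at h4
        linarith
      simp [hbs _ h2]
  · funext x
    rw [Real.fourierInv_eq_fourier_neg, Real.fourierInv_eq_fourier_neg,
      Real.fourierInv_eq_fourier_neg, Real.fourier_mul_convolution_eq ha hb]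

theorem HasSpec.conj {F : Plane → ℂ} {c : Plane} {ρ : ℝ} (hF : HasSpec F c ρ) :
    HasSpec (fun x => conj (F x)) (-c) ρ := by
  obtain ⟨a, ha, has, rfl⟩ := hF
  refine ⟨fun η => conj (a (-η)), ?_, fun η hη => ?_, ?_⟩
  · exact (Complex.conjLIE.toContinuousLinearEquiv : ℂ →L[ℝ] ℂ).integrable_comp ha.comp_neg
  · have : ρ < ‖(2 * Real.pi) • (-η) - c‖ := by
      rw [← norm_neg]; simpa [add_comm, sub_eq_add_neg] using hη
    simp [has _ this]
  · funext x
    rw [Real.fourierInv_eq', Real.fourierInv_eq', ← integral_conj,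
      ← integral_neg_eq_self]
    refine integral_congr_ae (Filter.Eventually.of_forall fun η => ?_)
    simp only [inner_neg_left, smul_eq_mul, map_mul, ← Complex.exp_conj, Complex.conj_ofReal,
      Complex.conj_I]
    congr 2
    push_cast
    ring

/-- Each factor |F|² = F · conj F moves the centre by c - c = 0 and enlarges the radius by 2ρ. This
is where oddness of the exponent q enters: the spectrum stays centred at the carrier. -/
theorem HasSpec.odd_power {F : Plane → ℂ} {c : Plane} {ρ : ℝ} (hF : HasSpec F c ρ) (m : ℕ) :
    HasSpec (fun x => F x * (((‖F x‖ ^ 2) ^ m : ℝ) : ℂ)) c ((2 * m + 1) * ρ) := by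
  induction m with
  | zero => simpa using hF
  | succ m ih =>
    have h := (ih.mul hF).mul hF.conj
    convert h using 1
    · funext x
      have : ((‖F x‖ ^ 2 : ℝ) : ℂ) = F x * conj (F x) := by
        rw [Complex.mul_conj, Complex.normSq_eq_norm_sq]
      rw [pow_succ, Complex.ofReal_mul, this]
      ring
    · abel
    · push_cast; ring

end Spectrum

end Progenitor

namespace Progenitor

/-! ### Smooth frequency truncation -/

section Truncation

open SchwartzMap

theorem norm_le_of_ae_norm_le {g : Plane → ℂ} (hg : Continuous g) {M : ℝ}
    (h : ∀ᵐ x, ‖g x‖ ≤ M) (x : Plane) : ‖g x‖ ≤ M := by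
  by_contra hx
  have ho : IsOpen {x | M < ‖g x‖} := isOpen_lt continuous_const hg.norm
  have h0 : volume {x | M < ‖g x‖} = 0 := by simpa [ae_iff] using h
  have he := ho.measure_eq_zero_iff volume |>.1 h0
  exact absurd (show x ∈ {x | M < ‖g x‖} by simpa using hx) (by simp [he])

theorem continuous_circle_coe : Continuous fun z : Circle => (z : ℂ) := continuous_subtype_val

/-- Truncation at any scale and centre averages translates of the function against one fixed kernel
ψ times a unimodular factor. The L¹ norm of the kernel, hence the sup norm bound, does not see r or
c. -/
theorem fourierInv_dilated_mul (ψ : 𝓢(Plane, ℂ)) (r : ℝ) (c : Plane) {a : Plane → ℂ}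
    (ha : Integrable a) (x : Plane) :
    𝓕⁻ (fun η => 𝓕 (ψ : Plane → ℂ) (r • ((2 * Real.pi) • η - c)) * a η) x
      = ∫ v, ((Real.fourierChar (r * inner ℝ v c) : Circle) : ℂ) * ψ v
          * 𝓕⁻ a (x - (r * (2 * Real.pi)) • v) := by
  have hint : Integrable (fun p : Plane × Plane => ψ p.2 * a p.1) (volume.prod volume) := by
    simpa [mul_comm] using ha.mul_prod (ψ.integrable (μ := volume))
  have hint2 : Integrable (fun p : Plane × Plane =>
      ((Real.fourierChar (inner ℝ p.1 x) : Circle) : ℂ) *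
      (((Real.fourierChar (-inner ℝ p.2 (r • ((2 * Real.pi) • p.1 - c))) : Circle) : ℂ)
        * (ψ p.2 * a p.1))) (volume.prod volume) := by
    refine hint.mono ?_ (Filter.Eventually.of_forall fun p => by simp [Circle.norm_coe])
    have h1 : Continuous fun p : Plane × Plane =>
        ((Real.fourierChar (inner ℝ p.1 x) : Circle) : ℂ) :=
      continuous_circle_coe.comp (Real.continuous_fourierChar.comp (by fun_prop))
    have h2 : Continuous fun p : Plane × Plane =>
        ((Real.fourierChar (-inner ℝ p.2 (r • ((2 * Real.pi) • p.1 - c))) : Circle) : ℂ) :=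
      continuous_circle_coe.comp (Real.continuous_fourierChar.comp (by fun_prop))
    exact h1.aestronglyMeasurable.mul (h2.aestronglyMeasurable.mul hint.aestronglyMeasurable)
  calc _ = ∫ η, ∫ v, ((Real.fourierChar (inner ℝ η x) : Circle) : ℂ) *
      (((Real.fourierChar (-inner ℝ v (r • ((2 * Real.pi) • η - c))) : Circle) : ℂ)
        * (ψ v * a η)) := by
        rw [Real.fourierInv_eq]
        congr with η
        rw [integral_const_mul, Circle.smul_def, smul_eq_mul, Real.fourier_eq]
        congr 1
        rw [← integral_mul_const]
        congr with v
        rw [Circle.smul_def, smul_eq_mul]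
        ring
    _ = ∫ v, ∫ η, ((Real.fourierChar (inner ℝ η x) : Circle) : ℂ) *
      (((Real.fourierChar (-inner ℝ v (r • ((2 * Real.pi) • η - c))) : Circle) : ℂ)
        * (ψ v * a η)) := integral_integral_swap hint2
    _ = _ := by
        congr with v
        rw [Real.fourierInv_eq, ← integral_const_mul]
        congr with η
        rw [Circle.smul_def, smul_eq_mul]
        have h3 : ((Real.fourierChar (inner ℝ η x) : Circle) : ℂ) *
            ((Real.fourierChar (-inner ℝ v (r • ((2 * Real.pi) • η - c))) : Circle) : ℂ)
            = ((Real.fourierChar (r * inner ℝ v c) : Circle) : ℂ) *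
              ((Real.fourierChar (inner ℝ η (x - (r * (2 * Real.pi)) • v)) : Circle) : ℂ) := by
          rw [← Circle.coe_mul, ← Circle.coe_mul, ← AddChar.map_add_eq_mul,
            ← AddChar.map_add_eq_mul]
          congr 2
          simp only [inner_smul_right, inner_sub_right, real_inner_comm v η]
          ring
        linear_combination (ψ v * a η) * h3

/-- Smooth frequency truncations are bounded in the sup norm, uniformly in the scale. -/
theorem exists_truncation : ∃ φ : Plane → ℝ, Continuous φ ∧ (∀ y, 0 ≤ φ y) ∧ (∀ y, φ y ≤ 1) ∧
    (∀ y, ‖y‖ ≤ 1 / 2 → φ y = 1) ∧ (∀ y, 1 ≤ ‖y‖ → φ y = 0) ∧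
    ∃ C : ℝ, 1 ≤ C ∧ ∀ (r : ℝ) (c : Plane) (a : Plane → ℂ), Integrable a →
      ∀ M : ℝ, (∀ x, ‖𝓕⁻ a x‖ ≤ M) → ∀ x,
        ‖𝓕⁻ (fun η => (φ (r • ((2 * Real.pi) • η - c)) : ℂ) * a η) x‖ ≤ C * M := by
  let f : ContDiffBump (0 : Plane) := ⟨1 / 2, 1, by norm_num, by norm_num⟩
  have h1 : HasCompactSupport (fun x => (f x : ℂ)) :=
    f.hasCompactSupport.comp_left (g := Complex.ofReal) (by simp)
  have h2 : ContDiff ℝ ((⊤ : ℕ∞) : WithTop ℕ∞) (fun x => (f x : ℂ)) :=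
    Complex.ofRealCLM.contDiff.comp f.contDiff
  let Φ : 𝓢(Plane, ℂ) := h1.toSchwartzMap h2
  let ψ : 𝓢(Plane, ℂ) := 𝓕⁻ Φ
  have hψ : 𝓕 (ψ : Plane → ℂ) = fun x => (f x : ℂ) := by
    rw [← SchwartzMap.fourier_coe, FourierTransform.fourier_fourierInv_eq]
    rfl
  refine ⟨f, f.continuous, fun y => f.nonneg, fun y => f.le_one, fun y hy => ?_, fun y hy => ?_,
    max 1 (∫ v, ‖ψ v‖), le_max_left _ _, fun r c a ha M hM x => ?_⟩
  · exact f.one_of_mem_closedBall (mem_closedBall_zero_iff.2 hy)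
  · exact f.zero_of_le_dist (by simpa using hy)
  · have hM0 : 0 ≤ M := (norm_nonneg _).trans (hM 0)
    have h := fourierInv_dilated_mul ψ r c ha x
    rw [hψ] at h
    rw [h]
    calc _ ≤ ∫ v, ‖ψ v‖ * M := by
          refine norm_integral_le_of_norm_le (ψ.integrable.norm.mul_const M)
            (Filter.Eventually.of_forall fun v => ?_)
          rw [norm_mul, norm_mul, Circle.norm_coe, one_mul]
          exact mul_le_mul_of_nonneg_left (hM _) (norm_nonneg _)
      _ = (∫ v, ‖ψ v‖) * M := integral_mul_const _ _
      _ ≤ _ := mul_le_mul_of_nonneg_right (le_max_right _ _) hM0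

end Truncation

end Progenitor

namespace Progenitor

noncomputable section

/-! ### Fourier multipliers on `L²` -/

section Multipliers

theorem toL2_ae {f : Plane → ℂ} (h : MemLp f 2 volume) : (toL2 f : Plane → ℂ) =ᵐ[volume] f := by
  rw [toL2, dif_pos h]
  exact h.coeFn_toLp

theorem enorm_sq_eq_lintegral (f : L2) : ‖f‖ₑ ^ 2 = ∫⁻ x, ‖f x‖ₑ ^ 2 := by
  rw [Lp.enorm_def]
  have := eLpNorm_nnreal_pow_eq_lintegral (μ := volume) (f := (f : Plane → ℂ)) (p := 2) (by norm_num)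
  simpa using this

theorem norm_le_mul_norm_of_ae {f g : L2} {C : ℝ}
    (h : ∀ᵐ x, ‖f x‖ ≤ C * ‖g x‖) : ‖f‖ ≤ C * ‖g‖ :=
  Lp.norm_le_mul_norm_of_ae_le_mul h

theorem norm_fourier (f : L2) : ‖(𝓕 f : L2)‖ = ‖f‖ := Lp.norm_fourier_eq f

theorem eq_of_fourier_ae {f g : L2}
    (h : ((𝓕 f : L2) : Plane → ℂ) =ᵐ[volume] (𝓕 g : L2)) : f = g := by
  have h1 : (𝓕 f : L2) = 𝓕 g := Lp.ext h
  exact (Lp.fourierTransformₗᵢ Plane ℂ).injective h1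

theorem fourier_multiplier {m : Plane → ℝ} {f : L2} (h : InDomain m f) :
    ((𝓕 (multiplier m f) : L2) : Plane → ℂ) =ᵐ[volume] symbolMul m f := by
  rw [multiplier, FourierTransform.fourier_fourierInv_eq]
  exact toL2_ae h

theorem norm_multiplier {m : Plane → ℝ} (f : L2) :
    ‖multiplier m f‖ = ‖toL2 (symbolMul m f)‖ := by
  rw [← norm_fourier, multiplier, FourierTransform.fourier_fourierInv_eq]

theorem measurable_symbolMul {m : Plane → ℝ} (hm : Measurable m) (f : L2) :
    AEStronglyMeasurable (symbolMul m f) volume := by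
  refine AEStronglyMeasurable.mul ?_ (Lp.aestronglyMeasurable _)
  exact (Complex.measurable_ofReal.comp (hm.comp (measurable_const_smul _))).aestronglyMeasurable

/-- Comparison of two multipliers whose symbols are comparable on the spectrum. -/
theorem InDomain.mono {m m' : Plane → ℝ} (hm : Measurable m) {f g : L2} (h : InDomain m' g)
    {C : ℝ} (hle : ∀ᵐ η, ‖symbolMul m f η‖ ≤ C * ‖symbolMul m' g η‖) : InDomain m f :=
  MemLp.of_le_mul h (measurable_symbolMul hm f) hle

theorem norm_multiplier_le {m m' : Plane → ℝ} (hm : Measurable m) {f g : L2} (h : InDomain m' g)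
    {C : ℝ} (hle : ∀ᵐ η, ‖symbolMul m f η‖ ≤ C * ‖symbolMul m' g η‖) :
    ‖multiplier m f‖ ≤ C * ‖multiplier m' g‖ := by
  have h1 := h.mono hm hle
  rw [norm_multiplier, norm_multiplier]
  refine norm_le_mul_norm_of_ae ?_
  filter_upwards [toL2_ae h, toL2_ae h1, hle] with η h2 h3 h4
  rw [h2, h3]
  exact h4

theorem norm_symbolMul (m : Plane → ℝ) (f : L2) (η : Plane) :
    ‖symbolMul m f η‖ = |m ((2 * Real.pi) • η)| * ‖(𝓕 f : L2) η‖ := by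
  rw [symbolMul, norm_mul, Complex.norm_real, Real.norm_eq_abs]

theorem inDomain_of_bounded {m : Plane → ℝ} (hm : Measurable m) {C : ℝ} (hC : ∀ ξ, |m ξ| ≤ C)
    (f : L2) : InDomain m f := by
  refine MemLp.of_le_mul (Lp.memLp (𝓕 f : L2)) (measurable_symbolMul hm f) (c := C)
    (Filter.Eventually.of_forall fun η => ?_)
  rw [norm_symbolMul]
  exact mul_le_mul_of_nonneg_right (hC _) (norm_nonneg _)

theorem multiplier_eq_iff {m : Plane → ℝ} {f g : L2} (h : InDomain m f) :
    multiplier m f = g ↔ ((𝓕 g : L2) : Plane → ℂ) =ᵐ[volume] symbolMul m f := by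
  constructor
  · rintro rfl
    exact fourier_multiplier h
  · intro hg
    exact eq_of_fourier_ae ((fourier_multiplier h).trans hg.symm)

theorem fourier_add_ae (f g : L2) :
    ((𝓕 (f + g) : L2) : Plane → ℂ) =ᵐ[volume] fun η => (𝓕 f : L2) η + (𝓕 g : L2) η := by
  rw [FourierTransform.fourier_add]
  exact Lp.coeFn_add _ _

theorem fourier_sub_ae (f g : L2) :
    ((𝓕 (f - g) : L2) : Plane → ℂ) =ᵐ[volume] fun η => (𝓕 f : L2) η - (𝓕 g : L2) η := by
  rw [show (𝓕 (f - g) : L2) = 𝓕 f - 𝓕 g from (Lp.fourierTransformₗᵢ Plane ℂ).map_sub f g]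
  exact Lp.coeFn_sub _ _

theorem fourier_smul_ae (c : ℂ) (f : L2) :
    ((𝓕 (c • f) : L2) : Plane → ℂ) =ᵐ[volume] fun η => c * (𝓕 f : L2) η := by
  rw [FourierTransform.fourier_smul]
  exact Lp.coeFn_smul _ _

/-- The multiplier with a bounded measurable symbol, as a continuous linear map. -/
def boundedMultiplier (m : Plane → ℝ) (hm : Measurable m) (C : ℝ) (hC : ∀ ξ, |m ξ| ≤ C) :
    L2 →L[ℂ] L2 :=
  LinearMap.mkContinuous
    { toFun := multiplier m
      map_add' := fun f g => by
        rw [multiplier_eq_iff (inDomain_of_bounded hm hC _)]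
        filter_upwards [fourier_add_ae (multiplier m f) (multiplier m g), fourier_add_ae f g,
          fourier_multiplier (inDomain_of_bounded hm hC f),
          fourier_multiplier (inDomain_of_bounded hm hC g)] with η h1 h2 h3 h4
        rw [h1, h3, h4]
        simp only [symbolMul]
        rw [h2, mul_add]
      map_smul' := fun c f => by
        rw [multiplier_eq_iff (inDomain_of_bounded hm hC _)]
        filter_upwards [fourier_smul_ae c (multiplier m f), fourier_smul_ae c f,
          fourier_multiplier (inDomain_of_bounded hm hC f)] with η h1 h2 h3
        rw [RingHom.id_apply, h1, h3]
        simp only [symbolMul]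
        rw [h2]
        ring } C fun f => by
    change ‖multiplier m f‖ ≤ C * ‖f‖
    rw [norm_multiplier, ← norm_fourier f]
    refine norm_le_mul_norm_of_ae ?_
    filter_upwards [toL2_ae (inDomain_of_bounded hm hC f)] with η h
    rw [h, norm_symbolMul]
    exact mul_le_mul_of_nonneg_right (hC _) (norm_nonneg _)

end Multipliers

/-! ### Band limited functions -/

section Band

theorem measurable_bandSymbol (k : ℝ) : Measurable (bandSymbol k) :=
  measurable_one.indicator Metric.isClosed_closedBall.measurableSet

theorem bandSymbol_of_mem {k : ℝ} {ξ : Plane} (h : ‖ξ - k • e1‖ ≤ k / 2) : bandSymbol k ξ = 1 := by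
  have : ξ ∈ Metric.closedBall (k • e1) (k / 2) := by simpa [dist_eq_norm] using h
  simp [bandSymbol, this]

theorem bandSymbol_of_notMem {k : ℝ} {ξ : Plane} (h : ¬ ‖ξ - k • e1‖ ≤ k / 2) :
    bandSymbol k ξ = 0 := by
  have : ξ ∉ Metric.closedBall (k • e1) (k / 2) := by simpa [dist_eq_norm] using h
  simp [bandSymbol, this]

theorem abs_bandSymbol_le (k : ℝ) (ξ : Plane) : |bandSymbol k ξ| ≤ 1 := by
  by_cases h : ‖ξ - k • e1‖ ≤ k / 2
  · simp [bandSymbol_of_mem h]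
  · simp [bandSymbol_of_notMem h]

theorem exists_bound_on_band (k : ℝ) (m : C(Plane, ℝ)) :
    ∃ C : ℝ, ∀ ξ, |m ξ * bandSymbol k ξ| ≤ C := by
  obtain ⟨C, hC⟩ := (isCompact_closedBall (k • e1) (k / 2)).exists_bound_of_continuousOn
    (f := m) m.continuous.continuousOn
  refine ⟨max C 0, fun ξ => ?_⟩
  by_cases h : ‖ξ - k • e1‖ ≤ k / 2
  · rw [bandSymbol_of_mem h, mul_one]
    exact (hC ξ (by simpa [dist_eq_norm] using h)).trans (le_max_left _ _)
  · simp [bandSymbol_of_notMem h]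

/-- The composition of `𝓑ₖ` with the multiplier with a continuous symbol. -/
def bandOp (k : ℝ) (m : C(Plane, ℝ)) : L2 →L[ℂ] L2 :=
  boundedMultiplier (fun ξ => m ξ * bandSymbol k ξ)
    (m.continuous.measurable.mul (measurable_bandSymbol k)) _ (exists_bound_on_band k m).choose_spec

theorem fourier_bandOp (k : ℝ) (m : C(Plane, ℝ)) (f : L2) :
    ((𝓕 (bandOp k m f) : L2) : Plane → ℂ) =ᵐ[volume]
      symbolMul (fun ξ => m ξ * bandSymbol k ξ) f :=
  fourier_multiplier (inDomain_of_bounded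
    (m.continuous.measurable.mul (measurable_bandSymbol k)) (exists_bound_on_band k m).choose_spec f)

theorem eq_bandOp_of_ae {k : ℝ} {m : C(Plane, ℝ)} {f g : L2}
    (h : ((𝓕 g : L2) : Plane → ℂ) =ᵐ[volume] symbolMul (fun ξ => m ξ * bandSymbol k ξ) f) :
    g = bandOp k m f :=
  eq_of_fourier_ae (h.trans (fourier_bandOp k m f).symm)

theorem band_eq_bandOp (k : ℝ) (f : L2) : band k f = bandOp k 1 f := by
  refine eq_bandOp_of_ae ((fourier_multiplier
    (inDomain_of_bounded (measurable_bandSymbol k) (abs_bandSymbol_le k) f)).trans ?_)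
  exact Filter.Eventually.of_forall fun η => by simp [symbolMul]

theorem fourier_band (k : ℝ) (f : L2) :
    ((𝓕 (band k f) : L2) : Plane → ℂ) =ᵐ[volume] symbolMul (bandSymbol k) f :=
  fourier_multiplier (inDomain_of_bounded (measurable_bandSymbol k) (abs_bandSymbol_le k) f)

theorem bandSymbol_mul_self (k : ℝ) (ξ : Plane) :
    bandSymbol k ξ * bandSymbol k ξ = bandSymbol k ξ := by
  by_cases h : ‖ξ - k • e1‖ ≤ k / 2
  · simp [bandSymbol_of_mem h]
  · simp [bandSymbol_of_notMem h]

theorem bandOp_bandOp (k : ℝ) (m m' : C(Plane, ℝ)) (f : L2) :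
    bandOp k m (bandOp k m' f) = bandOp k (m * m') f := by
  refine eq_bandOp_of_ae ?_
  filter_upwards [fourier_bandOp k m (bandOp k m' f), fourier_bandOp k m' f] with η h1 h2
  rw [h1]
  simp only [symbolMul]
  rw [h2]
  simp only [symbolMul, ContinuousMap.mul_apply]
  have := congrArg (fun r : ℝ => (r : ℂ)) (bandSymbol_mul_self k ((2 * Real.pi) • η))
  push_cast at this ⊢
  linear_combination ((m ((2 * Real.pi) • η) : ℂ) * (m' ((2 * Real.pi) • η) : ℂ) *
    (𝓕 f : L2) η) * this

theorem band_bandOp (k : ℝ) (m : C(Plane, ℝ)) (f : L2) : band k (bandOp k m f) = bandOp k m f := by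
  rw [band_eq_bandOp, bandOp_bandOp, one_mul]

theorem bandOp_band (k : ℝ) (m : C(Plane, ℝ)) (f : L2) : bandOp k m (band k f) = bandOp k m f := by
  rw [band_eq_bandOp, bandOp_bandOp, mul_one]

theorem band_band (k : ℝ) (f : L2) : band k (band k f) = band k f := by
  rw [band_eq_bandOp k f, band_bandOp]

theorem fourier_eq_zero_of_band {k : ℝ} {f : L2} (hf : f = band k f) :
    ∀ᵐ η, ¬ ‖(2 * Real.pi) • η - k • e1‖ ≤ k / 2 → (𝓕 f : L2) η = 0 := by
  filter_upwards [fourier_band k f] with η h hη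
  rw [hf, h, symbolMul, bandSymbol_of_notMem hη]
  simp

theorem symbolMul_of_band {k : ℝ} {f : L2} (hf : f = band k f) (m : Plane → ℝ) :
    symbolMul m f =ᵐ[volume] symbolMul (fun ξ => m ξ * bandSymbol k ξ) f := by
  filter_upwards [fourier_eq_zero_of_band hf] with η h
  by_cases hη : ‖(2 * Real.pi) • η - k • e1‖ ≤ k / 2
  · simp [symbolMul, bandSymbol_of_mem hη]
  · simp [symbolMul, h hη]

theorem inDomain_of_band {k : ℝ} {f : L2} (hf : f = band k f) (m : C(Plane, ℝ)) :
    InDomain m f :=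
  (memLp_congr_ae (symbolMul_of_band hf m)).2 (inDomain_of_bounded
    (m.continuous.measurable.mul (measurable_bandSymbol k)) (exists_bound_on_band k m).choose_spec f)

/-- A continuous symbol is bounded on the compact band, so on band limited functions an unbounded
multiplier may be replaced by a continuous linear map on all of L². -/
theorem multiplier_of_band {k : ℝ} {f : L2} (hf : f = band k f) (m : C(Plane, ℝ)) :
    multiplier m f = bandOp k m f :=
  eq_bandOp_of_ae ((fourier_multiplier (inDomain_of_band hf m)).trans (symbolMul_of_band hf m))

theorem isFiniteMeasure_band (k : ℝ) :
    volume {η : Plane | ‖(2 * Real.pi) • η - k • e1‖ ≤ k / 2} < ⊤ := by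
  refine lt_of_le_of_lt (measure_mono (t := Metric.closedBall 0 ((2 * |k|) / (2 * Real.pi)))
    fun η hη => ?_) measure_closedBall_lt_top
  rw [mem_closedBall_zero_iff, le_div_iff₀ (by positivity)]
  have h1 : ‖(2 * Real.pi) • η‖ ≤ ‖(2 * Real.pi) • η - k • e1‖ + ‖k • e1‖ := by
    simpa using norm_add_le ((2 * Real.pi) • η - k • e1) (k • e1)
  have h2 : ‖k • e1‖ = |k| := by simp [e1, norm_smul]
  rw [norm_smul, Real.norm_of_nonneg (by positivity), h2] at h1
  have h3 : ‖(2 * Real.pi) • η - k • e1‖ ≤ k / 2 := hη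
  have h4 := le_abs_self k
  have h5 := abs_nonneg k
  linarith

/-- Cauchy–Schwarz. It serves with φ the indicator of the band, and with φ a negative power of the
Bessel weight for the embedding of H^r, r > 1. -/
theorem integral_norm_smul_le {φ : Plane → ℝ} (hφ : MemLp φ 2 volume) (g : L2) :
    Integrable (fun η => φ η • g η) ∧
      ∫ η, ‖φ η • g η‖ ≤ (eLpNorm φ 2 volume).toReal * ‖g‖ := by
  have hmem := Lp.memLp g
  have h1 := eLpNorm_smul_le_mul_eLpNorm (p := 2) (q := 2) (r := 1) hmem.1 hφ.1
  have htop := ENNReal.mul_lt_top hφ.2 hmem.2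
  have h3 : Integrable (fun η => φ η • g η) :=
    memLp_one_iff_integrable.1 ⟨hφ.1.smul hmem.1, h1.trans_lt htop⟩
  refine ⟨h3, ?_⟩
  rw [integral_norm_eq_lintegral_enorm h3.1, ← eLpNorm_one_eq_lintegral_enorm,
    Lp.norm_def, ← ENNReal.toReal_mul]
  exact ENNReal.toReal_mono htop.ne h1

theorem integral_norm_le_of_support {S : Set Plane} (hS : MeasurableSet S) (hfin : volume S < ⊤)
    (g : L2) (hg : ∀ᵐ η, η ∉ S → g η = 0) :
    Integrable g ∧
      ∫ η, ‖g η‖ ≤ (eLpNorm (S.indicator fun _ => (1 : ℝ)) 2 volume).toReal * ‖g‖ := by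
  have hχ : MemLp (S.indicator fun _ => (1 : ℝ)) 2 volume :=
    memLp_indicator_const 2 hS 1 (Or.inr hfin.ne)
  have hmul : (fun η => S.indicator (fun _ => (1 : ℝ)) η • g η) =ᵐ[volume] g := by
    filter_upwards [hg] with η h
    by_cases hη : η ∈ S
    · simp [hη]
    · simp [hη, h hη]
  obtain ⟨h1, h2⟩ := integral_norm_smul_le hχ g
  refine ⟨h1.congr hmul, ?_⟩
  rw [integral_congr_ae (show (fun η => ‖g η‖) =ᵐ[volume]
    fun η => ‖S.indicator (fun _ => (1 : ℝ)) η • g η‖ from hmul.symm.fun_comp norm)]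
  exact h2

theorem integral_norm_fourier_band_le (k : ℝ) : ∃ C : ℝ, 0 ≤ C ∧ ∀ f : L2, f = band k f →
    Integrable (𝓕 f : L2) ∧ ∫ η, ‖(𝓕 f : L2) η‖ ≤ C * ‖f‖ := by
  have hSm : MeasurableSet {η : Plane | ‖(2 * Real.pi) • η - k • e1‖ ≤ k / 2} :=
    (isClosed_le (by fun_prop) continuous_const).measurableSet
  refine ⟨(eLpNorm ({η : Plane | ‖(2 * Real.pi) • η - k • e1‖ ≤ k / 2}.indicator
    fun _ => (1 : ℝ)) 2 volume).toReal, ENNReal.toReal_nonneg, fun f hf => ?_⟩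
  rw [← norm_fourier f]
  exact integral_norm_le_of_support hSm (isFiniteMeasure_band k) (𝓕 f : L2)
    (fourier_eq_zero_of_band hf)

theorem integrable_fourier_of_band {k : ℝ} {f : L2} (hf : f = band k f) :
    Integrable (𝓕 f : L2) := by
  obtain ⟨C, -, hC⟩ := integral_norm_fourier_band_le k
  exact (hC f hf).1

theorem pointValue_ae {f : L2} (hf : Integrable (𝓕 f : L2)) :
    (f : Plane → ℂ) =ᵐ[volume] pointValue f := by
  have h := coe_fourierInv_ae (𝓕 f : L2) hf
  rwa [FourierTransform.fourierInv_fourier_eq] at h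

theorem continuous_pointValue {f : L2} (hf : Integrable (𝓕 f : L2)) :
    Continuous (pointValue f) := continuous_fourierInv hf

/-- Bernstein's inequality: the band has finite measure, so the L¹ norm of the spectrum, and with it
the sup norm, is bounded by the L² norm. -/
theorem norm_pointValue_band_le (k : ℝ) : ∃ C : ℝ, 0 ≤ C ∧ ∀ f : L2, f = band k f →
    ∀ x, ‖pointValue f x‖ ≤ C * ‖f‖ := by
  obtain ⟨C, hC0, hC⟩ := integral_norm_fourier_band_le k
  exact ⟨C, hC0, fun f hf x => (norm_fourierInv_le _ x).trans (hC f hf).2⟩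

theorem integrand_integrable {g : Plane → ℂ} (hg : Integrable g) (x : Plane) :
    Integrable fun η => Real.fourierChar (inner ℝ η x) • g η := by
  have := (Real.fourierIntegral_convergent_iff (-x)).2 hg
  simpa using this

theorem pointValue_add {f g : L2} (hf : Integrable (𝓕 f : L2)) (hg : Integrable (𝓕 g : L2))
    (x : Plane) : pointValue (f + g) x = pointValue f x + pointValue g x := by
  simp only [pointValue, Real.fourierInv_eq]
  rw [← integral_add (integrand_integrable hf x) (integrand_integrable hg x)]
  refine integral_congr_ae ?_
  filter_upwards [fourier_add_ae f g] with η h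
  rw [h, smul_add]

theorem pointValue_smul (c : ℂ) (f : L2) (x : Plane) :
    pointValue (c • f) x = c * pointValue f x := by
  simp only [pointValue, Real.fourierInv_eq]
  rw [← integral_const_mul]
  refine integral_congr_ae ?_
  filter_upwards [fourier_smul_ae c f] with η h
  rw [h, Circle.smul_def, Circle.smul_def, smul_eq_mul, smul_eq_mul]
  ring

theorem supNorm_le {f : L2} {M : ℝ} (hM : 0 ≤ M) (h : ∀ᵐ x, ‖f x‖ ≤ M) : supNorm f ≤ M := by
  rw [supNorm, eLpNorm_exponent_top]
  refine ENNReal.toReal_le_of_le_ofReal hM ?_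
  refine essSup_le_of_ae_le _ ?_
  filter_upwards [h] with x hx
  rw [← ofReal_norm]
  exact ENNReal.ofReal_le_ofReal hx

theorem norm_pointValue_le_supNorm {f : L2} (hf : Integrable (𝓕 f : L2)) (x : Plane) :
    ‖pointValue f x‖ ≤ supNorm f := by
  refine norm_le_of_ae_norm_le (continuous_pointValue hf) ?_ x
  have hfin : eLpNorm f ⊤ volume ≠ ⊤ := by
    rw [eLpNorm_congr_ae (pointValue_ae hf)]
    exact (memLp_top_of_bound (continuous_pointValue hf).aestronglyMeasurable _
      (Filter.Eventually.of_forall (norm_fourierInv_le _))).2.ne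
  have h := ae_le_eLpNormEssSup (f := (f : Plane → ℂ)) (μ := volume)
  filter_upwards [h, pointValue_ae hf] with y h1 h2
  rw [← h2, ← toReal_enorm, supNorm, eLpNorm_exponent_top]
  exact ENNReal.toReal_mono (by rwa [eLpNorm_exponent_top] at hfin) h1

theorem supNorm_nonneg (f : L2) : 0 ≤ supNorm f := ENNReal.toReal_nonneg

end Band

end

end Progenitor

namespace Progenitor

noncomputable section

/-! ### The power nonlinearity -/

section Power

/-- The pointwise nonlinearity `z |z/r|ⁿ`. -/
def powFun (n : ℕ) (r : ℝ) (z : ℂ) : ℂ := z * (((‖z‖ / r) ^ n : ℝ) : ℂ)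

theorem continuous_powFun (n : ℕ) (r : ℝ) : Continuous (powFun n r) := by
  unfold powFun
  fun_prop

theorem norm_powFun_sub_le (n : ℕ) {r R : ℝ} (hr : 0 < r) {a b : ℂ} (ha : ‖a‖ ≤ R)
    (hb : ‖b‖ ≤ R) : ‖powFun n r a - powFun n r b‖ ≤ (n + 1) * (R / r) ^ n * ‖a - b‖ := by
  have hR : 0 ≤ R := (norm_nonneg _).trans ha
  have h1 : powFun n r a - powFun n r b = (a - b) * (((‖a‖ / r) ^ n : ℝ) : ℂ)
      + b * (((‖a‖ / r) ^ n - (‖b‖ / r) ^ n : ℝ) : ℂ) := by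
    unfold powFun; push_cast; ring
  have h2 : |(‖a‖ / r) ^ n| ≤ (R / r) ^ n := by
    rw [abs_of_nonneg (by positivity)]
    gcongr
  have h3 : ‖b‖ * |(‖a‖ / r) ^ n - (‖b‖ / r) ^ n| ≤ n * (R / r) ^ n * ‖a - b‖ := by
    rcases n with _ | n
    · simp
    have h4 := abs_pow_sub_pow_le (‖a‖ / r) (‖b‖ / r) (n + 1)
    have h5 : |‖a‖ / r - ‖b‖ / r| ≤ ‖a - b‖ / r := by
      rw [← sub_div, abs_div, abs_of_pos hr]
      gcongr
      exact abs_norm_sub_norm_le a b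
    have h6 : max |‖a‖ / r| |‖b‖ / r| ≤ R / r := by
      rw [abs_of_nonneg (by positivity), abs_of_nonneg (by positivity)]
      exact max_le (by gcongr) (by gcongr)
    calc ‖b‖ * |(‖a‖ / r) ^ (n + 1) - (‖b‖ / r) ^ (n + 1)|
        ≤ R * (‖a - b‖ / r * (n + 1 : ℕ) * (R / r) ^ n) := by
          refine mul_le_mul hb (h4.trans ?_) (abs_nonneg _) hR
          rw [Nat.add_sub_cancel]
          gcongr
      _ = _ := by rw [pow_succ]; ring
  rw [h1]
  calc _ ≤ ‖a - b‖ * |(‖a‖ / r) ^ n| + ‖b‖ * |(‖a‖ / r) ^ n - (‖b‖ / r) ^ n| := by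
        refine (norm_add_le _ _).trans (le_of_eq ?_)
        rw [norm_mul, norm_mul, Complex.norm_real, Complex.norm_real, Real.norm_eq_abs,
          Real.norm_eq_abs]
    _ ≤ ‖a - b‖ * (R / r) ^ n + n * (R / r) ^ n * ‖a - b‖ := by gcongr
    _ = _ := by ring

theorem norm_powFun_le (n : ℕ) {r R : ℝ} (hr : 0 < r) {a : ℂ} (ha : ‖a‖ ≤ R) :
    ‖powFun n r a‖ ≤ (R / r) ^ n * ‖a‖ := by
  rw [powFun, norm_mul, Complex.norm_real, Real.norm_of_nonneg (by positivity), mul_comm]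
  gcongr

theorem memLp_powFun (n : ℕ) {r R : ℝ} (hr : 0 < r) {f : L2} (hf : ∀ᵐ x, ‖f x‖ ≤ R) :
    MemLp (fun x => powFun n r (f x)) 2 volume := by
  refine MemLp.of_le_mul (Lp.memLp f) (c := (R / r) ^ n)
    ((continuous_powFun n r).comp_aestronglyMeasurable (Lp.aestronglyMeasurable f)) ?_
  filter_upwards [hf] with x hx
  exact norm_powFun_le n hr hx

theorem powTerm_ae (q : ℕ) {r R : ℝ} (hr : 0 < r) {f : L2} (hf : ∀ᵐ x, ‖f x‖ ≤ R) :
    (powTerm q r f : Plane → ℂ) =ᵐ[volume] fun x => powFun (q - 1) r (f x) :=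
  toL2_ae (memLp_powFun (q - 1) hr hf)

theorem norm_powTerm_sub_le (q : ℕ) {r R : ℝ} (hr : 0 < r) {f g : L2} (hf : ∀ᵐ x, ‖f x‖ ≤ R)
    (hg : ∀ᵐ x, ‖g x‖ ≤ R) :
    ‖powTerm q r f - powTerm q r g‖ ≤ ((q - 1 : ℕ) + 1) * (R / r) ^ (q - 1) * ‖f - g‖ := by
  refine norm_le_mul_norm_of_ae ?_
  filter_upwards [powTerm_ae q hr hf, powTerm_ae q hr hg, hf, hg,
    Lp.coeFn_sub (powTerm q r f) (powTerm q r g), Lp.coeFn_sub f g] with x h1 h2 h3 h4 h5 h6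
  rw [h5, h6, Pi.sub_apply, Pi.sub_apply, h1, h2]
  exact norm_powFun_sub_le _ hr h3 h4

theorem norm_powTerm_le (q : ℕ) {r R : ℝ} (hr : 0 < r) {f : L2} (hf : ∀ᵐ x, ‖f x‖ ≤ R) :
    ‖powTerm q r f‖ ≤ (R / r) ^ (q - 1) * ‖f‖ := by
  refine norm_le_mul_norm_of_ae ?_
  filter_upwards [powTerm_ae q hr hf, hf] with x h1 h2
  rw [h1]
  exact norm_powFun_le _ hr h2

theorem powTerm_eq_smul (q : ℕ) {r R : ℝ} (hr : 0 < r) {f : L2} (hf : ∀ᵐ x, ‖f x‖ ≤ R) :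
    powTerm q r f = (((r⁻¹) ^ (q - 1) : ℝ) : ℂ) • powTerm q 1 f := by
  refine Lp.ext ?_
  filter_upwards [powTerm_ae q hr hf, powTerm_ae q one_pos hf,
    Lp.coeFn_smul (((r⁻¹) ^ (q - 1) : ℝ) : ℂ) (powTerm q 1 f)] with x h1 h2 h3
  rw [h1, h3, Pi.smul_apply, h2, powFun, powFun, smul_eq_mul, div_one, div_pow, inv_pow]
  push_cast
  ring

end Power

/-! ### The tame estimate for the power nonlinearity -/

section Tame

/-- The distance of the frequency `2πη` to `c`. -/
def freqDist (c η : Plane) : ℝ := ‖(2 * Real.pi) • η - c‖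

theorem continuous_freqDist (c : Plane) : Continuous (freqDist c) := by
  unfold freqDist
  fun_prop

/-- Let B be the smooth truncation of A to the disc of radius ρ. The power of B has no spectrum
beyond (2m + 1)ρ, so the tail of the power of A is the tail of a difference of two powers. That
difference is Lipschitz-controlled by ‖A - B‖, which sees only the frequencies of A beyond ρ/2.
Smoothness of the truncation keeps the sup norm of B comparable to that of A. -/
theorem lintegral_tail_powTerm_le (m : ℕ) : ∃ D : ℝ, 1 ≤ D ∧ ∀ (c : Plane) (ρ : ℝ), 0 < ρ →
    ∀ (A : L2) (M : ℝ), Integrable (𝓕 A : L2) → (∀ x, ‖pointValue A x‖ ≤ M) →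
    ∫⁻ η in {η | (2 * m + 1) * ρ < freqDist c η}, ‖(𝓕 (powTerm (2 * m + 1) 1 A) : L2) η‖ₑ ^ 2
      ≤ ENNReal.ofReal (D * M ^ (2 * m)) ^ 2 *
        ∫⁻ η in {η | ρ / 2 < freqDist c η}, ‖(𝓕 A : L2) η‖ₑ ^ 2 := by
  obtain ⟨φ, hφc, hφ0, hφ1, hφin, hφout, C, hC1, hC⟩ := exists_truncation
  refine ⟨(2 * m + 1) * C ^ (2 * m), ?_, fun c ρ hρ A M hA hM => ?_⟩
  · have : (1 : ℝ) ≤ C ^ (2 * m) := one_le_pow₀ hC1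
    have h2 : (1 : ℝ) ≤ 2 * m + 1 := by
      have : (0 : ℝ) ≤ m := Nat.cast_nonneg m
      linarith
    nlinarith
  have hM0 : 0 ≤ M := (norm_nonneg _).trans (hM 0)
  have hMC : M ≤ C * M := by nlinarith
  set F := powTerm (2 * m + 1) 1 A with hF
  set sy : Plane → ℝ := fun ξ => φ (ρ⁻¹ • (ξ - c)) with hsy
  have hsym : Measurable sy := (hφc.comp (by fun_prop)).measurable
  have hsyb : ∀ ξ, |sy ξ| ≤ 1 := fun ξ => by
    rw [abs_of_nonneg (hφ0 _)]; exact hφ1 _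
  have hdist : ∀ η : Plane, ‖ρ⁻¹ • ((2 * Real.pi) • η - c)‖ = freqDist c η / ρ := fun η => by
    rw [norm_smul, norm_inv, Real.norm_of_nonneg hρ.le, freqDist]; ring
  set B := multiplier sy A with hB
  have hBF : ((𝓕 B : L2) : Plane → ℂ) =ᵐ[volume] symbolMul sy A :=
    fourier_multiplier (inDomain_of_bounded hsym hsyb A)
  have hint : Integrable (symbolMul sy A) := by
    refine Integrable.mono hA (measurable_symbolMul hsym A) (Filter.Eventually.of_forall fun η => ?_)
    rw [norm_symbolMul]
    exact mul_le_of_le_one_left (norm_nonneg _) (hsyb _)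
  have hBi : Integrable (𝓕 B : L2) := hint.congr hBF.symm
  set b : Plane → ℂ := 𝓕⁻ (symbolMul sy A) with hb
  have hBb : (B : Plane → ℂ) =ᵐ[volume] b := by
    refine (pointValue_ae hBi).trans (Filter.Eventually.of_forall fun x => ?_)
    exact Real.fourierInv_congr_ae hBF x
  have hbM : ∀ x, ‖b x‖ ≤ C * M := fun x => hC ρ⁻¹ c _ hA M hM x
  have hBM : ∀ᵐ x, ‖B x‖ ≤ C * M := by
    filter_upwards [hBb] with x hx
    rw [hx]; exact hbM x
  have hAM : ∀ᵐ x, ‖A x‖ ≤ C * M := by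
    filter_upwards [pointValue_ae hA] with x hx
    rw [hx]; exact (hM x).trans hMC
  set G := powTerm (2 * m + 1) 1 B with hG
  have hspec : HasSpec b c ρ := by
    refine ⟨_, hint, fun η hη => ?_, rfl⟩
    have : φ (ρ⁻¹ • ((2 * Real.pi) • η - c)) = 0 := by
      refine hφout _ ?_
      rw [hdist, le_div_iff₀ hρ, one_mul]
      exact hη.le
    simp [symbolMul, hsy, this]
  obtain ⟨g, hgi, hgs, hgb⟩ := hspec.odd_power m
  have hGF : ((𝓕 G : L2) : Plane → ℂ) =ᵐ[volume] g := by
    refine fourier_ae_of_eq_fourierInv hgi ?_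
    filter_upwards [powTerm_ae (2 * m + 1) one_pos hBM, hBb] with x h1 h2
    rw [h1, h2, ← hgb, powFun, div_one, Nat.add_sub_cancel, pow_mul]
  have hsub := norm_powTerm_sub_le (2 * m + 1) one_pos hAM hBM
  rw [← hF, ← hG, Nat.add_sub_cancel, div_one, mul_pow] at hsub
  have hsub2 : ‖F - G‖ₑ ≤ ENNReal.ofReal ((2 * m + 1) * C ^ (2 * m) * M ^ (2 * m)) * ‖A - B‖ₑ := by
    rw [← ofReal_norm, ← ofReal_norm, ← ENNReal.ofReal_mul (by positivity)]
    refine ENNReal.ofReal_le_ofReal (hsub.trans (le_of_eq ?_))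
    push_cast; ring
  -- On this set the spectrum of G vanishes, so subtracting G changes nothing there but makes the
  -- Lipschitz bound available.
  calc _ = ∫⁻ η in {η | (2 * m + 1) * ρ < freqDist c η}, ‖(𝓕 (F - G) : L2) η‖ₑ ^ 2 := by
        refine setLIntegral_congr_fun_ae
          (isOpen_lt continuous_const (continuous_freqDist c)).measurableSet ?_
        filter_upwards [hGF, fourier_sub_ae F G] with η h1 h2 hη
        rw [h2, h1, hgs η hη, sub_zero]
    _ ≤ ∫⁻ η, ‖(𝓕 (F - G) : L2) η‖ₑ ^ 2 := setLIntegral_le_lintegral _ _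
    _ = ‖F - G‖ₑ ^ 2 := by
        rw [← enorm_sq_eq_lintegral, ← ofReal_norm, norm_fourier, ofReal_norm]
    _ ≤ (ENNReal.ofReal ((2 * m + 1) * C ^ (2 * m) * M ^ (2 * m)) * ‖A - B‖ₑ) ^ 2 := by gcongr
    _ = ENNReal.ofReal ((2 * m + 1) * C ^ (2 * m) * M ^ (2 * m)) ^ 2
          * ∫⁻ η, ‖(𝓕 (A - B) : L2) η‖ₑ ^ 2 := by
        rw [mul_pow, ← enorm_sq_eq_lintegral, ← ofReal_norm, ← ofReal_norm, norm_fourier]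
    _ ≤ _ := by
        refine mul_le_mul_right ?_ _
        rw [← lintegral_indicator
          (isOpen_lt continuous_const (continuous_freqDist c)).measurableSet]
        refine lintegral_mono_ae ?_
        filter_upwards [hBF, fourier_sub_ae A B] with η h1 h2
        rw [h2, h1]
        have h3 : (𝓕 A : L2) η - symbolMul sy A η
            = ((1 - sy ((2 * Real.pi) • η) : ℝ) : ℂ) * (𝓕 A : L2) η := by
          rw [symbolMul]; push_cast; ring
        rw [h3]
        by_cases hη : ρ / 2 < freqDist c η
        · rw [Set.indicator_of_mem (show η ∈ {η | ρ / 2 < freqDist c η} from hη)]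
          gcongr
          rw [← ofReal_norm, ← ofReal_norm]
          refine ENNReal.ofReal_le_ofReal ?_
          rw [norm_mul, Complex.norm_real, Real.norm_eq_abs]
          refine mul_le_of_le_one_left (norm_nonneg _) ?_
          rw [abs_le]
          have h4 := hφ0 (ρ⁻¹ • ((2 * Real.pi) • η - c))
          have h5 := hφ1 (ρ⁻¹ • ((2 * Real.pi) • η - c))
          constructor <;> simp only [hsy] <;> linarith
        · have h6 : sy ((2 * Real.pi) • η) = 1 := by
            refine hφin _ ?_
            rw [hdist, div_le_div_iff₀ hρ two_pos]
            linarith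
          rw [h6]
          simp

end Tame

end

end Progenitor

namespace Progenitor

noncomputable section

/-! ### The tame estimate in the rescaled Sobolev norm -/

section Tame

/-- The square of the symbol of `Λˢ_ε`, as a function of `η`. -/
def weight (s ε : ℝ) (c η : Plane) : ℝ := (1 + (freqDist c η / ε) ^ 2) ^ s

theorem one_le_weight {s : ℝ} (hs : 0 ≤ s) (ε : ℝ) (c η : Plane) : 1 ≤ weight s ε c η :=
  Real.one_le_rpow (by nlinarith [sq_nonneg (freqDist c η / ε)]) hs

theorem measurable_weight (s ε : ℝ) (c : Plane) : Measurable (weight s ε c) := by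
  have := (continuous_freqDist c).measurable
  unfold weight
  fun_prop

theorem aemeasurable_enorm_fourier_sq (f : L2) :
    AEMeasurable (fun η => ‖(𝓕 f : L2) η‖ₑ ^ 2) volume :=
  (Lp.aestronglyMeasurable (𝓕 f : L2)).enorm.pow_const 2

/-- Layer cake formula for the measure with density |𝓕f|². It turns the weighted norm into tail
integrals. -/
theorem lintegral_weight_eq (f : L2) {w : Plane → ℝ} (hw : Measurable w) (hw0 : ∀ η, 0 ≤ w η) :
    ∫⁻ η, ENNReal.ofReal (w η) * ‖(𝓕 f : L2) η‖ₑ ^ 2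
      = ∫⁻ t in Set.Ioi (0 : ℝ), ∫⁻ η in {η | t < w η}, ‖(𝓕 f : L2) η‖ₑ ^ 2 := by
  have h1 := lintegral_eq_lintegral_meas_lt
    (volume.withDensity fun η => ‖(𝓕 f : L2) η‖ₑ ^ 2) (f := w)
    (Filter.Eventually.of_forall hw0) hw.aemeasurable
  rw [lintegral_withDensity_eq_lintegral_mul₀ (aemeasurable_enorm_fourier_sq f)
    hw.ennreal_ofReal.aemeasurable] at h1
  calc _ = _ := lintegral_congr fun η => mul_comm _ _
    _ = _ := h1
    _ = _ := lintegral_congr fun t => withDensity_apply _ (measurableSet_lt measurable_const hw)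

/-- Each superlevel set of the weight is the outside of a disc, to which the tail estimate applies.
The loss of a factor 2(2m + 1) in the radius becomes the factor κ in the weight, and nothing depends
on c or ε. -/
theorem lintegral_weight_powTerm_le (m : ℕ) {s : ℝ} (hs : 0 < s) : ∃ K : ℝ, 1 ≤ K ∧
    ∀ (c : Plane) (ε : ℝ), 0 < ε → ∀ (A : L2) (M : ℝ), Integrable (𝓕 A : L2) →
      (∀ x, ‖pointValue A x‖ ≤ M) →
      ∫⁻ η, ENNReal.ofReal (weight s ε c η) * ‖(𝓕 (powTerm (2 * m + 1) 1 A) : L2) η‖ₑ ^ 2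
        ≤ ENNReal.ofReal (K * M ^ (2 * m)) ^ 2 *
          ∫⁻ η, ENNReal.ofReal (weight s ε c η) * ‖(𝓕 A : L2) η‖ₑ ^ 2 := by
  obtain ⟨D, hD1, hD⟩ := lintegral_tail_powTerm_le m
  set Q : ℝ := 2 * m + 1 with hQ
  have hQ1 : 1 ≤ Q := by
    have : (0 : ℝ) ≤ m := Nat.cast_nonneg m
    linarith
  have hκ1 : 1 ≤ (2 * Q) ^ s := Real.one_le_rpow (by linarith) hs.le
  refine ⟨D * (2 * Q) ^ s, by nlinarith, fun c ε hε A M hA hM => ?_⟩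
  have hM0 : 0 ≤ M := (norm_nonneg _).trans (hM 0)
  set F := powTerm (2 * m + 1) 1 A with hF
  set κ : ℝ := ((2 * Q) ^ 2) ^ s with hκ
  have hκsq : κ = ((2 * Q) ^ s) ^ 2 := by
    rw [hκ, ← Real.rpow_natCast, ← Real.rpow_natCast, ← Real.rpow_mul (by linarith),
      ← Real.rpow_mul (by linarith)]
    congr 1
    exact mul_comm _ _
  have hκlt : 1 < κ := Real.one_lt_rpow (by nlinarith) hs
  have hκ0 : 0 ≤ κ := by linarith
  have hAM : ∀ᵐ x, ‖A x‖ ≤ M := by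
    filter_upwards [pointValue_ae hA] with x hx
    rw [hx]; exact hM x
  have htot : ∫⁻ η, ‖(𝓕 F : L2) η‖ₑ ^ 2
      ≤ ENNReal.ofReal (D * M ^ (2 * m)) ^ 2 * ∫⁻ η, ‖(𝓕 A : L2) η‖ₑ ^ 2 := by
    rw [← enorm_sq_eq_lintegral, ← enorm_sq_eq_lintegral, ← ofReal_norm, ← ofReal_norm,
      norm_fourier, norm_fourier, ← mul_pow, ← ENNReal.ofReal_mul (by positivity)]
    gcongr
    have h := norm_powTerm_le (2 * m + 1) one_pos hAM
    rw [Nat.add_sub_cancel, div_one] at h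
    refine h.trans ?_
    gcongr
    exact le_mul_of_one_le_left (by positivity) hD1
  have key : ∀ t : ℝ, 0 < t →
      ∫⁻ η in {η | t < weight s ε c η}, ‖(𝓕 F : L2) η‖ₑ ^ 2
        ≤ ENNReal.ofReal (D * M ^ (2 * m)) ^ 2 *
          ∫⁻ η in {η | t < κ * weight s ε c η}, ‖(𝓕 A : L2) η‖ₑ ^ 2 := by
    intro t ht
    -- For t ≤ 1 there is no disc to remove, and the plain L² bound suffices because κ times the
    -- weight exceeds 1 everywhere.
    rcases le_or_gt t 1 with ht1 | ht1
    · have huniv : {η : Plane | t < κ * weight s ε c η} = Set.univ := by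
        refine Set.eq_univ_of_forall fun η => ?_
        have := one_le_weight hs.le ε c η
        change t < κ * weight s ε c η
        nlinarith
      rw [huniv, Measure.restrict_univ]
      exact (setLIntegral_le_lintegral _ _).trans htot
    · have ht2 : 1 < t ^ s⁻¹ := Real.one_lt_rpow ht1 (by positivity)
      -- The weight exceeds t exactly beyond distance εy. The tail estimate is used with ρ = εy/Q,
      -- so it loses the part of the spectrum of A within εy/(2Q).
      set y := Real.sqrt (t ^ s⁻¹ - 1) with hy
      have hy0 : 0 < y := Real.sqrt_pos.2 (by linarith)
      have hysq : y ^ 2 = t ^ s⁻¹ - 1 := Real.sq_sqrt (by linarith)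
      have hts : (t ^ s⁻¹) ^ s = t := Real.rpow_inv_rpow ht.le hs.ne'
      have hsub1 : {η | t < weight s ε c η} ⊆ {η | Q * (ε * y / Q) < freqDist c η} := by
        intro η hη
        have h1 : t < (1 + (freqDist c η / ε) ^ 2) ^ s := hη
        rw [← hts] at h1
        have h2 := (Real.rpow_lt_rpow_iff (by positivity) (by positivity) hs).1 h1
        have h3 : y ^ 2 < (freqDist c η / ε) ^ 2 := by linarith
        have h4 : y < freqDist c η / ε :=
          lt_of_pow_lt_pow_left₀ 2 (div_nonneg (norm_nonneg _) hε.le) h3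
        rw [lt_div_iff₀ hε] at h4
        change Q * (ε * y / Q) < freqDist c η
        rw [mul_div_cancel₀ _ (by linarith : Q ≠ 0)]
        linarith
      have hsub2 : {η | ε * y / Q / 2 < freqDist c η} ⊆ {η | t < κ * weight s ε c η} := by
        intro η hη
        have h1 : ε * y / Q / 2 < freqDist c η := hη
        have h2 : y < (2 * Q) * (freqDist c η / ε) := by
          rw [div_div, div_lt_iff₀ (by linarith)] at h1
          rw [← mul_div_assoc, lt_div_iff₀ hε]
          linarith
        have h3 : y ^ 2 < ((2 * Q) * (freqDist c η / ε)) ^ 2 :=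
          pow_lt_pow_left₀ h2 hy0.le two_ne_zero
        change t < κ * weight s ε c η
        rw [hκ, weight, ← Real.mul_rpow (by positivity) (by positivity)]
        conv_lhs => rw [← hts]
        refine Real.rpow_lt_rpow (by positivity) ?_ hs
        nlinarith
      calc _ ≤ ∫⁻ η in {η | Q * (ε * y / Q) < freqDist c η}, ‖(𝓕 F : L2) η‖ₑ ^ 2 :=
            lintegral_mono_set hsub1
        _ ≤ _ := hD c (ε * y / Q) (by positivity) A M hA hM
        _ ≤ _ := mul_le_mul_right (lintegral_mono_set hsub2) _
  have hw0 : ∀ η, 0 ≤ weight s ε c η := fun η => zero_le_one.trans (one_le_weight hs.le ε c η)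
  rw [lintegral_weight_eq F (measurable_weight s ε c) hw0]
  calc _ ≤ ∫⁻ t in Set.Ioi (0 : ℝ), ENNReal.ofReal (D * M ^ (2 * m)) ^ 2 *
          ∫⁻ η in {η | t < κ * weight s ε c η}, ‖(𝓕 A : L2) η‖ₑ ^ 2 :=
        setLIntegral_mono' measurableSet_Ioi fun t ht => key t ht
    _ = ENNReal.ofReal (D * M ^ (2 * m)) ^ 2 *
          ∫⁻ η, ENNReal.ofReal (κ * weight s ε c η) * ‖(𝓕 A : L2) η‖ₑ ^ 2 := by
        rw [lintegral_const_mul' _ _ (by finiteness),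
          lintegral_weight_eq A ((measurable_weight s ε c).const_mul κ)
            fun η => mul_nonneg hκ0 (hw0 η)]
    _ = _ := by
        have h1 : ∀ η, ENNReal.ofReal (κ * weight s ε c η) * ‖(𝓕 A : L2) η‖ₑ ^ 2
            = ENNReal.ofReal κ * (ENNReal.ofReal (weight s ε c η) * ‖(𝓕 A : L2) η‖ₑ ^ 2) :=
          fun η => by rw [ENNReal.ofReal_mul hκ0, mul_assoc]
        simp_rw [h1]
        rw [lintegral_const_mul' _ _ ENNReal.ofReal_ne_top, ← mul_assoc]
        congr 1
        rw [hκsq, ← ENNReal.ofReal_pow (by positivity), ← ENNReal.ofReal_pow (by positivity),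
          ← ENNReal.ofReal_mul (by positivity)]
        congr 1
        ring

/-- The symbol of `Λˢ_ε` as a continuous function. -/
def besselC (s k ε : ℝ) : C(Plane, ℝ) where
  toFun := rescaledSymbol k ε (besselSymbol s)
  continuous_toFun := by
    unfold rescaledSymbol besselSymbol
    refine Continuous.rpow_const (by fun_prop) fun ξ => Or.inl ?_
    positivity

/-- The symbol of `|D|ᵖ` as a continuous function, for `p > 0`. -/
def rieszC (p : ℝ) (hp : 0 < p) : C(Plane, ℝ) where
  toFun := rieszSymbol p
  continuous_toFun := by
    unfold rieszSymbol
    exact continuous_norm.rpow_const fun ξ => Or.inr hp.le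

theorem Lam_of_band {s k ε : ℝ} {f : L2} (hf : f = band k f) :
    Lam s k ε f = bandOp k (besselC s k ε) f := multiplier_of_band hf (besselC s k ε)

theorem absD_of_band {p : ℝ} (hp : 0 < p) {k : ℝ} {f : L2} (hf : f = band k f) :
    absD p f = bandOp k (rieszC p hp) f := multiplier_of_band hf (rieszC p hp)

theorem band_Lam {s k ε : ℝ} {f : L2} (hf : f = band k f) :
    Lam s k ε f = band k (Lam s k ε f) := by
  rw [Lam_of_band hf, band_bandOp]

theorem besselC_mul_neg (s k ε : ℝ) : besselC s k ε * besselC (-s) k ε = 1 := by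
  ext ξ
  change (_ : ℝ) ^ (s / 2) * (_ : ℝ) ^ (-s / 2) = 1
  rw [← Real.rpow_add (by positivity)]
  ring_nf
  exact Real.rpow_zero _

theorem Lam_Lam_neg {s k ε : ℝ} {f : L2} (hf : f = band k f) :
    Lam s k ε (Lam (-s) k ε f) = f := by
  rw [Lam_of_band (band_Lam hf), Lam_of_band hf, bandOp_bandOp, besselC_mul_neg,
    ← band_eq_bandOp, ← hf]

theorem enorm_sq_Lam {s k ε : ℝ} (hε : 0 < ε) {f : L2} (hf : f = band k f) :
    ‖Lam s k ε f‖ₑ ^ 2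
      = ∫⁻ η, ENNReal.ofReal (weight s ε (k • e1) η) * ‖(𝓕 f : L2) η‖ₑ ^ 2 := by
  rw [← ofReal_norm, ← norm_fourier, ofReal_norm, enorm_sq_eq_lintegral]
  refine lintegral_congr_ae ?_
  filter_upwards [fourier_multiplier (inDomain_of_band hf (besselC s k ε))] with η h
  have h' : (𝓕 (Lam s k ε f) : L2) η = symbolMul (besselC s k ε) f η := h
  rw [h', ← ofReal_norm, norm_symbolMul, ← ofReal_norm, ← ENNReal.ofReal_pow (by positivity),
    ← ENNReal.ofReal_pow (by positivity), mul_pow, ENNReal.ofReal_mul (by positivity), sq_abs]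
  congr 2
  change ((_ : ℝ) ^ (s / 2)) ^ 2 = weight s ε (k • e1) η
  rw [← Real.rpow_natCast, ← Real.rpow_mul (by positivity), weight, freqDist, norm_smul, norm_inv,
    Real.norm_of_nonneg hε.le, add_comm, inv_mul_eq_div]
  congr 1
  push_cast
  ring

/-- The tame estimate `‖Λˢ_ε 𝓑ₖ(z |z|^(q-1))‖ ≤ K ‖z‖_{L^∞}^(q-1) ‖Λˢ_ε z‖`. -/
theorem exists_tame {q : ℕ} (hq : Odd q) {s : ℝ} (hs : 0 < s) : ∃ K : ℝ, 1 ≤ K ∧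
    ∀ k ε : ℝ, 0 < ε → ∀ f : L2, f = band k f →
      ‖Lam s k ε (band k (powTerm q 1 f))‖ ≤ K * supNorm f ^ (q - 1) * ‖Lam s k ε f‖ := by
  obtain ⟨m, rfl⟩ := hq
  obtain ⟨K, hK1, hK⟩ := lintegral_weight_powTerm_le m hs
  refine ⟨K, hK1, fun k ε hε f hf => ?_⟩
  have hint := integrable_fourier_of_band hf
  have h := hK (k • e1) ε hε f (supNorm f) hint (norm_pointValue_le_supNorm hint)
  have hM := supNorm_nonneg f
  rw [Nat.add_sub_cancel]
  have h2 : ‖Lam s k ε (band k (powTerm (2 * m + 1) 1 f))‖ₑ ^ 2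
      ≤ (ENNReal.ofReal (K * supNorm f ^ (2 * m)) * ‖Lam s k ε f‖ₑ) ^ 2 := by
    rw [mul_pow, enorm_sq_Lam hε hf, enorm_sq_Lam hε (band_band k _).symm]
    refine le_trans (lintegral_mono_ae ?_) h
    filter_upwards [fourier_band k (powTerm (2 * m + 1) 1 f)] with η h3
    gcongr
    rw [h3, ← ofReal_norm, ← ofReal_norm, norm_symbolMul]
    exact ENNReal.ofReal_le_ofReal
      (mul_le_of_le_one_left (norm_nonneg _) (abs_bandSymbol_le _ _))
  rw [← ofReal_norm, ← ofReal_norm, ← ENNReal.ofReal_mul (by positivity),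
    ← ENNReal.ofReal_pow (by positivity), ← ENNReal.ofReal_pow (by positivity),
    ENNReal.ofReal_le_ofReal_iff (by positivity)] at h2
  exact le_of_sq_le_sq h2 (by positivity)

end Tame

end

end Progenitor

namespace Progenitor

noncomputable section

/-! ### Bounded Lipschitz functions on a set -/

section BoundedLipschitz

variable {E Y Z W : Type*} [PseudoMetricSpace E] [NormedAddCommGroup Y] [NormedAddCommGroup Z]
  [NormedAddCommGroup W]

/-- `f` is bounded and Lipschitz on `S`. -/
def BddLip (S : Set E) (f : E → Y) : Prop :=
  ∃ C : ℝ, 0 ≤ C ∧ (∀ x ∈ S, ‖f x‖ ≤ C) ∧ ∀ x ∈ S, ∀ y ∈ S, ‖f x - f y‖ ≤ C * dist x y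

theorem BddLip.intro {S : Set E} {f : E → Y} (C D : ℝ) (h1 : ∀ x ∈ S, ‖f x‖ ≤ C)
    (h2 : ∀ x ∈ S, ∀ y ∈ S, ‖f x - f y‖ ≤ D * dist x y) : BddLip S f := by
  refine ⟨max 0 (max C D), le_max_left _ _, fun x hx => (h1 x hx).trans ?_,
    fun x hx y hy => (h2 x hx y hy).trans ?_⟩
  · exact (le_max_left _ _).trans (le_max_right _ _)
  · gcongr
    exact (le_max_right _ _).trans (le_max_right _ _)

theorem BddLip.mono {S S' : Set E} {f : E → Y} (h : BddLip S f) (hS : S' ⊆ S) : BddLip S' f := by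
  obtain ⟨C, h0, h1, h2⟩ := h
  exact ⟨C, h0, fun x hx => h1 x (hS hx), fun x hx y hy => h2 x (hS hx) y (hS hy)⟩

theorem BddLip.const (S : Set E) (c : Y) : BddLip S fun _ => c :=
  BddLip.intro ‖c‖ 0 (fun _ _ => le_rfl) (by simp)

theorem BddLip.add {S : Set E} {f g : E → Y} (hf : BddLip S f) (hg : BddLip S g) :
    BddLip S fun x => f x + g x := by
  obtain ⟨C, -, h1, h2⟩ := hf
  obtain ⟨D, -, h3, h4⟩ := hg
  refine BddLip.intro (C + D) (C + D)
    (fun x hx => (norm_add_le _ _).trans (add_le_add (h1 x hx) (h3 x hx))) fun x hx y hy => ?_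
  rw [add_sub_add_comm, add_mul]
  exact (norm_add_le _ _).trans (add_le_add (h2 x hx y hy) (h4 x hx y hy))

variable [NormedSpace ℝ Y] [NormedSpace ℝ Z] [NormedSpace ℝ W]

theorem BddLip.clm {S : Set E} {f : E → Y} (hf : BddLip S f) (A : Y →L[ℝ] Z) :
    BddLip S fun x => A (f x) := by
  obtain ⟨C, h0, h1, h2⟩ := hf
  refine BddLip.intro (‖A‖ * C) (‖A‖ * C) (fun x hx => (A.le_opNorm _).trans ?_)
    fun x hx y hy => ?_
  · exact mul_le_mul_of_nonneg_left (h1 x hx) (norm_nonneg _)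
  · rw [← map_sub, mul_assoc]
    exact (A.le_opNorm _).trans (mul_le_mul_of_nonneg_left (h2 x hx y hy) (norm_nonneg _))

theorem BddLip.bilin {S : Set E} {f : E → Y} {g : E → Z} (hf : BddLip S f) (hg : BddLip S g)
    (B : Y →L[ℝ] Z →L[ℝ] W) : BddLip S fun x => B (f x) (g x) := by
  obtain ⟨C, h0, h1, h2⟩ := hf
  obtain ⟨D, h0', h3, h4⟩ := hg
  refine BddLip.intro (‖B‖ * C * D) (‖B‖ * C * D + ‖B‖ * C * D) (fun x hx => ?_)
    fun x hx y hy => ?_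
  · refine (B.le_opNorm₂ _ _).trans ?_
    gcongr
    exacts [h1 x hx, h3 x hx]
  · have e : B (f x) (g x) - B (f y) (g y) = B (f x - f y) (g x) + B (f y) (g x - g y) := by
      simp only [map_sub, sub_apply]
      abel
    rw [e]
    calc _ ≤ ‖B‖ * ‖f x - f y‖ * ‖g x‖ + ‖B‖ * ‖f y‖ * ‖g x - g y‖ :=
          (norm_add_le _ _).trans (add_le_add (B.le_opNorm₂ _ _) (B.le_opNorm₂ _ _))
      _ ≤ ‖B‖ * (C * dist x y) * D + ‖B‖ * C * (D * dist x y) := by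
          have := @dist_nonneg _ _ x y
          gcongr
          exacts [h2 x hx y hy, h3 x hx, h1 y hy, h4 x hx y hy]
      _ = _ := by ring

theorem BddLip.smul {S : Set E} {f : E → ℝ} {g : E → Z} (hf : BddLip S f) (hg : BddLip S g) :
    BddLip S fun x => f x • g x :=
  hf.bilin hg (ContinuousLinearMap.lsmul ℝ ℝ)

theorem BddLip.mul {S : Set E} {f g : E → ℝ} (hf : BddLip S f) (hg : BddLip S g) :
    BddLip S fun x => f x * g x := hf.smul hg

theorem BddLip.neg {S : Set E} {f : E → Y} (hf : BddLip S f) : BddLip S fun x => -f x :=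
  hf.clm (-ContinuousLinearMap.id ℝ Y)

theorem BddLip.sub {S : Set E} {f g : E → Y} (hf : BddLip S f) (hg : BddLip S g) :
    BddLip S fun x => f x - g x := by
  simpa only [sub_eq_add_neg] using hf.add hg.neg

theorem BddLip.inner {X : Type*} [NormedAddCommGroup X] [InnerProductSpace ℝ X] {S : Set E}
    {f g : E → X} (hf : BddLip S f) (hg : BddLip S g) : BddLip S fun x => inner ℝ (f x) (g x) :=
  hf.bilin hg (innerSL ℝ)

theorem BddLip.sqrt {S : Set E} {f : E → ℝ} (hf : BddLip S f) {d : ℝ} (hd : 0 < d)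
    (h : ∀ x ∈ S, d ≤ f x) : BddLip S fun x => Real.sqrt (f x) := by
  obtain ⟨C, h0, h1, h2⟩ := hf
  refine BddLip.intro (Real.sqrt C) (C / Real.sqrt d) (fun x hx => ?_) fun x hx y hy => ?_
  · rw [Real.norm_of_nonneg (Real.sqrt_nonneg _)]
    exact Real.sqrt_le_sqrt ((le_abs_self _).trans (h1 x hx))
  · have hs := Real.sqrt_pos.2 hd
    have hx1 := Real.sqrt_le_sqrt (h x hx)
    have hy1 := Real.sqrt_le_sqrt (h y hy)
    have e : (Real.sqrt (f x) - Real.sqrt (f y)) * (Real.sqrt (f x) + Real.sqrt (f y))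
        = f x - f y := by
      have := Real.mul_self_sqrt (hd.le.trans (h x hx))
      have := Real.mul_self_sqrt (hd.le.trans (h y hy))
      linarith
    have h3 := h2 x hx y hy
    rw [← e, norm_mul, Real.norm_of_nonneg (by positivity : 0 ≤ Real.sqrt (f x) + Real.sqrt (f y))]
      at h3
    rw [div_mul_eq_mul_div, le_div_iff₀ hs]
    refine le_trans (mul_le_mul_of_nonneg_left ?_ (norm_nonneg _)) h3
    linarith

theorem BddLip.inv {S : Set E} {f : E → ℝ} (hf : BddLip S f) {d : ℝ} (hd : 0 < d)
    (h : ∀ x ∈ S, d ≤ f x) : BddLip S fun x => (f x)⁻¹ := by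
  obtain ⟨C, h0, h1, h2⟩ := hf
  refine BddLip.intro d⁻¹ (C * d⁻¹ * d⁻¹) (fun x hx => ?_) fun x hx y hy => ?_
  · rw [norm_inv, Real.norm_of_nonneg (hd.le.trans (h x hx))]
    exact inv_anti₀ hd (h x hx)
  · have hx0 := hd.trans_le (h x hx)
    have hy0 := hd.trans_le (h y hy)
    have e : (f x)⁻¹ - (f y)⁻¹ = (f y - f x) * (f x)⁻¹ * (f y)⁻¹ := by
      field_simp
    rw [e, norm_mul, norm_mul, norm_inv, norm_inv, Real.norm_of_nonneg hx0.le,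
      Real.norm_of_nonneg hy0.le, norm_sub_rev]
    calc _ ≤ C * dist x y * d⁻¹ * d⁻¹ := by
          gcongr
          exacts [h2 x hx y hy, h x hx, h y hy]
      _ = _ := by ring

end BoundedLipschitz

/-! ### Second order differential equations -/

section ODE

variable {X : Type*} [NormedAddCommGroup X] [NormedSpace ℝ X] [CompleteSpace X]

/-- A local solution of `z'' = Φ(t, z)`, with a quantitative time of existence. -/
theorem exists_second_order {Φ : ℝ → X → X} {z₀ v₀ : X} {r L K τ : ℝ} (hr : 0 < r) (hK : 0 ≤ K)
    (hτ : 0 < τ) (hv : ‖v₀‖ ≤ L) (hτL : (L + r) * τ ≤ r)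
    (hlip : ∀ t ∈ Set.Icc 0 τ, ∀ x ∈ Metric.closedBall z₀ r, ∀ y ∈ Metric.closedBall z₀ r,
      ‖Φ t x - Φ t y‖ ≤ K * dist x y)
    (hcont : ∀ x ∈ Metric.closedBall z₀ r, ContinuousOn (fun t => Φ t x) (Set.Icc 0 τ))
    (hbd : ∀ t ∈ Set.Icc 0 τ, ∀ x ∈ Metric.closedBall z₀ r, ‖Φ t x‖ ≤ L) :
    ∃ z v : ℝ → X, z 0 = z₀ ∧ v 0 = v₀ ∧ ∀ t ∈ Set.Icc 0 τ,
      z t ∈ Metric.closedBall z₀ r ∧ v t ∈ Metric.closedBall v₀ r ∧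
      HasDerivWithinAt z (v t) (Set.Icc 0 τ) t ∧
      HasDerivWithinAt v (Φ t (z t)) (Set.Icc 0 τ) t := by
  have hL : 0 ≤ L := (norm_nonneg _).trans hv
  let f : ℝ → X × X → X × X := fun t y => (y.2, Φ t y.1)
  have hball : ∀ y ∈ Metric.closedBall (z₀, v₀) r,
      y.1 ∈ Metric.closedBall z₀ r ∧ y.2 ∈ Metric.closedBall v₀ r := fun y hy => by
    rw [← closedBall_prod_same] at hy
    exact hy
  have h00 : (0 : ℝ) ∈ Set.Icc 0 τ := Set.left_mem_Icc.2 hτ.le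
  obtain ⟨r', rfl⟩ : ∃ r' : NNReal, (r' : ℝ) = r := CanLift.prf r hr.le
  obtain ⟨L', hL'⟩ : ∃ L' : NNReal, (L' : ℝ) = L + r' := CanLift.prf (L + r') (by positivity)
  obtain ⟨K', hK'⟩ : ∃ K' : NNReal, (K' : ℝ) = max 1 K := CanLift.prf (max 1 K) (by positivity)
  have hpl : IsPicardLindelof f (⟨0, h00⟩ : Set.Icc (0 : ℝ) τ) (z₀, v₀)
      r' 0 L' K' := by
    refine ⟨fun t ht => ?_, fun y hy => ?_, fun t ht y hy => ?_, ?_⟩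
    · refine LipschitzOnWith.of_dist_le_mul fun x hx y hy => ?_
      rw [hK']
      have h1 := hlip t ht x.1 (hball x hx).1 y.1 (hball y hy).1
      have h2 : dist x.1 y.1 ≤ dist x y := le_max_left _ _
      have h3 : dist x.2 y.2 ≤ dist x y := le_max_right _ _
      have h4 := @dist_nonneg _ _ x y
      refine max_le ?_ ?_
      · change dist x.2 y.2 ≤ max 1 K * dist x y
        nlinarith [le_max_left 1 K]
      · change dist (Φ t x.1) (Φ t y.1) ≤ max 1 K * dist x y
        rw [dist_eq_norm]
        nlinarith [le_max_right 1 K]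
    · exact continuousOn_const.prodMk (hcont y.1 (hball y hy).1)
    · rw [hL']
      refine max_le ?_ ?_
      · change ‖y.2‖ ≤ L + r'
        have h1 : dist y.2 v₀ ≤ r' := (hball y hy).2
        rw [dist_eq_norm] at h1
        have h2 := norm_add_le (y.2 - v₀) v₀
        rw [sub_add_cancel] at h2
        linarith
      · change ‖Φ t y.1‖ ≤ L + r'
        have := hbd t ht y.1 (hball y hy).1
        linarith
    · rw [hL']
      change (L + r') * max (τ - 0) (0 - 0) ≤ (r' : ℝ) - 0
      simpa [hτ.le] using hτL
  have hx : (z₀, v₀) ∈ Metric.closedBall (z₀, v₀) ((0 : NNReal) : ℝ) := by simp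
  -- The fixed point of the Picard map is taken itself, because it also records that the curve stays
  -- in the closed ball.
  obtain ⟨α, hα⟩ := ODE.FunSpace.exists_isFixedPt_next hpl hx
  have hmem : ∀ t, α.compProj t ∈ Metric.closedBall (z₀, v₀) r' := fun t =>
    α.compProj_mem_closedBall hpl.mul_max_le
  have hpic : ∀ t ∈ Set.Icc 0 τ, α.compProj t = ODE.picard f 0 (z₀, v₀) α.compProj t := by
    intro t ht
    have h1 : α.compProj t = (ODE.FunSpace.next hpl hx α).compProj t := by rw [hα.eq]
    rw [h1, ODE.FunSpace.compProj_of_mem ht, ODE.FunSpace.next_apply]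
  have hderiv : ∀ t ∈ Set.Icc 0 τ,
      HasDerivWithinAt α.compProj (f t (α.compProj t)) (Set.Icc 0 τ) t := by
    intro t ht
    refine (ODE.hasDerivWithinAt_picard_Icc (f := f) (u := Metric.closedBall (z₀, v₀) r')
      h00 hpl.continuousOn_uncurry α.continuous_compProj.continuousOn
      (fun t _ => hmem t) (z₀, v₀) ht).congr_of_mem hpic ht
  have h0 : α.compProj 0 = (z₀, v₀) := by
    rw [hpic 0 h00, ODE.picard_apply₀]
  refine ⟨fun t => (α.compProj t).1, fun t => (α.compProj t).2, congrArg Prod.fst h0,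
    congrArg Prod.snd h0,
    fun t ht => ⟨(hball _ (hmem t)).1, (hball _ (hmem t)).2, ?_, ?_⟩⟩
  · exact (ContinuousLinearMap.fst ℝ X X).hasFDerivAt.comp_hasDerivWithinAt t (hderiv t ht)
  · exact (ContinuousLinearMap.snd ℝ X X).hasFDerivAt.comp_hasDerivWithinAt t (hderiv t ht)

end ODE

end

end Progenitor

namespace Progenitor

noncomputable section

/-! ### The quadratic equation for the value of the penalization -/

section Root

variable {X : Type*} [NormedAddCommGroup X] [InnerProductSpace ℝ X]

/-- A quarter of the discriminant of the quadratic equation `‖f - γ n‖² = M (2γ - γ²)`. -/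
def penDisc (f n : X) (M : ℝ) : ℝ :=
  (M + inner ℝ f n) * (M + inner ℝ f n) - (inner ℝ n n + M) * inner ℝ f f

/-- The smaller root of the quadratic equation `‖f - γ n‖² = M (2γ - γ²)`. -/
def penRoot (f n : X) (M : ℝ) : ℝ :=
  ((M + inner ℝ f n) - Real.sqrt (penDisc f n M)) * (inner ℝ n n + M)⁻¹

theorem norm_sub_smul_sq (f n : X) (γ : ℝ) :
    ‖f - γ • n‖ ^ 2 = inner ℝ f f - 2 * γ * inner ℝ f n + γ ^ 2 * inner ℝ n n := by
  rw [norm_sub_sq_real, ← real_inner_self_eq_norm_sq, ← real_inner_self_eq_norm_sq,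
    inner_smul_right, inner_smul_left, inner_smul_right]
  simp only [conj_trivial]
  ring

/-- The quadratic is (‖n‖² + M)γ² - 2(M + ⟨f, n⟩)γ + ‖f‖² = 0, with positive leading coefficient
even when n = 0. -/
theorem penRoot_spec {f n : X} {M : ℝ} (hM : 0 < M) (hD : 0 ≤ penDisc f n M) :
    ‖f - penRoot f n M • n‖ ^ 2 = M * (2 * penRoot f n M - penRoot f n M ^ 2) := by
  have hα : 0 < inner ℝ n n + M := add_pos_of_nonneg_of_pos real_inner_self_nonneg hM
  have hs := Real.mul_self_sqrt hD
  have hγ : (inner ℝ n n + M) * penRoot f n M = M + inner ℝ f n - Real.sqrt (penDisc f n M) := by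
    rw [penRoot, mul_comm, mul_assoc, inv_mul_cancel₀ hα.ne', mul_one]
  rw [norm_sub_smul_sq]
  set γ := penRoot f n M
  set σ := Real.sqrt (penDisc f n M)
  have h1 : (inner ℝ n n + M) *
      ((inner ℝ n n + M) * γ ^ 2 - 2 * (M + inner ℝ f n) * γ + inner ℝ f f) = 0 := by
    have h2 : σ * σ = (M + inner ℝ f n) * (M + inner ℝ f n) - (inner ℝ n n + M) * inner ℝ f f := hs
    have h3 : σ = M + inner ℝ f n - (inner ℝ n n + M) * γ := by linarith
    rw [h3] at h2
    linear_combination h2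
  have h4 := (mul_eq_zero.1 h1).resolve_left hα.ne'
  linear_combination h4

/-- At a root of αγ² - 2βγ + c one has β² - αc = (β - αγ)². The expression squared here is β - αγ;
its sign decides which root γ is. -/
theorem penDisc_of_root {f n : X} {M γ : ℝ} (h : ‖f - γ • n‖ ^ 2 = M * (2 * γ - γ ^ 2)) :
    penDisc f n M = (M * (1 - γ) + inner ℝ (f - γ • n) n) ^ 2 := by
  rw [norm_sub_smul_sq] at h
  rw [penDisc, inner_sub_left, inner_smul_left]
  simp only [conj_trivial]
  linear_combination (-(inner ℝ n n + M)) * h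

theorem penRoot_of_root {f n : X} {M γ : ℝ} (hM : 0 < M)
    (h : ‖f - γ • n‖ ^ 2 = M * (2 * γ - γ ^ 2))
    (h0 : 0 ≤ M * (1 - γ) + inner ℝ (f - γ • n) n) : penRoot f n M = γ := by
  have hα : 0 < inner ℝ n n + M := add_pos_of_nonneg_of_pos real_inner_self_nonneg hM
  rw [penRoot, penDisc_of_root h, Real.sqrt_sq h0, inner_sub_left, inner_smul_left]
  simp only [conj_trivial]
  rw [← div_eq_mul_inv, div_eq_iff hα.ne']
  ring

theorem bddLip_penDisc {E : Type*} [PseudoMetricSpace E] {S : Set E} {f n : E → X} {M : E → ℝ}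
    (hf : BddLip S f) (hn : BddLip S n) (hM : BddLip S M) :
    BddLip S fun x => penDisc (f x) (n x) (M x) :=
  ((hM.add (hf.inner hn)).mul (hM.add (hf.inner hn))).sub
    (((hn.inner hn).add hM).mul (hf.inner hf))

theorem bddLip_penRoot {E : Type*} [PseudoMetricSpace E] {S : Set E} {f n : E → X} {M : E → ℝ}
    (hf : BddLip S f) (hn : BddLip S n) (hM : BddLip S M) {m d : ℝ} (hm : 0 < m)
    (hMm : ∀ x ∈ S, m ≤ M x) (hd : 0 < d) (hD : ∀ x ∈ S, d ≤ penDisc (f x) (n x) (M x)) :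
    BddLip S fun x => penRoot (f x) (n x) (M x) := by
  refine ((hM.add (hf.inner hn)).sub ((bddLip_penDisc hf hn hM).sqrt hd hD)).mul
    (((hn.inner hn).add hM).inv hm fun x hx => ?_)
  have h1 := hMm x hx
  have h2 : 0 ≤ inner ℝ (n x) (n x) := real_inner_self_nonneg
  linarith

/-- This inverts g. The restriction γ ≤ 1 is why the solution must keep its root on this side of 1.
-/
theorem pen_two_mul_sub_sq {γ : ℝ} (h : γ ≤ 1) : pen (2 * γ - γ ^ 2) = γ := by
  rw [pen, show 1 - (2 * γ - γ ^ 2) = (1 - γ) ^ 2 by ring, Real.sqrt_sq (by linarith)]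
  ring

theorem two_mul_pen_sub_sq {l : ℝ} (h : l ≤ 1) : 2 * pen l - pen l ^ 2 = l := by
  have := Real.sq_sqrt (by linarith : 0 ≤ 1 - l)
  rw [pen]
  linear_combination -this

theorem one_sub_pen (l : ℝ) : 1 - pen l = Real.sqrt (1 - l) := by
  rw [pen]; ring

theorem pen_nonneg {l : ℝ} (h : 0 ≤ l) : 0 ≤ pen l := by
  have : Real.sqrt (1 - l) ≤ 1 := Real.sqrt_le_one.2 (by linarith)
  rw [pen]; linarith

theorem deriv_pen {l : ℝ} (h : l < 1) : deriv pen l = 1 / (2 * Real.sqrt (1 - l)) := by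
  have h1 : HasDerivAt (fun x : ℝ => 1 - x) (-1) l := by
    simpa using (hasDerivAt_id l).const_sub 1
  have h2 := (h1.sqrt (by linarith)).const_sub 1
  have h3 : HasDerivAt pen (-(-1 / (2 * Real.sqrt (1 - l)))) l := h2
  rw [h3.deriv]
  ring

end Root

/-! ### The vector field -/

section Field

theorem real_smul_eq (r : ℝ) (f : L2) : r • f = (r : ℂ) • f := by
  refine Lp.ext ?_
  filter_upwards [Lp.coeFn_smul r f, Lp.coeFn_smul (r : ℂ) f] with x h1 h2
  rw [h1, h2, Pi.smul_apply, Pi.smul_apply, Complex.real_smul, smul_eq_mul]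

theorem freq_pos {p k : ℝ} (hk : 0 < k) : 0 < freq p k := Real.rpow_pos_of_pos hk _

/-- `-|D|ᵖ z - C_k ε² 𝓑ₖ(z |z/ε|^(q-1))`, precomposed with `𝓑ₖ`. -/
def force (q : ℕ) (p : ℝ) (hp : 0 < p) (k ε : ℝ) (z : L2) : L2 :=
  -bandOp k (rieszC p hp) z - semilinear q p k ε (band k z)

/-- The coefficient `𝒩`, precomposed with `𝓑ₖ`, as a function of `τ = ε⁷ t + ε⁵ T`. -/
def penalAt (q : ℕ) (p k ε τ : ℝ) (z : L2) : L2 :=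
  ((freq p k ^ 2 : ℝ) : ℂ) • (((ε ^ (q + 4) : ℝ) : ℂ) • band k z +
    (2 * Complex.I * (τ : ℂ)) • band k (powTerm q 1 (band k z)))

theorem penal_eq_penalAt (q : ℕ) (p k ε T t : ℝ) {z : L2} (hz : z = band k z) :
    penal q p k ε T t z = penalAt q p k ε (ε ^ 7 * t + ε ^ 5 * T) z := by
  rw [penal, penalAt, ← hz]
  congr 1
  rw [band_eq_bandOp, map_add, map_smul, map_smul, ← band_eq_bandOp, ← band_eq_bandOp, ← hz]

theorem force_eq (q : ℕ) {p : ℝ} (hp : 0 < p) (k ε : ℝ) {z : L2} (hz : z = band k z) :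
    force q p hp k ε z = -absD p z - semilinear q p k ε z := by
  rw [force, ← hz, absD_of_band hp hz]

theorem band_semilinear (q : ℕ) (p k ε : ℝ) (z : L2) :
    band k (semilinear q p k ε z) = semilinear q p k ε z := by
  rw [semilinear, band_eq_bandOp k (_ • _), map_smul, ← band_eq_bandOp, band_band]

theorem band_force (q : ℕ) {p : ℝ} (hp : 0 < p) (k ε : ℝ) (z : L2) :
    band k (force q p hp k ε z) = force q p hp k ε z := by
  rw [force, band_eq_bandOp, map_sub, map_neg, ← band_eq_bandOp, ← band_eq_bandOp, band_bandOp,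
    band_semilinear]

theorem band_penalAt (q : ℕ) (p k ε τ : ℝ) (z : L2) :
    band k (penalAt q p k ε τ z) = penalAt q p k ε τ z := by
  rw [penalAt, band_eq_bandOp k (_ • _), map_smul, map_add, map_smul, map_smul,
    ← band_eq_bandOp, ← band_eq_bandOp, band_band, band_band]

variable {E : Type*} [PseudoMetricSpace E] {S : Set E}

theorem BddLip.complexClm {f : E → L2} (hf : BddLip S f) (A : L2 →L[ℂ] L2) :
    BddLip S fun x => A (f x) := hf.clm (A.restrictScalars ℝ)

theorem BddLip.band {f : E → L2} (hf : BddLip S f) (k : ℝ) : BddLip S fun x => band k (f x) := by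
  simp_rw [band_eq_bandOp]
  exact hf.complexClm _

theorem BddLip.complexSMul {f : E → L2} (hf : BddLip S f) (c : ℂ) : BddLip S fun x => c • f x :=
  hf.complexClm (c • ContinuousLinearMap.id ℂ L2)

/-- The power is Lipschitz on L² only under a sup norm bound, which Bernstein's inequality supplies
after filtering. -/
theorem BddLip.powTerm_band {f : E → L2} (hf : BddLip S f) (q : ℕ) (k : ℝ) {r : ℝ} (hr : 0 < r) :
    BddLip S fun x => powTerm q r (Progenitor.band k (f x)) := by
  obtain ⟨C, h0, h1, h2⟩ := hf.band k
  obtain ⟨D, hD0, hD⟩ := norm_pointValue_band_le k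
  have hsup : ∀ x ∈ S, ∀ᵐ y, ‖Progenitor.band k (f x) y‖ ≤ D * C := fun x hx => by
    have hb := (band_band k (f x)).symm
    filter_upwards [pointValue_ae (integrable_fourier_of_band hb)] with y hy
    rw [hy]
    exact (hD _ hb y).trans (mul_le_mul_of_nonneg_left (h1 x hx) hD0)
  refine BddLip.intro ((D * C / r) ^ (q - 1) * C)
    (((q - 1 : ℕ) + 1) * (D * C / r) ^ (q - 1) * C) (fun x hx => ?_) fun x hx y hy => ?_
  · refine (norm_powTerm_le q hr (hsup x hx)).trans ?_
    gcongr
    exact h1 x hx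
  · refine (norm_powTerm_sub_le q hr (hsup x hx) (hsup y hy)).trans ?_
    rw [mul_assoc (_ * _) C]
    gcongr
    exact h2 x hx y hy

theorem BddLip.force {f : E → L2} (hf : BddLip S f) (q : ℕ) {p : ℝ} (hp : 0 < p) (k : ℝ) {ε : ℝ}
    (hε : 0 < ε) : BddLip S fun x => force q p hp k ε (f x) := by
  have h1 := (hf.complexClm (bandOp k (rieszC p hp))).neg
  have h2 := ((hf.powTerm_band q k hε).band k).complexSMul ((powCoeff p k * ε ^ 2 : ℝ) : ℂ)
  exact h1.sub h2

theorem BddLip.penalAt {f : E → L2} (hf : BddLip S f) {τ : E → ℝ} (hτ : BddLip S τ) (q : ℕ)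
    (p k ε : ℝ) : BddLip S fun x => penalAt q p k ε (τ x) (f x) := by
  have h1 := (hf.band k).complexSMul ((ε ^ (q + 4) : ℝ) : ℂ)
  have h := hτ.smul (((hf.powTerm_band q k one_pos).band k).complexSMul (2 * Complex.I))
  have h2 := (h1.add h).complexSMul ((freq p k ^ 2 : ℝ) : ℂ)
  convert h2 using 2 with x
  rw [Progenitor.penalAt, real_smul_eq, smul_smul, mul_comm]

end Field

end

end Progenitor

namespace Progenitor

noncomputable section

/-! ### Local solutions with a uniform time of existence -/

section LocalSolution

theorem BddLip.continuousOn {E Y : Type*} [PseudoMetricSpace E] [NormedAddCommGroup Y] {S : Set E}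
    {f : E → Y} (hf : BddLip S f) : ContinuousOn f S := by
  obtain ⟨C, h0, -, h2⟩ := hf
  have h : LipschitzOnWith (Real.toNNReal C) f S := LipschitzOnWith.of_dist_le_mul
    fun x hx y hy => by
      rw [Real.coe_toNNReal _ h0, dist_eq_norm]
      exact h2 x hx y hy
  exact h.continuousOn

/-- The component y - 𝓑ₖy has zero derivative and starts at zero. The solution is constructed in all
of L², so band limitation has to be recovered. -/
theorem eq_band_of_deriv {k τ : ℝ} {y y' : ℝ → L2} (h0 : y 0 = band k (y 0))
    (hy' : ∀ t ∈ Set.Icc 0 τ, y' t = band k (y' t))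
    (hd : ∀ t ∈ Set.Icc 0 τ, HasDerivWithinAt y (y' t) (Set.Icc 0 τ) t) :
    ∀ t ∈ Set.Icc 0 τ, y t = band k (y t) := by
  let A : L2 →L[ℝ] L2 := (ContinuousLinearMap.id ℂ L2 - bandOp k 1).restrictScalars ℝ
  have hA : ∀ f, A f = f - band k f := fun f => by
    rw [band_eq_bandOp]; rfl
  have hAd : ∀ t ∈ Set.Icc 0 τ, HasDerivWithinAt (fun t => A (y t)) 0 (Set.Icc 0 τ) t := by
    intro t ht
    have h := A.hasFDerivAt.comp_hasDerivWithinAt t (hd t ht)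
    rwa [hA, ← hy' t ht, sub_self] at h
  have hc := constant_of_has_deriv_right_zero (f := fun t => A (y t)) (a := 0) (b := τ)
    (fun t ht => (hAd t ht).continuousWithinAt) fun t ht =>
      (hAd t ⟨ht.1, ht.2.le⟩).mono_of_mem_nhdsWithin (Icc_mem_nhdsGE_of_mem ht)
  intro t ht
  have h1 := hc t ht
  rw [hA, hA, ← h0, sub_self] at h1
  exact sub_eq_zero.1 h1

/-- Position, the coefficient ε⁷t + ε⁵T and the scale M are the coordinates of one bounded set S.
The Lipschitz constants on it, and hence τ, are fixed before the data are chosen. -/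
theorem exists_uniform_solution (q : ℕ) {p : ℝ} (hp : 0 < p) (k s : ℝ) {ε δ d m R η : ℝ}
    (hε : 0 < ε) (hδ : 0 < δ) (hd : 0 < d) (hm : 0 < m) (hR : 0 < R) (hη : 0 < η) :
    ∃ τ : ℝ, 0 < τ ∧ ∀ (z₀ v₀ : L2) (T M γ₀ : ℝ), z₀ = band k z₀ → v₀ = band k v₀ →
      ‖z₀‖ ≤ R → ‖v₀‖ ≤ R → |T| ≤ R → m ≤ M → M ≤ R → γ₀ < 1 → δ ≤ (1 - γ₀) ^ 2 →
      ∀ Λ : L2 →L[ℂ] L2, Λ = bandOp k (besselC s k ε) →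
      ‖Λ (force q p hp k ε z₀) - γ₀ • Λ (penalAt q p k ε (ε ^ 5 * T) z₀)‖ ^ 2
        = M * (2 * γ₀ - γ₀ ^ 2) →
      d ≤ M * (1 - γ₀) + inner ℝ (Λ (force q p hp k ε z₀)
        - γ₀ • Λ (penalAt q p k ε (ε ^ 5 * T) z₀)) (Λ (penalAt q p k ε (ε ^ 5 * T) z₀)) →
      ∃ (z v : ℝ → L2) (γ : ℝ → ℝ), z 0 = z₀ ∧ v 0 = v₀ ∧ γ 0 = γ₀ ∧
        ContinuousOn (fun t => force q p hp k ε (z t)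
          - γ t • penalAt q p k ε (ε ^ 7 * t + ε ^ 5 * T) (z t)) (Set.Icc 0 τ) ∧
        ∀ t ∈ Set.Icc 0 τ, z t = band k (z t) ∧ v t = band k (v t) ∧
          ‖Λ (z t - z₀)‖ ≤ η ∧ ‖Λ (v t - v₀)‖ ≤ η ∧ γ t ≤ 1 ∧
          ‖Λ (force q p hp k ε (z t))
            - γ t • Λ (penalAt q p k ε (ε ^ 7 * t + ε ^ 5 * T) (z t))‖ ^ 2
              = M * (2 * γ t - γ t ^ 2) ∧
          |(2 * γ t - γ t ^ 2) - (2 * γ₀ - γ₀ ^ 2)| ≤ δ / 2 ∧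
          HasDerivWithinAt z (v t) (Set.Icc 0 τ) t ∧
          HasDerivWithinAt v (force q p hp k ε (z t)
            - γ t • penalAt q p k ε (ε ^ 7 * t + ε ^ 5 * T) (z t)) (Set.Icc 0 τ) t := by
  set Λ₀ : L2 →L[ℂ] L2 := bandOp k (besselC s k ε) with hΛ₀
  let S : Set (L2 × ℝ × ℝ) :=
    {x | ‖x.1‖ ≤ R + 1 ∧ |x.2.1| ≤ ε ^ 5 * R + 1 ∧ m ≤ x.2.2 ∧ x.2.2 ≤ R}
  have hz : BddLip S fun x => x.1 := BddLip.intro (R + 1) 1 (fun x hx => hx.1) fun x _ y _ => by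
    rw [one_mul, ← dist_eq_norm]
    exact le_max_left _ _
  have hσ : BddLip S fun x => x.2.1 :=
    BddLip.intro (ε ^ 5 * R + 1) 1 (fun x hx => hx.2.1) fun x _ y _ => by
      rw [one_mul, ← dist_eq_norm]
      exact (le_max_left _ _).trans (le_max_right _ _)
  have hM : BddLip S fun x => x.2.2 := BddLip.intro R 1 (fun x hx => by
      rw [Real.norm_of_nonneg (hm.le.trans hx.2.2.1)]
      exact hx.2.2.2) fun x _ y _ => by
      rw [one_mul, ← dist_eq_norm]
      exact (le_max_right _ _).trans (le_max_right _ _)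
  have hF := hz.force q hp k hε
  have hN := hz.penalAt hσ q p k ε
  have hf := hF.complexClm Λ₀
  have hn := hN.complexClm Λ₀
  let disc : L2 × ℝ × ℝ → ℝ := fun x =>
    penDisc (Λ₀ (force q p hp k ε x.1)) (Λ₀ (penalAt q p k ε x.2.1 x.1)) x.2.2
  let g : L2 × ℝ × ℝ → ℝ := fun x =>
    penRoot (Λ₀ (force q p hp k ε x.1)) (Λ₀ (penalAt q p k ε x.2.1 x.1)) x.2.2
  have hdisc : BddLip S disc := bddLip_penDisc hf hn hM
  let S' : Set (L2 × ℝ × ℝ) := S ∩ {x | d ^ 2 / 2 ≤ disc x}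
  have hSS : S' ⊆ S := Set.inter_subset_left
  have hg : BddLip S' g := bddLip_penRoot (hf.mono hSS) (hn.mono hSS) (hM.mono hSS) hm
    (fun x hx => hx.1.2.2.1) (by positivity : 0 < d ^ 2 / 2) fun x hx => hx.2
  have hl : BddLip S' fun x => 2 * g x - g x * g x :=
    ((BddLip.const S' (2 : ℝ)).mul hg).sub (hg.mul hg)
  let V : L2 × ℝ × ℝ → L2 := fun x => force q p hp k ε x.1 - g x • penalAt q p k ε x.2.1 x.1
  have hV : BddLip S' V := (hF.mono hSS).sub (hg.smul (hN.mono hSS))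
  obtain ⟨C₁, h10, -, h1⟩ := id hdisc
  obtain ⟨C₂, h20, -, h2⟩ := id hg
  obtain ⟨C₃, h30, -, h3⟩ := hl
  obtain ⟨C₄, h40, h4b, h4⟩ := id hV
  have hδs := Real.sqrt_pos.2 hδ
  -- Within distance r of the initial point one stays in S, the discriminant keeps half of its lower
  -- bound d², γ cannot pass 1, λ moves by at most δ/2, and Λˢ_ε moves states by at most η.
  obtain ⟨r, hr, hr1, hrd, hrδ, hrl, hrη⟩ : ∃ r : ℝ, 0 < r ∧ r ≤ 1 ∧ C₁ * r ≤ d ^ 2 / 2 ∧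
      C₂ * r ≤ Real.sqrt δ ∧ C₃ * r ≤ δ / 2 ∧ ‖Λ₀‖ * r ≤ η := by
    have aux : ∀ C b : ℝ, 0 ≤ C → 0 < b → ∀ r : ℝ, 0 ≤ r → r ≤ b / (C + 1) → C * r ≤ b := by
      intro C b hC hb r hr0 hr
      rw [le_div_iff₀ (by linarith)] at hr
      nlinarith
    have p1 : 0 < d ^ 2 / 2 / (C₁ + 1) := by positivity
    have p2 : 0 < Real.sqrt δ / (C₂ + 1) := by positivity
    have p3 : 0 < δ / 2 / (C₃ + 1) := by positivity
    have p4 : 0 < η / (‖Λ₀‖ + 1) := by positivity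
    let r := min 1 (min (d ^ 2 / 2 / (C₁ + 1)) (min (Real.sqrt δ / (C₂ + 1))
      (min (δ / 2 / (C₃ + 1)) (η / (‖Λ₀‖ + 1)))))
    have hr : 0 < r := lt_min one_pos (lt_min p1 (lt_min p2 (lt_min p3 p4)))
    have q1 : r ≤ min (d ^ 2 / 2 / (C₁ + 1)) (min (Real.sqrt δ / (C₂ + 1))
      (min (δ / 2 / (C₃ + 1)) (η / (‖Λ₀‖ + 1)))) := min_le_right _ _
    have q2 := q1.trans (min_le_right _ _)
    have q3 := q2.trans (min_le_right _ _)
    exact ⟨r, hr, min_le_left _ _, aux _ _ h10 (by positivity) r hr.le (q1.trans (min_le_left _ _)),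
      aux _ _ h20 hδs r hr.le (q2.trans (min_le_left _ _)),
      aux _ _ h30 (by positivity) r hr.le (q3.trans (min_le_left _ _)),
      aux _ _ (norm_nonneg _) hη r hr.le (q3.trans (min_le_right _ _))⟩
  have hL0 : 0 < C₄ + R + r := by positivity
  -- The first bound limits the drift of the coefficient ε⁷t to r; the second is the Picard
  -- condition, with C₄ bounding the field and R the initial velocity.
  refine ⟨min (r / ε ^ 7) (r / (C₄ + R + r)), lt_min (by positivity) (by positivity), ?_⟩
  set τ := min (r / ε ^ 7) (r / (C₄ + R + r)) with hτdef
  have hτ : 0 < τ := lt_min (by positivity) (by positivity)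
  have hτ1 : ε ^ 7 * τ ≤ r := by
    have : τ ≤ r / ε ^ 7 := min_le_left _ _
    rw [le_div_iff₀ (by positivity)] at this
    linarith
  have hτ2 : (C₄ + R + r) * τ ≤ r := by
    have : τ ≤ r / (C₄ + R + r) := min_le_right _ _
    rw [le_div_iff₀ (by positivity)] at this
    linarith
  intro z₀ v₀ T M γ₀ hz₀ hv₀ hz₀R hv₀R hTR hmM hMR hγ₀ hδγ Λ hΛ hroot hnd
  subst hΛ
  have hM0 : 0 < M := hm.trans_le hmM
  let pt : ℝ → L2 → L2 × ℝ × ℝ := fun t y => (y, ε ^ 7 * t + ε ^ 5 * T, M)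
  have hx₀ : pt 0 z₀ = (z₀, ε ^ 5 * T, M) := by simp [pt]
  have hx₀S : pt 0 z₀ ∈ S := by
    rw [hx₀]
    refine ⟨by linarith, ?_, hmM, hMR⟩
    change |ε ^ 5 * T| ≤ ε ^ 5 * R + 1
    rw [abs_mul, abs_of_pos (by positivity : 0 < ε ^ 5)]
    have : ε ^ 5 * |T| ≤ ε ^ 5 * R := by gcongr
    linarith
  have hdisc₀ : d ^ 2 ≤ disc (pt 0 z₀) := by
    rw [hx₀]
    change d ^ 2 ≤ penDisc _ _ _
    rw [penDisc_of_root hroot]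
    gcongr
  have hg₀ : g (pt 0 z₀) = γ₀ := by
    rw [hx₀]
    exact penRoot_of_root hM0 hroot (hd.le.trans hnd)
  have hdist : ∀ t ∈ Set.Icc 0 τ, ∀ y ∈ Metric.closedBall z₀ r,
      dist (pt t y) (pt 0 z₀) ≤ r := by
    intro t ht y hy
    refine max_le hy (max_le ?_ ?_)
    · change dist (ε ^ 7 * t + ε ^ 5 * T) (ε ^ 7 * 0 + ε ^ 5 * T) ≤ r
      rw [Real.dist_eq, show ε ^ 7 * t + ε ^ 5 * T - (ε ^ 7 * 0 + ε ^ 5 * T) = ε ^ 7 * t by ring,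
        abs_of_nonneg (mul_nonneg (by positivity) ht.1)]
      refine le_trans ?_ hτ1
      gcongr
      exact ht.2
    · change dist M M ≤ r
      rw [dist_self]
      exact hr.le
  have hptS : ∀ t ∈ Set.Icc 0 τ, ∀ y ∈ Metric.closedBall z₀ r, pt t y ∈ S' := by
    intro t ht y hy
    have hmem : pt t y ∈ S := by
      refine ⟨?_, ?_, hmM, hMR⟩
      · change ‖y‖ ≤ R + 1
        have h5 : ‖y - z₀‖ ≤ r := by rw [← dist_eq_norm]; exact hy
        have h6 := norm_add_le (y - z₀) z₀
        rw [sub_add_cancel] at h6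
        linarith
      · change |ε ^ 7 * t + ε ^ 5 * T| ≤ ε ^ 5 * R + 1
        refine (abs_add_le _ _).trans ?_
        rw [abs_mul (ε ^ 5), abs_of_pos (by positivity : 0 < ε ^ 5),
          abs_of_nonneg (mul_nonneg (by positivity) ht.1)]
        have h5 : ε ^ 5 * |T| ≤ ε ^ 5 * R := by gcongr
        have h6 : ε ^ 7 * t ≤ ε ^ 7 * τ := by gcongr; exact ht.2
        linarith
    refine ⟨hmem, ?_⟩
    change d ^ 2 / 2 ≤ disc (pt t y)
    have h5 := h1 _ hmem _ hx₀S
    have h6 : C₁ * dist (pt t y) (pt 0 z₀) ≤ C₁ * r :=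
      mul_le_mul_of_nonneg_left (hdist t ht y hy) h10
    rw [Real.norm_eq_abs] at h5
    have h7 := neg_abs_le (disc (pt t y) - disc (pt 0 z₀))
    linarith
  have hpt0S' : pt 0 z₀ ∈ S' :=
    hptS 0 (Set.left_mem_Icc.2 hτ.le) z₀ (Metric.mem_closedBall_self hr.le)
  obtain ⟨z, v, hz0, hv0, hsol⟩ := exists_second_order (Φ := fun t y => V (pt t y)) (z₀ := z₀)
    (v₀ := v₀) (L := C₄ + R) hr h40 hτ (by linarith) hτ2
    (fun t ht x hx y hy => by
      refine (h4 _ (hptS t ht x hx) _ (hptS t ht y hy)).trans (le_of_eq ?_)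
      congr 1
      simp [pt, Prod.dist_eq, dist_nonneg])
    (fun x hx => hV.continuousOn.comp
      (by simp only [pt]; fun_prop) fun t ht => hptS t ht x hx)
    (fun t ht x hx => by
      have := h4b _ (hptS t ht x hx)
      linarith)
  have hzc : ContinuousOn z (Set.Icc 0 τ) := fun t ht => (hsol t ht).2.2.1.continuousWithinAt
  have hptc : ContinuousOn (fun t => pt t (z t)) (Set.Icc 0 τ) := by
    refine hzc.prodMk ?_
    fun_prop
  have hVc : ContinuousOn (fun t => V (pt t (z t))) (Set.Icc 0 τ) :=
    hV.continuousOn.comp hptc fun t ht => hptS t ht _ (hsol t ht).1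
  have hvb := eq_band_of_deriv (k := k) (y := v) (by rw [hv0]; exact hv₀) (fun t ht => by
    simp only [V]
    rw [real_smul_eq, band_eq_bandOp, map_sub, map_smul, ← band_eq_bandOp, ← band_eq_bandOp,
      band_force, band_penalAt]) fun t ht => (hsol t ht).2.2.2
  have hzb := eq_band_of_deriv (k := k) (y := z) (by rw [hz0]; exact hz₀) hvb
    fun t ht => (hsol t ht).2.2.1
  have hΛr : ∀ y y₀ : L2, y ∈ Metric.closedBall y₀ r → ‖Λ₀ (y - y₀)‖ ≤ η := by
    intro y y₀ hy
    refine (Λ₀.le_opNorm _).trans (le_trans ?_ hrη)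
    rw [← dist_eq_norm]
    exact mul_le_mul_of_nonneg_left hy (norm_nonneg _)
  refine ⟨z, v, fun t => g (pt t (z t)), hz0, hv0, by simp only [hz0, hg₀], hVc, fun t ht => ?_⟩
  obtain ⟨hs1, hs2, hs3, hs4⟩ := hsol t ht
  have hmem := hptS t ht _ hs1
  have hdt := hdist t ht _ hs1
  refine ⟨hzb t ht, hvb t ht, hΛr _ _ hs1, hΛr _ _ hs2, ?_, ?_, ?_, hs3, hs4⟩
  · have h5 := h2 _ hmem _ hpt0S'
    rw [hg₀, Real.norm_eq_abs] at h5
    have h6 := (le_abs_self _).trans h5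
    have h7 : C₂ * dist (pt t (z t)) (pt 0 z₀) ≤ C₂ * r := mul_le_mul_of_nonneg_left hdt h20
    have h8 : Real.sqrt δ ≤ 1 - γ₀ := Real.sqrt_le_iff.2 ⟨by linarith, hδγ⟩
    linarith
  · exact penRoot_spec hM0 ((by positivity : (0 : ℝ) ≤ d ^ 2 / 2).trans hmem.2)
  · have h5 := h3 _ hmem _ hpt0S'
    rw [Real.norm_eq_abs] at h5
    simp only [hg₀] at h5
    have h7 : C₃ * dist (pt t (z t)) (pt 0 z₀) ≤ C₃ * r := mul_le_mul_of_nonneg_left hdt h30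
    simp only [sq]
    linarith

end LocalSolution

end

end Progenitor

namespace Progenitor

noncomputable section

/-! ### From the abstract solution to the progenitor equation -/

section Solution

theorem pointValue_zero (x : Plane) : pointValue 0 x = 0 := by
  simpa using pointValue_smul 0 0 x

theorem pointValue_sub {f g : L2} (hf : Integrable (𝓕 f : L2)) (hg : Integrable (𝓕 g : L2))
    (x : Plane) : pointValue (f - g) x = pointValue f x - pointValue g x := by
  have h1 : Integrable (𝓕 ((-1 : ℂ) • g) : L2) :=
    (hg.const_mul (-1)).congr (fourier_smul_ae (-1) g).symm
  rw [sub_eq_add_neg, ← neg_one_smul ℂ g, pointValue_add hf h1, pointValue_smul]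
  ring

/-- All terms are band limited, so their point values are given by convergent integrals and add up;
an identity in L² then holds at every point. -/
theorem equationAt_of_eq {q : ℕ} {s p k ε ν T t γ : ℝ} {A₀ z w : L2}
    (hp : 0 < p) (hz : z = band k z)
    (hw : w = -absD p z - semilinear q p k ε z - (γ : ℂ) • penal q p k ε T t z)
    (hγ : pen (controlNorm s p k ε ν A₀ w) = γ) : EquationAt q s p k ε ν T A₀ t z w := by
  intro x
  have hbD : absD p z = band k (absD p z) := by rw [absD_of_band hp hz, band_bandOp]
  have hbS : semilinear q p k ε z = band k (semilinear q p k ε z) := (band_semilinear _ _ _ _ _).symm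
  have hbN : (γ : ℂ) • penal q p k ε T t z = band k ((γ : ℂ) • penal q p k ε T t z) := by
    rw [penal_eq_penalAt q p k ε T t hz, band_eq_bandOp, map_smul, ← band_eq_bandOp, band_penalAt]
  have hbw : w = band k w := by
    rw [hw, band_eq_bandOp, map_sub, map_sub, map_neg, ← band_eq_bandOp, ← band_eq_bandOp,
      ← band_eq_bandOp, ← hbD, ← hbS, ← hbN]
  have hadd : ∀ {f g : L2}, f = band k f → g = band k g → f + g = band k (f + g) := by
    intro f g hf hg
    rw [band_eq_bandOp, map_add, ← band_eq_bandOp, ← band_eq_bandOp, ← hf, ← hg]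
  have i1 := integrable_fourier_of_band hbw
  have i2 := integrable_fourier_of_band hbD
  have i3 := integrable_fourier_of_band hbS
  have i4 := integrable_fourier_of_band hbN
  have i12 := integrable_fourier_of_band (hadd hbw hbD)
  have i123 := integrable_fourier_of_band (hadd (hadd hbw hbD) hbS)
  rw [hγ, ← pointValue_smul, ← pointValue_add i1 i2, ← pointValue_add i12 i3,
    ← pointValue_add i123 i4]
  have h0 : w + absD p z + semilinear q p k ε z + (γ : ℂ) • penal q p k ε T t z = 0 := by
    rw [hw]; abel
  rw [h0, pointValue_zero]

theorem continuous_pointValue_uncurry {α : Type*} [TopologicalSpace α] {k : ℝ} {G : α → L2}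
    (hG : Continuous G) (hb : ∀ t, G t = band k (G t)) :
    Continuous fun y : α × Plane => pointValue (G y.1) y.2 := by
  obtain ⟨C, hC0, hC⟩ := norm_pointValue_band_le k
  rw [continuous_iff_continuousAt]
  rintro ⟨t₀, x₀⟩
  have hi : ∀ t, Integrable (𝓕 (G t) : L2) := fun t => integrable_fourier_of_band (hb t)
  have h1 : Continuous fun y : α × Plane =>
      C * ‖G y.1 - G t₀‖ + ‖pointValue (G t₀) y.2 - pointValue (G t₀) x₀‖ := by
    have := continuous_pointValue (hi t₀)
    fun_prop
  have h2 := h1.tendsto (t₀, x₀)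
  simp only [sub_self, norm_zero, mul_zero, add_zero] at h2
  refine tendsto_iff_norm_sub_tendsto_zero.2 (squeeze_zero (fun _ => norm_nonneg _)
    (fun y => ?_) h2)
  have hbs : G y.1 - G t₀ = band k (G y.1 - G t₀) := by
    rw [band_eq_bandOp, map_sub, ← band_eq_bandOp, ← band_eq_bandOp, ← hb, ← hb]
  have h3 := hC _ hbs y.2
  rw [pointValue_sub (hi _) (hi _)] at h3
  calc _ ≤ ‖pointValue (G y.1) y.2 - pointValue (G t₀) y.2‖
        + ‖pointValue (G t₀) y.2 - pointValue (G t₀) x₀‖ := norm_sub_le_norm_sub_add_norm_sub _ _ _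
    _ ≤ _ := by gcongr

/-- The constructed acceleration is continuous in time, so measurability, boundedness and the
integral formula follow from continuity on a compact interval and Bernstein's inequality. -/
theorem isSolution_of_continuousOn {q : ℕ} {s p k ε ν T τ : ℝ} {A₀ : L2} {z zt ztt : ℝ → L2}
    (hτ : 0 < τ) (hc : ContinuousOn ztt (Set.Icc 0 τ))
    (hb : ∀ t ∈ Set.Icc 0 τ, ztt t = band k (ztt t))
    (hz : ∀ t ∈ Set.Icc 0 τ, HasDerivWithinAt z (zt t) (Set.Icc 0 τ) t)
    (hzt : ∀ t ∈ Set.Icc 0 τ, HasDerivWithinAt zt (ztt t) (Set.Icc 0 τ) t)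
    (heq : ∀ t ∈ Set.Icc 0 τ, EquationAt q s p k ε ν T A₀ t (z t) (ztt t)) :
    IsSolution q s p k ε ν T A₀ τ z zt ztt := by
  have hLc : ContinuousOn (fun t => Lam s k ε (ztt t)) (Set.Icc 0 τ) :=
    ((bandOp k (besselC s k ε)).continuous.comp_continuousOn hc).congr
      fun t ht => Lam_of_band (hb t ht)
  have hLb : ∀ t ∈ Set.Icc 0 τ, Lam s k ε (ztt t) = band k (Lam s k ε (ztt t)) :=
    fun t ht => band_Lam (hb t ht)
  obtain ⟨B, hB⟩ := isCompact_Icc.exists_bound_of_continuousOn hLc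
  refine ⟨hz, ?_, fun t ht => ?_, ?_, ?_, ?_, ?_, heq τ (Set.right_mem_Icc.2 hτ.le)⟩
  · exact ContinuousOn.intervalIntegrable (by rwa [Set.uIcc_of_le hτ.le])
  · have hsub : Set.Icc 0 t ⊆ Set.Icc 0 τ := Set.Icc_subset_Icc_right ht.2
    rw [intervalIntegral.integral_eq_sub_of_hasDerivAt_of_le ht.1
      (fun u hu => ((hzt u (hsub hu)).continuousWithinAt).mono hsub)
      (fun u hu => (hzt u (hsub (Set.Ioo_subset_Icc_self hu))).hasDerivAt
        (Icc_mem_nhds hu.1 (hu.2.trans_le ht.2)))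
      (ContinuousOn.intervalIntegrable (by rw [Set.uIcc_of_le ht.1]; exact hc.mono hsub))]
    abel
  · refine (continuous_pointValue_uncurry (k := k)
      (G := fun t : Set.Icc 0 τ => Lam s k ε (ztt t)) ?_ fun t => hLb t t.2).measurable
    exact continuousOn_iff_continuous_domRestrict.1 hLc
  · obtain ⟨C, hC0, hC⟩ := norm_pointValue_band_le k
    exact ⟨C * B, fun t ht x => (hC _ (hLb t ht) x).trans
      (mul_le_mul_of_nonneg_left (hB t ht) hC0)⟩
  · refine memLp_top_of_bound (hLc.aestronglyMeasurable measurableSet_Icc) B ?_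
    exact (ae_restrict_iff' measurableSet_Icc).2 (Filter.Eventually.of_forall hB)
  · exact (ae_restrict_iff' measurableSet_Icc).2 (Filter.Eventually.of_forall heq)

end Solution

/-! ### Nondegeneracy of the root -/

section Nondegenerate

/-- Since g' = 1/(2√(1 - λ)) and 1 - g = √(1 - λ), an upper bound on g' is a lower bound on 1 - g.
-/
theorem one_sub_pen_ge {l e 𝒞 : ℝ} (hl : l < 1) (he : 0 < e) (h𝒞 : 0 < 𝒞)
    (h : deriv pen l ≤ 16 / (𝒞 * e)) : 𝒞 / 32 * e ≤ 1 - pen l := by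
  have hs : 0 < Real.sqrt (1 - l) := Real.sqrt_pos.2 (by linarith)
  rw [deriv_pen hl, div_le_div_iff₀ (by positivity) (by positivity)] at h
  rw [one_sub_pen]
  linarith

theorem norm_Lam_penalAt_le {q : ℕ} {s p k ε τ K : ℝ} (hε : 0 < ε) (hτ : 0 ≤ τ)
    (hK : ∀ f : L2, f = band k f →
      ‖Lam s k ε (band k (powTerm q 1 f))‖ ≤ K * supNorm f ^ (q - 1) * ‖Lam s k ε f‖)
    {z : L2} (hz : z = band k z) :
    ‖bandOp k (besselC s k ε) (penalAt q p k ε τ z)‖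
      ≤ freq p k ^ 2 * (ε ^ (q + 4) + 2 * τ * (K * supNorm z ^ (q - 1))) * ‖Lam s k ε z‖ := by
  have h1 := hK z hz
  rw [Lam_of_band (band_band k _).symm] at h1
  rw [penalAt, ← hz, map_smul, map_add, map_smul, map_smul, ← Lam_of_band hz, norm_smul,
    Complex.norm_real, Real.norm_of_nonneg (by positivity), mul_assoc (freq p k ^ 2)]
  refine mul_le_mul_of_nonneg_left ((norm_add_le _ _).trans ?_) (by positivity)
  rw [norm_smul, norm_smul, Complex.norm_real, Real.norm_of_nonneg (by positivity), norm_mul,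
    norm_mul, Complex.norm_I, Complex.norm_real, Real.norm_of_nonneg hτ, Complex.norm_ofNat, mul_one,
    add_mul, mul_assoc (2 * τ)]
  gcongr

end Nondegenerate

end

end Progenitor

namespace Progenitor

noncomputable section

/-! ### Local existence for the progenitor equation -/

section Existence

/-- The factor in the control functional. -/
def controlScale (s p k ν : ℝ) (A₀ : L2) : ℝ := ν ^ 2 * freq p k ^ 4 * sobNorm s A₀ ^ 2

theorem controlNorm_mul_scale {s p k ε ν : ℝ} {A₀ f : L2} (h : controlScale s p k ν A₀ ≠ 0) :
    ‖Lam s k ε f‖ ^ 2 = controlScale s p k ν A₀ * controlNorm s p k ε ν A₀ f := by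
  rw [controlNorm, ← controlScale]
  field_simp

/-- The first term is at least 6b²N²e and the inner product at least -3bN²e; for b > 1 one has 6b² -
3b ≥ 3. It is applied with b = ν and N = ω²‖A₀‖_{Hˢ}. -/
theorem nondegenerate_of_bounds {X : Type*} [NormedAddCommGroup X] [InnerProductSpace ℝ X]
    {w n : X} {M N γ b e : ℝ} (hw : ‖w‖ ^ 2 ≤ M) (hn : ‖n‖ ≤ 3 * N * e) (he : 0 ≤ e)
    (hN : 0 ≤ N) (hMN : M = b ^ 2 * N ^ 2) (hb : 1 < b) (hγ : 6 * e ≤ 1 - γ) :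
    3 * N ^ 2 * e ≤ M * (1 - γ) + inner ℝ w n := by
  have h1 : ‖w‖ ≤ b * N := le_of_sq_le_sq (by rw [mul_pow, ← hMN]; exact hw) (by positivity)
  have h2 : -(b * N * (3 * N * e)) ≤ inner ℝ w n := by
    refine neg_le_of_abs_le ((abs_real_inner_le_norm w n).trans ?_)
    gcongr
  have h3 : M * (6 * e) ≤ M * (1 - γ) := by
    refine mul_le_mul_of_nonneg_left hγ ?_
    rw [hMN]; positivity
  have h4 : 0 ≤ N ^ 2 * e := by positivity
  have h5 : 3 * (N ^ 2 * e) ≤ (6 * b ^ 2 - 3 * b) * (N ^ 2 * e) := by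
    refine mul_le_mul_of_nonneg_right ?_ h4
    nlinarith
  rw [hMN] at h3 ⊢
  nlinarith

-- The ranges ε ≤ ‖A₀‖_{Hˢ} ≤ 1/ε and 𝐓 ≤ 1/ε turn every bound on the data into one in ε, k, p and s
-- alone, so τ can precede ν, 𝐓 and A₀.
set_option maxHeartbeats 2000000 in
theorem exists_solution (q : ℕ) (hq : 1 ≤ q) {s p k ε δ K : ℝ} (hp : 0 < p) (hk : 0 < k)
    (hε : 0 < ε) (hδ : 0 < δ) (hK0 : 0 ≤ K)
    (hK : ∀ f : L2, f = band k f →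
      ‖Lam s k ε (band k (powTerm q 1 f))‖ ≤ K * supNorm f ^ (q - 1) * ‖Lam s k ε f‖) :
    ∃ τ : ℝ, 0 < τ ∧ ∀ (ν Tmax : ℝ) (A₀ : L2), 1 < ν → ν < 2 → 0 < Tmax → Tmax ≤ 1 / ε →
      ε ≤ sobNorm s A₀ → sobNorm s A₀ ≤ 1 / ε →
      4 * 2 ^ q * K * freq p k ^ (4 / p - 1) * Tmax * supNorm A₀ ^ (q - 1) ≤ 1 →
      ∀ T : ℝ, 0 ≤ T → T ≤ 2 * freq p k ^ (4 / p - 1) * Tmax →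
      ∀ u₀ v₀ w₀ : L2, u₀ = band k u₀ → v₀ = band k v₀ → w₀ = band k w₀ →
        ‖u₀‖ ≤ 2 * sobNorm s A₀ →
        (freq p k)⁻¹ * ‖v₀‖ ≤ 2 * sobNorm s A₀ →
        supNorm (Lam (-s) k ε u₀) ≤ 2 * ε * supNorm A₀ →
        Compatible q s p k ε ν T A₀ (Lam (-s) k ε u₀) (Lam (-s) k ε w₀) →
        ∀ lam₀ : ℝ, lam₀ = controlNorm s p k ε ν A₀ (Lam (-s) k ε w₀) →
        δ = 1 - lam₀ → deriv pen lam₀ ≤ 16 / (192 * ε ^ (q + 4)) →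
        ∃ z zt ztt : ℝ → L2,
          z 0 = Lam (-s) k ε u₀ ∧ zt 0 = Lam (-s) k ε v₀ ∧ ztt 0 = Lam (-s) k ε w₀ ∧
          IsSolution q s p k ε ν T A₀ τ z zt ztt ∧
          (∀ t ∈ Set.Icc 0 τ,
            z t = band k (z t) ∧ zt t = band k (zt t) ∧ ztt t = band k (ztt t)) ∧
          ContinuousOn (fun t => Lam s k ε (z t)) (Set.Icc 0 τ) ∧
          ContinuousOn (fun t => Lam s k ε (zt t)) (Set.Icc 0 τ) ∧
          (∀ t ∈ Set.Icc 0 τ,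
            ‖Lam s k ε (z t)‖ ≤ 3 * sobNorm s A₀ ∧
            (freq p k)⁻¹ * ‖Lam s k ε (zt t)‖ ≤ 3 * sobNorm s A₀) ∧
          (∀ t ∈ Set.Icc 0 τ,
            |controlNorm s p k ε ν A₀ (ztt t) - lam₀| ≤ 1 / 2 * (1 - lam₀)) := by
  have hω : 0 < freq p k := freq_pos hk
  set ω := freq p k with hωdef
  set Ψ : L2 →L[ℂ] L2 := bandOp k (besselC (-s) k ε) with hΨ
  set θ : ℝ := ω ^ (4 / p - 1) with hθdef
  have hθ : 0 < θ := Real.rpow_pos_of_pos hω _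
  set R : ℝ := 1 + ‖Ψ‖ * (2 * (1 / ε)) + ‖Ψ‖ * (2 * ω * (1 / ε)) + 2 * θ * (1 / ε)
    + 4 * ω ^ 4 * (1 / ε) ^ 2 with hR
  have hΨ0 := norm_nonneg Ψ
  have r1 : 0 ≤ ‖Ψ‖ * (2 * (1 / ε)) := by positivity
  have r2 : 0 ≤ ‖Ψ‖ * (2 * ω * (1 / ε)) := by positivity
  have r3 : 0 ≤ 2 * θ * (1 / ε) := by positivity
  have r4 : 0 ≤ 4 * ω ^ 4 * (1 / ε) ^ 2 := by positivity
  -- Here d and m are the nondegeneracy bound and the scale M with ‖A₀‖_{Hˢ} replaced by ε and ν by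
  -- 1. The choice of η lets the norms grow from 2‖A₀‖_{Hˢ} to at most 3‖A₀‖_{Hˢ}.
  obtain ⟨τ, hτ, H⟩ := exists_uniform_solution q hp k s (d := 3 * (ω ^ 2 * ε) ^ 2 * ε ^ (q + 4))
    (m := ω ^ 4 * ε ^ 2) (R := R) (η := min ε (ω * ε)) hε hδ (by positivity) (by positivity)
    (by linarith) (lt_min hε (by positivity))
  refine ⟨τ, hτ, fun ν Tmax A₀ hν1 hν2 hTm hTmε haε haε' hKT T hT0 hT u₀ v₀ w₀ hu hv hw hun hvn hsup
    hcomp lam₀ hlam hδl hder => ?_⟩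
  set a := sobNorm s A₀ with ha
  have ha0 : 0 < a := hε.trans_le haε
  have hl1 : lam₀ < 1 := by linarith
  set M := controlScale s p k ν A₀ with hM
  have hMdef : M = ν ^ 2 * (ω ^ 2 * a) ^ 2 := by rw [hM, controlScale, ← hωdef, ← ha]; ring
  have hM0 : 0 < M := by rw [hMdef]; positivity
  set z₀ := Lam (-s) k ε u₀ with hz₀
  set y₀ := Lam (-s) k ε v₀ with hy₀
  have hzb : z₀ = band k z₀ := band_Lam hu
  have hyb : y₀ = band k y₀ := band_Lam hv
  have hΛz : Lam s k ε z₀ = u₀ := Lam_Lam_neg hu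
  have hΛw : Lam s k ε (Lam (-s) k ε w₀) = w₀ := Lam_Lam_neg hw
  have hΛy : Lam s k ε y₀ = v₀ := Lam_Lam_neg hv
  have hvn' : ‖v₀‖ ≤ 2 * ω * a := by
    rw [inv_mul_le_iff₀ hω] at hvn
    linarith
  have hz₀R : ‖z₀‖ ≤ ‖Ψ‖ * (2 * (1 / ε)) := by
    rw [hz₀, Lam_of_band hu]
    refine (Ψ.le_opNorm _).trans ?_
    gcongr
    linarith
  have hy₀R : ‖y₀‖ ≤ ‖Ψ‖ * (2 * ω * (1 / ε)) := by
    rw [hy₀, Lam_of_band hv]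
    refine (Ψ.le_opNorm _).trans ?_
    gcongr
    exact hvn'.trans (by gcongr)
  have hTR : |T| ≤ 2 * θ * (1 / ε) := by
    rw [abs_of_nonneg hT0]
    exact hT.trans (by gcongr)
  have hMm : ω ^ 4 * ε ^ 2 ≤ M := by
    rw [hMdef]
    have h1 : ω ^ 4 * ε ^ 2 ≤ (ω ^ 2 * a) ^ 2 := by
      rw [mul_pow, ← pow_mul]
      gcongr
    exact h1.trans (le_mul_of_one_le_left (sq_nonneg _) (one_le_pow₀ hν1.le))
  have hMR : M ≤ 4 * ω ^ 4 * (1 / ε) ^ 2 := by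
    rw [hMdef, mul_pow, ← pow_mul, ← mul_assoc]
    have h2 : ν ^ 2 ≤ 4 := by nlinarith
    gcongr
  set γ₀ := pen lam₀ with hγ₀
  have hγ1 : 6 * ε ^ (q + 4) ≤ 1 - γ₀ := by
    have := one_sub_pen_ge (𝒞 := 192) hl1 (by positivity) (by norm_num) hder
    linarith
  have he0 : 0 < ε ^ (q + 4) := by positivity
  have hγlt : γ₀ < 1 := by linarith
  have hδγ : (1 - γ₀) ^ 2 = δ := by
    rw [hγ₀, one_sub_pen, Real.sq_sqrt (by linarith), hδl]
  set Λ : L2 →L[ℂ] L2 := bandOp k (besselC s k ε) with hΛ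
  set N₀ := penalAt q p k ε (ε ^ 5 * T) z₀ with hN₀
  set F₀ := force q p hp k ε z₀ with hF₀
  have hw₀ : Lam (-s) k ε w₀ = F₀ - γ₀ • N₀ := by
    have h1 := hcomp
    rw [Compatible, ← hlam, penal_eq_penalAt q p k ε T 0 hzb, mul_zero, zero_add,
      ← force_eq q hp k ε hzb, ← real_smul_eq] at h1
    exact h1
  have hw₁ : Λ F₀ - γ₀ • Λ N₀ = w₀ := by
    rw [← hΛw, Lam_of_band (band_Lam hw), hw₀, real_smul_eq, real_smul_eq, map_sub, map_smul]
  have hwn : ‖w₀‖ ^ 2 = M * lam₀ := by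
    rw [hlam, hM, ← controlNorm_mul_scale hM0.ne', hΛw]
  have hroot : ‖Λ F₀ - γ₀ • Λ N₀‖ ^ 2 = M * (2 * γ₀ - γ₀ ^ 2) := by
    rw [hw₁, hwn, hγ₀, two_mul_pen_sub_sq hl1.le]
  have hNn : ‖Λ N₀‖ ≤ 3 * (ω ^ 2 * a) * ε ^ (q + 4) := by
    have h1 := norm_Lam_penalAt_le (p := p) (τ := ε ^ 5 * T) hε (by positivity) hK hzb
    rw [hΛz, ← hωdef] at h1
    have hs0 := supNorm_nonneg z₀
    have hs1 := supNorm_nonneg A₀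
    -- The sup norm of order ε contributes ε^(q-1), which with ε⁵ matches the linear coefficient
    -- ε^(q+4). The factor 4 · 2^q in the smallness condition is fixed by this line.
    have h2 : 2 * (ε ^ 5 * T) * (K * supNorm z₀ ^ (q - 1)) ≤ 1 / 2 * ε ^ (q + 4) := by
      calc _ ≤ 2 * (ε ^ 5 * (2 * θ * Tmax)) * (K * (2 * ε * supNorm A₀) ^ (q - 1)) := by gcongr
        _ = 1 / 2 * ε ^ (q + 4) * (4 * 2 ^ q * K * θ * Tmax * supNorm A₀ ^ (q - 1)) := by
          obtain ⟨n, rfl⟩ : ∃ n, q = n + 1 := ⟨q - 1, by omega⟩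
          rw [Nat.add_sub_cancel, mul_pow, mul_pow]
          ring
        _ ≤ _ := mul_le_of_le_one_right (by positivity) hKT
    calc _ ≤ ω ^ 2 * (ε ^ (q + 4) + 2 * (ε ^ 5 * T) * (K * supNorm z₀ ^ (q - 1))) * ‖u₀‖ := h1
      _ ≤ ω ^ 2 * (ε ^ (q + 4) + 1 / 2 * ε ^ (q + 4)) * (2 * a) := by gcongr
      _ = _ := by ring
  have hnd := nondegenerate_of_bounds (w := Λ F₀ - γ₀ • Λ N₀) (n := Λ N₀) (γ := γ₀)
    (by rw [hw₁, hwn]; exact mul_le_of_le_one_right hM0.le hl1.le) hNn he0.le (by positivity)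
    hMdef hν1 hγ1
  have hnd' : 3 * (ω ^ 2 * ε) ^ 2 * ε ^ (q + 4) ≤ 3 * (ω ^ 2 * a) ^ 2 * ε ^ (q + 4) := by gcongr
  obtain ⟨z, v, γ, hz0, hv0, hγ0, hcont, hsol⟩ := H z₀ y₀ T M γ₀ hzb hyb (by linarith)
    (by linarith) (by linarith) hMm (by linarith) hγlt hδγ.ge Λ rfl hroot (hnd'.trans hnd)
  set ztt : ℝ → L2 := fun t => force q p hp k ε (z t)
          - γ t • penalAt q p k ε (ε ^ 7 * t + ε ^ 5 * T) (z t) with hztt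
  have hzttb : ∀ t, ztt t = band k (ztt t) := fun t => by
    rw [hztt]
    simp only
    rw [real_smul_eq, band_eq_bandOp, map_sub, map_smul, ← band_eq_bandOp, ← band_eq_bandOp,
      band_force, band_penalAt]
  have hctrl : ∀ t ∈ Set.Icc 0 τ, controlNorm s p k ε ν A₀ (ztt t) = 2 * γ t - γ t ^ 2 := by
    intro t ht
    have h1 := (hsol t ht).2.2.2.2.2.1
    have h2 := controlNorm_mul_scale (s := s) (p := p) (k := k) (ε := ε) (ν := ν) (A₀ := A₀)
      (f := ztt t) hM0.ne'
    rw [Lam_of_band (hzttb t)] at h2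
    have h3 : Λ (ztt t) = Λ (force q p hp k ε (z t))
        - γ t • Λ (penalAt q p k ε (ε ^ 7 * t + ε ^ 5 * T) (z t)) := by
      rw [hztt, real_smul_eq]
      simp only
      rw [real_smul_eq, map_sub, map_smul]
    rw [← hΛ, h3, h1] at h2
    exact (mul_left_cancel₀ hM0.ne' h2).symm
  have hΛtri : ∀ {y y' u : L2} {η : ℝ}, y = band k y → y' = band k y' → Lam s k ε y' = u →
      ‖Λ (y - y')‖ ≤ η → ‖Lam s k ε y‖ ≤ ‖u‖ + η := by
    intro y y' u η hy hy' hu' hη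
    rw [map_sub, ← Lam_of_band hy, ← Lam_of_band hy', hu'] at hη
    have := norm_add_le (Lam s k ε y - u) u
    rw [sub_add_cancel] at this
    linarith
  refine ⟨z, v, ztt, hz0, hv0, ?_, ?_, fun t ht => ⟨(hsol t ht).1, (hsol t ht).2.1, hzttb t⟩,
    ?_, ?_, fun t ht => ⟨?_, ?_⟩, fun t ht => ?_⟩
  · rw [hw₀, hztt]
    simp only [hz0, hγ0, mul_zero, zero_add]
    rfl
  · refine isSolution_of_continuousOn hτ hcont (fun t _ => hzttb t)
      (fun t ht => (hsol t ht).2.2.2.2.2.2.2.1) (fun t ht => (hsol t ht).2.2.2.2.2.2.2.2)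
      fun t ht => ?_
    have hb := (hsol t ht).1
    refine equationAt_of_eq (γ := γ t) hp hb ?_ ?_
    · rw [penal_eq_penalAt q p k ε T t hb, ← force_eq q hp k ε hb, ← real_smul_eq]
    · rw [hctrl t ht, pen_two_mul_sub_sq (hsol t ht).2.2.2.2.1]
  · refine (Λ.continuous.comp_continuousOn fun t ht =>
      (hsol t ht).2.2.2.2.2.2.2.1.continuousWithinAt).congr fun t ht => Lam_of_band (hsol t ht).1
  · refine (Λ.continuous.comp_continuousOn fun t ht =>
      (hsol t ht).2.2.2.2.2.2.2.2.continuousWithinAt).congr fun t ht => Lam_of_band (hsol t ht).2.1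
  · have h1 := hΛtri (hsol t ht).1 hzb hΛz (hsol t ht).2.2.1
    have h2 := min_le_left ε (ω * ε)
    linarith
  · have h1 := hΛtri (hsol t ht).2.1 hyb hΛy (hsol t ht).2.2.2.1
    have h2 := min_le_right ε (ω * ε)
    have h3 : ω * ε ≤ ω * a := by gcongr
    rw [inv_mul_le_iff₀ hω]
    linarith
  · rw [hctrl t ht, ← hδl, show lam₀ = 2 * γ₀ - γ₀ ^ 2 from (two_mul_pen_sub_sq hl1.le).symm]
    have := (hsol t ht).2.2.2.2.2.2.1
    linarith

end Existence

end

end Progenitor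

namespace Progenitor

noncomputable section

/-! ### The spectrum of the wave packet datum -/

section Packet

theorem lintegral_comp_affine {r : ℝ} (hr : 0 < r) (κ : Plane) (F : Plane → ENNReal) :
    ∫⁻ η, F (r⁻¹ • (η - κ)) = ENNReal.ofReal (r ^ 2) * ∫⁻ η, F η := by
  rw [lintegral_sub_right_eq_self (fun η => F (r⁻¹ • η)) κ]
  have he : MeasurableEmbedding (fun η : Plane => r⁻¹ • η) :=
    (Homeomorph.smulOfNeZero r⁻¹ (inv_ne_zero hr.ne')).measurableEmbedding
  rw [← he.lintegral_map, Measure.map_addHaar_smul _ (inv_ne_zero hr.ne'), lintegral_smul_measure,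
    finrank_euclideanSpace_fin, inv_pow, inv_inv, abs_of_nonneg (by positivity), smul_eq_mul]

theorem integral_comp_affine {r : ℝ} (hr : 0 < r) (κ : Plane) (F : Plane → ℂ) :
    ∫ η, F (r⁻¹ • (η - κ)) = ((r ^ 2 : ℝ) : ℂ) * ∫ η, F η := by
  have h := Measure.integral_comp_smul volume F r⁻¹
  rw [integral_sub_right_eq_self (fun η => F (r⁻¹ • η)) κ, h, finrank_euclideanSpace_fin, inv_pow,
    inv_inv, abs_of_nonneg (by positivity), Complex.real_smul]

theorem quasiMeasurePreserving_affine {r : ℝ} (hr : 0 < r) (κ : Plane) :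
    Measure.QuasiMeasurePreserving (fun η : Plane => r⁻¹ • (η - κ)) :=
  (Measure.quasiMeasurePreserving_smul volume (inv_ne_zero hr.ne')).comp
    (measurePreserving_sub_right volume κ).quasiMeasurePreserving

/-- The spectrum of the wave packet `ε A(εx) e^{ik x₁}`, for the spectrum `c` of `A`. -/
def packetSpec (k ε : ℝ) (c : Plane → ℂ) : Plane → ℂ :=
  fun η => (ε⁻¹ : ℂ) * c (ε⁻¹ • (η - (k / (2 * Real.pi)) • e1))

/-- The amplitude ε⁻¹ against the two-dimensional Jacobian ε² leaves ε; this is why the packet has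
sup norm O(ε) while its L² norm is that of the envelope. -/
theorem lintegral_packetSpec (k : ℝ) {ε : ℝ} (hε : 0 < ε) (c : Plane → ℂ) :
    ∫⁻ η, ‖packetSpec k ε c η‖ₑ = ENNReal.ofReal ε * ∫⁻ η, ‖c η‖ₑ := by
  have h1 : ∀ η, ‖packetSpec k ε c η‖ₑ = ENNReal.ofReal ε⁻¹ *
      ‖c (ε⁻¹ • (η - (k / (2 * Real.pi)) • e1))‖ₑ := fun η => by
    rw [packetSpec, enorm_mul, ← ofReal_norm, ← Complex.ofReal_inv, Complex.norm_real,
      Real.norm_of_nonneg (by positivity)]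
  simp_rw [h1]
  rw [lintegral_const_mul' _ _ ENNReal.ofReal_ne_top,
    lintegral_comp_affine hε _ (fun η => ‖c η‖ₑ), ← mul_assoc,
    ← ENNReal.ofReal_mul (by positivity)]
  congr 2
  field_simp

theorem integrable_packetSpec (k : ℝ) {ε : ℝ} (hε : 0 < ε) {c : Plane → ℂ} (hc : Integrable c) :
    Integrable (packetSpec k ε c) := by
  refine ⟨(hc.1.comp_quasiMeasurePreserving (quasiMeasurePreserving_affine hε _)).const_mul _, ?_⟩
  rw [HasFiniteIntegral, lintegral_packetSpec k hε]
  exact ENNReal.mul_lt_top ENNReal.ofReal_lt_top hc.2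

theorem fourierInv_packetSpec (k : ℝ) {ε : ℝ} (hε : 0 < ε) (c : Plane → ℂ) (x : Plane) :
    𝓕⁻ (packetSpec k ε c) x
      = (ε : ℂ) * 𝓕⁻ c (ε • x) * Complex.exp (Complex.I * ((k * x 0 : ℝ) : ℂ)) := by
  set κ : Plane := (k / (2 * Real.pi)) • e1 with hκ
  have hκx : inner ℝ κ x = k / (2 * Real.pi) * x 0 := by
    rw [hκ, inner_smul_left, e1, EuclideanSpace.inner_single_left]
    simp
  rw [Real.fourierInv_eq', Real.fourierInv_eq']
  have h1 : ∀ η, Complex.exp (((2 * Real.pi * inner ℝ η x : ℝ) : ℂ) * Complex.I)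
      • packetSpec k ε c η
      = (fun ζ : Plane => ((ε⁻¹ : ℂ) * Complex.exp (Complex.I * ((k * x 0 : ℝ) : ℂ))) *
        (Complex.exp (((2 * Real.pi * inner ℝ ζ (ε • x) : ℝ) : ℂ) * Complex.I) • c ζ))
        (ε⁻¹ • (η - κ)) := by
    intro η
    have h2 : Complex.exp (((2 * Real.pi * inner ℝ η x : ℝ) : ℂ) * Complex.I)
        = Complex.exp (Complex.I * ((k * x 0 : ℝ) : ℂ)) * Complex.exp
          (((2 * Real.pi * inner ℝ (ε⁻¹ • (η - κ)) (ε • x) : ℝ) : ℂ) * Complex.I) := by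
      rw [← Complex.exp_add, inner_smul_left, inner_smul_right, inner_sub_left, hκx]
      congr 1
      have hπ : (Real.pi : ℂ) ≠ 0 := by exact_mod_cast Real.pi_ne_zero
      have hε' : (ε : ℂ) ≠ 0 := by exact_mod_cast hε.ne'
      simp only [conj_trivial]
      push_cast
      field_simp
      ring
    simp only [smul_eq_mul]
    rw [h2, packetSpec]
    ring
  refine (integral_congr_ae (Filter.Eventually.of_forall h1)).trans ?_
  refine (integral_comp_affine hε κ (fun ζ : Plane =>
    ((ε⁻¹ : ℂ) * Complex.exp (Complex.I * ((k * x 0 : ℝ) : ℂ))) *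
      (Complex.exp (((2 * Real.pi * inner ℝ ζ (ε • x) : ℝ) : ℂ) * Complex.I) • c ζ))).trans ?_
  rw [integral_const_mul]
  have hε' : (ε : ℂ) ≠ 0 := by exact_mod_cast hε.ne'
  push_cast
  field_simp

theorem fourier_packet (k : ℝ) {ε : ℝ} (hε : 0 < ε) {A : L2} (hA : Integrable (𝓕 A : L2)) :
    ((𝓕 (toL2 fun x => (ε : ℂ) * A (ε • x) * Complex.exp (Complex.I * ((k * x 0 : ℝ) : ℂ))) : L2)
      : Plane → ℂ) =ᵐ[volume] packetSpec k ε (𝓕 A : L2) := by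
  have hQ : Measure.QuasiMeasurePreserving (fun x : Plane => ε • x) :=
    Measure.quasiMeasurePreserving_smul volume hε.ne'
  have h1 : (fun x => (ε : ℂ) * A (ε • x) * Complex.exp (Complex.I * ((k * x 0 : ℝ) : ℂ)))
      =ᵐ[volume] 𝓕⁻ (packetSpec k ε (𝓕 A : L2)) := by
    filter_upwards [hQ.ae (pointValue_ae hA)] with x hx
    rw [fourierInv_packetSpec k hε, hx]
    rfl
  have hmem : MemLp (fun x => (ε : ℂ) * A (ε • x) *
      Complex.exp (Complex.I * ((k * x 0 : ℝ) : ℂ))) 2 volume := by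
    have hm := (Lp.memLp A).1.comp_quasiMeasurePreserving hQ
    have hmeas : AEStronglyMeasurable (fun x => (ε : ℂ) * A (ε • x) *
        Complex.exp (Complex.I * ((k * x 0 : ℝ) : ℂ))) volume :=
      (hm.const_mul (ε : ℂ)).mul (Continuous.aestronglyMeasurable (by fun_prop))
    have h2 : MemLp (fun x : Plane => A (ε • x)) 2 volume := by
      refine (memLp_two_iff_integrable_sq_norm hm).2 ?_
      exact ((memLp_two_iff_integrable_sq_norm (Lp.memLp A).1).1 (Lp.memLp A)).comp_smul hε.ne'
    refine MemLp.of_le_mul h2 hmeas (c := ε) (Filter.Eventually.of_forall fun x => ?_)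
    rw [norm_mul, norm_mul, mul_comm Complex.I, Complex.norm_exp_ofReal_mul_I, mul_one,
      Complex.norm_real, Real.norm_of_nonneg hε.le]
  exact fourier_ae_of_eq_fourierInv (integrable_packetSpec k hε hA) ((toL2_ae hmem).trans h1)

/-- The filtered datum in `H^m_ε` is controlled by the envelope in `H^m`. -/
theorem norm_multiplier_packetDatum_le (k : ℝ) {ε : ℝ} (hε : 0 < ε) {A : L2}
    (hA : Integrable (𝓕 A : L2)) {m : C(Plane, ℝ)} {m₀ : Plane → ℝ}
    (hm : ⇑m = rescaledSymbol k ε m₀) (hd : InDomain m₀ A) :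
    ‖multiplier m (packetDatum k ε A)‖ ≤ ‖multiplier m₀ A‖ := by
  have hb : packetDatum k ε A = band k (packetDatum k ε A) := (band_band k _).symm
  have h2 : ‖multiplier m (packetDatum k ε A)‖ₑ ^ 2 ≤ ‖multiplier m₀ A‖ₑ ^ 2 := by
    rw [← ofReal_norm (multiplier m _), ← ofReal_norm (multiplier m₀ A), norm_multiplier,
      norm_multiplier, ofReal_norm, ofReal_norm, enorm_sq_eq_lintegral, enorm_sq_eq_lintegral,
      lintegral_congr_ae (show (fun x => ‖(toL2 (symbolMul m₀ A)) x‖ₑ ^ 2) =ᵐ[volume]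
        fun x => ‖symbolMul m₀ A x‖ₑ ^ 2 from (toL2_ae hd).fun_comp (fun y => ‖y‖ₑ ^ 2)),
      -- Inserting ε⁻²ε² = 1 prepares the change of variables: ε² is its Jacobian and ε⁻² the
      -- squared amplitude of the packet spectrum.
      show ∫⁻ x, ‖symbolMul m₀ A x‖ₑ ^ 2 = ENNReal.ofReal (ε⁻¹ ^ 2) * (ENNReal.ofReal (ε ^ 2) *
        ∫⁻ x, ‖symbolMul m₀ A x‖ₑ ^ 2) by
        rw [← mul_assoc, ← ENNReal.ofReal_mul (by positivity), ← mul_pow,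
          inv_mul_cancel₀ hε.ne']; simp,
      ← lintegral_comp_affine hε ((k / (2 * Real.pi)) • e1)
        (fun x => ‖symbolMul m₀ A x‖ₑ ^ 2), ← lintegral_const_mul' _ _ ENNReal.ofReal_ne_top]
    refine lintegral_mono_ae ?_
    filter_upwards [toL2_ae (inDomain_of_band hb m), fourier_band k (toL2 fun x =>
      (ε : ℂ) * A (ε • x) * Complex.exp (Complex.I * ((k * x 0 : ℝ) : ℂ))),
      fourier_packet k hε hA] with η h3 h4 h5
    rw [h3, ENNReal.ofReal_pow (by positivity), ← mul_pow]
    gcongr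
    rw [← ofReal_norm, ← ofReal_norm, ← ENNReal.ofReal_mul (by positivity)]
    refine ENNReal.ofReal_le_ofReal ?_
    have h6 : (𝓕 (packetDatum k ε A) : L2) η
        = symbolMul (bandSymbol k) (toL2 fun x =>
          (ε : ℂ) * A (ε • x) * Complex.exp (Complex.I * ((k * x 0 : ℝ) : ℂ))) η := h4
    have h7 : (2 * Real.pi) • ε⁻¹ • (η - (k / (2 * Real.pi)) • e1)
        = ε⁻¹ • ((2 * Real.pi) • η - k • e1) := by
      rw [smul_comm, smul_sub, smul_smul (2 * Real.pi), mul_div_cancel₀ _ (by positivity)]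
    rw [norm_symbolMul, norm_symbolMul, h6, norm_symbolMul, h5, packetSpec, norm_mul, h7, hm,
      rescaledSymbol, ← Complex.ofReal_inv, Complex.norm_real, Real.norm_of_nonneg (by positivity)]
    calc _ ≤ |m₀ (ε⁻¹ • ((2 * Real.pi) • η - k • e1))| * (1 *
          (ε⁻¹ * ‖(𝓕 A : L2) (ε⁻¹ • (η - (k / (2 * Real.pi)) • e1))‖)) := by
          gcongr
          exact abs_bandSymbol_le _ _
      _ = _ := by ring
  rw [← ofReal_norm, ← ofReal_norm, ← ENNReal.ofReal_pow (norm_nonneg _),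
    ← ENNReal.ofReal_pow (norm_nonneg _), ENNReal.ofReal_le_ofReal_iff (by positivity)] at h2
  exact le_of_sq_le_sq h2 (norm_nonneg _)

theorem supNorm_packetDatum_le (k : ℝ) {ε : ℝ} (hε : 0 < ε) {A : L2}
    (hA : Integrable (𝓕 A : L2)) :
    supNorm (packetDatum k ε A) ≤ ε * ∫ η, ‖(𝓕 A : L2) η‖ := by
  have hb : packetDatum k ε A = band k (packetDatum k ε A) := (band_band k _).symm
  have hi := integrable_fourier_of_band hb
  have h0 : 0 ≤ ∫ η, ‖(𝓕 A : L2) η‖ := integral_nonneg fun _ => norm_nonneg _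
  refine supNorm_le (by positivity) ?_
  filter_upwards [pointValue_ae hi] with x hx
  rw [hx]
  refine (norm_fourierInv_le _ x).trans ?_
  calc ∫ η, ‖(𝓕 (packetDatum k ε A) : L2) η‖ ≤ ∫ η, ‖packetSpec k ε (𝓕 A : L2) η‖ := by
        refine integral_mono_ae hi.norm (integrable_packetSpec k hε hA).norm ?_
        filter_upwards [fourier_band k (toL2 fun x =>
          (ε : ℂ) * A (ε • x) * Complex.exp (Complex.I * ((k * x 0 : ℝ) : ℂ))),
          fourier_packet k hε hA] with η h4 h5
        have h6 : (𝓕 (packetDatum k ε A) : L2) η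
            = symbolMul (bandSymbol k) (toL2 fun x =>
              (ε : ℂ) * A (ε • x) * Complex.exp (Complex.I * ((k * x 0 : ℝ) : ℂ))) η := h4
        rw [h6, norm_symbolMul, h5]
        exact mul_le_of_le_one_left (norm_nonneg _) (abs_bandSymbol_le _ _)
    _ = ε * ∫ η, ‖(𝓕 A : L2) η‖ := by
        rw [integral_norm_eq_lintegral_enorm (integrable_packetSpec k hε hA).1,
          lintegral_packetSpec k hε, ENNReal.toReal_mul, ENNReal.toReal_ofReal hε.le,
          ← integral_norm_eq_lintegral_enorm hA.1]

end Packet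

end

end Progenitor

namespace Progenitor

noncomputable section

/-! ### Compatible initial data -/

section Compatibility

theorem besselSymbol_nonneg (s : ℝ) (ξ : Plane) : 0 ≤ besselSymbol s ξ :=
  Real.rpow_nonneg (by positivity) _

theorem measurable_besselSymbol (s : ℝ) : Measurable (besselSymbol s) := by
  unfold besselSymbol
  fun_prop

theorem besselSymbol_le {s r : ℝ} (h : s ≤ r) (ξ : Plane) : besselSymbol s ξ ≤ besselSymbol r ξ :=
  Real.rpow_le_rpow_of_exponent_le (by nlinarith [sq_nonneg ‖ξ‖]) (by linarith)

theorem norm_mul_besselSymbol_le (s : ℝ) (ξ : Plane) :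
    ‖ξ‖ * besselSymbol s ξ ≤ besselSymbol (s + 1) ξ := by
  have h0 : 0 < ‖ξ‖ ^ 2 + 1 := by positivity
  have h1 : ‖ξ‖ ≤ (‖ξ‖ ^ 2 + 1) ^ (1 / 2 : ℝ) := by
    rw [← Real.sqrt_eq_rpow]
    exact Real.le_sqrt_of_sq_le (by linarith)
  calc ‖ξ‖ * besselSymbol s ξ ≤ (‖ξ‖ ^ 2 + 1) ^ (1 / 2 : ℝ) * besselSymbol s ξ :=
        mul_le_mul_of_nonneg_right h1 (besselSymbol_nonneg s ξ)
    _ = besselSymbol (s + 1) ξ := by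
        rw [besselSymbol, besselSymbol, ← Real.rpow_add h0]
        congr 1
        ring

theorem MemH.mono {s r : ℝ} (h : s ≤ r) {A : L2} (hA : MemH r A) :
    MemH s A ∧ sobNorm s A ≤ sobNorm r A := by
  have hle : ∀ᵐ η, ‖symbolMul (besselSymbol s) A η‖ ≤ 1 * ‖symbolMul (besselSymbol r) A η‖ := by
    refine Filter.Eventually.of_forall fun η => ?_
    rw [norm_symbolMul, norm_symbolMul, one_mul, abs_of_nonneg (besselSymbol_nonneg _ _),
      abs_of_nonneg (besselSymbol_nonneg _ _)]
    gcongr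
    exact besselSymbol_le h _
  refine ⟨InDomain.mono (measurable_besselSymbol s) hA hle, ?_⟩
  have := norm_multiplier_le (measurable_besselSymbol s) hA hle
  rwa [one_mul] at this

/-- The Fourier transform of a function in `H^r`, `r > 1`, is integrable. -/
theorem exists_integrable_fourier {r : ℝ} (hr : 1 < r) : ∃ C : ℝ, 0 ≤ C ∧ ∀ A : L2, MemH r A →
    Integrable (𝓕 A : L2) ∧ ∫ η, ‖(𝓕 A : L2) η‖ ≤ C * sobNorm r A := by
  have hφ : MemLp (fun η : Plane => besselSymbol (-r) ((2 * Real.pi) • η)) 2 volume := by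
    refine (memLp_two_iff_integrable_sq ((measurable_besselSymbol (-r)).comp
      (measurable_const_smul _)).aestronglyMeasurable).2 ?_
    have h1 : Integrable fun ξ : Plane => (1 + ‖ξ‖ ^ 2) ^ (-(2 * r) / 2) :=
      integrable_rpow_neg_one_add_norm_sq (by
        rw [finrank_euclideanSpace_fin]; push_cast; linarith)
    have h2 := h1.comp_smul (R := 2 * Real.pi) (by positivity)
    refine h2.congr (Filter.Eventually.of_forall fun η => ?_)
    have h0 : (0 : ℝ) ≤ 1 + ‖(2 * Real.pi) • η‖ ^ 2 := by positivity
    change _ = ((‖(2 * Real.pi) • η‖ ^ 2 + 1) ^ (-r / 2)) ^ 2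
    rw [add_comm (‖(2 * Real.pi) • η‖ ^ 2), ← Real.rpow_natCast, ← Real.rpow_mul h0]
    have h3 : -(2 * r) / 2 = -r / 2 * ((2 : ℕ) : ℝ) := by
      push_cast
      ring
    rw [← h3]
  refine ⟨(eLpNorm (fun η : Plane => besselSymbol (-r) ((2 * Real.pi) • η)) 2 volume).toReal,
    ENNReal.toReal_nonneg, fun A hA => ?_⟩
  obtain ⟨h1, h2⟩ := integral_norm_smul_le hφ (𝓕 (multiplier (besselSymbol r) A) : L2)
  have h3 : (fun η => besselSymbol (-r) ((2 * Real.pi) • η) •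
      (𝓕 (multiplier (besselSymbol r) A) : L2) η) =ᵐ[volume] (𝓕 A : L2) := by
    filter_upwards [fourier_multiplier hA] with η h
    have h0 : (0 : ℝ) < ‖(2 * Real.pi) • η‖ ^ 2 + 1 := by positivity
    have h4 : besselSymbol (-r) ((2 * Real.pi) • η) * besselSymbol r ((2 * Real.pi) • η) = 1 := by
      rw [besselSymbol, besselSymbol, ← Real.rpow_add h0, neg_div, neg_add_cancel, Real.rpow_zero]
    rw [h, symbolMul, Complex.real_smul, ← mul_assoc, ← Complex.ofReal_mul, h4]
    simp
  refine ⟨h1.congr h3, ?_⟩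
  rw [norm_fourier] at h2
  exact (integral_congr_ae (h3.fun_comp (fun y => ‖y‖))).symm.trans_le h2

/-- Linearization of the dispersion relation on the band. -/
theorem exists_dispersion_bound (p : ℝ) {k : ℝ} (hk : 0 < k) : ∃ C : ℝ, 0 ≤ C ∧
    ∀ ξ : Plane, ‖ξ - k • e1‖ ≤ k / 2 → |‖ξ‖ ^ p - freq p k ^ 2| ≤ C * ‖ξ - k • e1‖ := by
  have hfreq : freq p k ^ 2 = k ^ p := by
    rw [freq, ← Real.rpow_natCast, ← Real.rpow_mul hk.le]
    congr 1
    push_cast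
    ring
  have hke : ‖k • e1‖ = k := by
    rw [norm_smul, e1, EuclideanSpace.single, PiLp.norm_single, norm_one, mul_one, Real.norm_of_nonneg hk.le]
  have hpos : ∀ r ∈ Set.Icc (k / 2) (3 * k / 2), r ≠ 0 := fun r hr => by
    have := hr.1
    linarith
  -- On the band |ξ| lies in [k/2, 3k/2], away from the origin, so r ↦ r^p is smooth there for every
  -- p.
  obtain ⟨C, hC⟩ := (isCompact_Icc (a := k / 2) (b := 3 * k / 2)).exists_bound_of_continuousOn
    (f := fun r : ℝ => p * r ^ (p - 1)) (continuousOn_const.mul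
      (continuousOn_id.rpow_const fun r hr => Or.inl (hpos r hr)))
  have hk1 : k ∈ Set.Icc (k / 2) (3 * k / 2) := ⟨by linarith, by linarith⟩
  refine ⟨C, (norm_nonneg _).trans (hC k hk1), fun ξ hξ => ?_⟩
  have hd : |‖ξ‖ - k| ≤ ‖ξ - k • e1‖ := by
    have := abs_norm_sub_norm_le ξ (k • e1)
    rwa [hke] at this
  have hd2 := abs_le.1 (hd.trans hξ)
  have h1 : ‖ξ‖ ∈ Set.Icc (k / 2) (3 * k / 2) := ⟨by linarith, by linarith⟩
  have h2 := (convex_Icc (k / 2) (3 * k / 2)).norm_image_sub_le_of_norm_hasDerivWithin_le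
    (f := fun r : ℝ => r ^ p) (fun r hr =>
      (Real.hasDerivAt_rpow_const (p := p) (Or.inl (hpos r hr))).hasDerivWithinAt) hC hk1 h1
  rw [hfreq]
  exact h2.trans (mul_le_mul_of_nonneg_left hd ((norm_nonneg _).trans (hC k hk1)))

/-- On functions concentrated near the carrier frequency, `|D|ᵖ` is `ω²` up to `O(ε)`. -/
theorem exists_dispersion_norm_bound {p k : ℝ} (hp : 0 < p) (hk : 0 < k) (s : ℝ) :
    ∃ C : ℝ, 0 ≤ C ∧ ∀ ε : ℝ, 0 < ε → ∀ z : L2, z = band k z →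
      ‖bandOp k (besselC s k ε) (bandOp k (rieszC p hp) z)‖
        ≤ freq p k ^ 2 * ‖Lam s k ε z‖ + C * ε * ‖Lam (s + 1) k ε z‖ := by
  obtain ⟨C, hC0, hC⟩ := exists_dispersion_bound p hk
  refine ⟨C, hC0, fun ε hε z hz => ?_⟩
  rw [Lam_of_band hz, Lam_of_band hz, bandOp_bandOp]
  set F := bandOp k (besselC s k ε * rieszC p hp) z with hF
  set G := bandOp k (besselC s k ε) z with hG
  set H := bandOp k (besselC (s + 1) k ε) z with hH
  have key : ‖F - ((freq p k ^ 2 : ℝ) : ℂ) • G‖ ≤ C * ε * ‖H‖ := by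
    rw [← norm_fourier (F - _), ← norm_fourier H]
    refine norm_le_mul_norm_of_ae ?_
    filter_upwards [fourier_sub_ae F (((freq p k ^ 2 : ℝ) : ℂ) • G), fourier_smul_ae
      ((freq p k ^ 2 : ℝ) : ℂ) G, fourier_bandOp k (besselC s k ε * rieszC p hp) z,
      fourier_bandOp k (besselC s k ε) z, fourier_bandOp k (besselC (s + 1) k ε) z]
      with η h1 h2 h3 h4 h5
    rw [h1, h2, h3, h4, h5, norm_symbolMul]
    set ξ := (2 * Real.pi) • η
    have h6 : symbolMul (fun ξ => (besselC s k ε * rieszC p hp) ξ * bandSymbol k ξ) z η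
        - ((freq p k ^ 2 : ℝ) : ℂ) * symbolMul (fun ξ => besselC s k ε ξ * bandSymbol k ξ) z η
        = ((besselSymbol s (ε⁻¹ • (ξ - k • e1)) * (‖ξ‖ ^ p - freq p k ^ 2) * bandSymbol k ξ : ℝ)
          : ℂ) * (𝓕 z : L2) η := by
      change ((besselSymbol s (ε⁻¹ • (ξ - k • e1)) * ‖ξ‖ ^ p * bandSymbol k ξ : ℝ) : ℂ) * _
        - _ * (((besselSymbol s (ε⁻¹ • (ξ - k • e1)) * bandSymbol k ξ : ℝ) : ℂ) * _) = _
      push_cast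
      ring
    rw [h6, norm_mul, Complex.norm_real, Real.norm_eq_abs, ← mul_assoc]
    refine mul_le_mul_of_nonneg_right ?_ (norm_nonneg _)
    change _ ≤ C * ε * |besselSymbol (s + 1) (ε⁻¹ • (ξ - k • e1)) * bandSymbol k ξ|
    by_cases hξ : ‖ξ - k • e1‖ ≤ k / 2
    · rw [bandSymbol_of_mem hξ, mul_one, mul_one, abs_mul,
        abs_of_nonneg (besselSymbol_nonneg _ _), abs_of_nonneg (besselSymbol_nonneg _ _)]
      -- The error |ξ - ke₁| is ε times the rescaled frequency, which is absorbed by one more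
      -- derivative.
      have h7 := norm_mul_besselSymbol_le s (ε⁻¹ • (ξ - k • e1))
      rw [norm_smul, Real.norm_of_nonneg (by positivity)] at h7
      calc besselSymbol s (ε⁻¹ • (ξ - k • e1)) * |‖ξ‖ ^ p - freq p k ^ 2|
          ≤ besselSymbol s (ε⁻¹ • (ξ - k • e1)) * (C * ‖ξ - k • e1‖) :=
            mul_le_mul_of_nonneg_left (hC ξ hξ) (besselSymbol_nonneg _ _)
        _ = C * ε * (ε⁻¹ * ‖ξ - k • e1‖ * besselSymbol s (ε⁻¹ • (ξ - k • e1))) := by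
            field_simp
        _ ≤ _ := by gcongr
    · rw [bandSymbol_of_notMem hξ]
      simp
  have h8 : ‖((freq p k ^ 2 : ℝ) : ℂ) • G‖ = freq p k ^ 2 * ‖G‖ := by
    rw [norm_smul, Complex.norm_real, Real.norm_of_nonneg (by positivity)]
  have h9 := norm_sub_norm_le F (((freq p k ^ 2 : ℝ) : ℂ) • G)
  linarith

/-- The scalar fixed point problem behind the compatibility condition. -/
theorem exists_pen_fixedPoint {f n : L2} {M c : ℝ} (hM : 0 < M) (hc0 : 0 ≤ c)
    (h : (‖f‖ + ‖n‖) ^ 2 ≤ c * M) :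
    ∃ l ∈ Set.Icc 0 c, ‖f - ((pen l : ℝ) : ℂ) • n‖ ^ 2 / M = l := by
  -- The real square root vanishes on negative numbers, so `pen` is continuous on the whole line,
  -- with value 1 for l ≥ 1.
  have hcont : Continuous fun l : ℝ => ‖f - ((pen l : ℝ) : ℂ) • n‖ ^ 2 / M := by
    unfold pen
    fun_prop
  have hmaps : Set.MapsTo (fun l : ℝ => ‖f - ((pen l : ℝ) : ℂ) • n‖ ^ 2 / M)
      (Set.Icc 0 c) (Set.Icc 0 c) := by
    intro l hl
    refine ⟨by positivity, ?_⟩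
    have h1 : ‖((pen l : ℝ) : ℂ)‖ ≤ 1 := by
      rw [Complex.norm_real, Real.norm_of_nonneg (pen_nonneg hl.1)]
      have := Real.sqrt_nonneg (1 - l)
      rw [pen]
      linarith
    have h2 : ‖f - ((pen l : ℝ) : ℂ) • n‖ ≤ ‖f‖ + ‖n‖ := by
      refine (norm_sub_le _ _).trans ?_
      rw [norm_smul]
      gcongr
      exact mul_le_of_le_one_left (norm_nonneg _) h1
    rw [div_le_iff₀ hM]
    exact (pow_le_pow_left₀ (norm_nonneg _) h2 2).trans h
  obtain ⟨l, hl, hfix⟩ := exists_mem_Icc_isFixedPt_of_mapsTo hcont.continuousOn hc0 hmaps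
  exact ⟨l, hl, hfix⟩

theorem norm_Lam_semilinear_le {q : ℕ} {s p k ε K : ℝ} (hk : 0 < k) (hε : 0 < ε)
    (hK : ∀ f : L2, f = band k f →
      ‖Lam s k ε (band k (powTerm q 1 f))‖ ≤ K * supNorm f ^ (q - 1) * ‖Lam s k ε f‖)
    {z : L2} (hz : z = band k z) :
    ‖bandOp k (besselC s k ε) (semilinear q p k ε z)‖
      ≤ powCoeff p k * ε ^ 2 * ((supNorm z / ε) ^ (q - 1) * (K * ‖Lam s k ε z‖)) := by
  have hpc : 0 ≤ powCoeff p k := Real.rpow_nonneg (freq_pos hk).le _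
  have hb : ∃ R : ℝ, ∀ᵐ x, ‖z x‖ ≤ R := by
    obtain ⟨C, -, hC⟩ := norm_pointValue_band_le k
    refine ⟨C * ‖z‖, ?_⟩
    filter_upwards [pointValue_ae (integrable_fourier_of_band hz)] with x hx
    rw [hx]
    exact hC z hz x
  obtain ⟨R, hR⟩ := hb
  have h1 := hK z hz
  rw [Lam_of_band (band_band k _).symm, bandOp_band] at h1
  rw [semilinear, map_smul, bandOp_band, powTerm_eq_smul q hε hR, map_smul, norm_smul, norm_smul,
    Complex.norm_real, Complex.norm_real, Real.norm_of_nonneg (by positivity),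
    Real.norm_of_nonneg (by positivity)]
  refine mul_le_mul_of_nonneg_left ?_ (by positivity)
  calc (ε⁻¹) ^ (q - 1) * ‖bandOp k (besselC s k ε) (powTerm q 1 z)‖
      ≤ (ε⁻¹) ^ (q - 1) * (K * supNorm z ^ (q - 1) * ‖Lam s k ε z‖) := by gcongr
    _ = _ := by rw [div_pow, inv_pow]; ring

-- The force has norm at most ω²a + O(ε) and the penalization is O(ε). Their sum therefore stays
-- below ρω²a, where ρ is the quadratic mean of 1 and ν, and ρ²/ν² = 1/2 + 1/(2ν²) is the right end
-- of the interval for the fixed point.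
set_option maxHeartbeats 800000 in
theorem exists_compatible (q : ℕ) {s p k ν Tmax a N K : ℝ} (b : ℝ) (hs : 0 < s) (hp : 0 < p)
    (hk : 0 < k) (hν : 1 < ν) (hTmax : 0 < Tmax) (ha : 0 < a) (hN : s + 1 ≤ N) (hK0 : 0 ≤ K)
    (hK : ∀ ε : ℝ, 0 < ε → ∀ f : L2, f = band k f →
      ‖Lam s k ε (band k (powTerm q 1 f))‖ ≤ K * supNorm f ^ (q - 1) * ‖Lam s k ε f‖) :
    ∃ ε₀ : ℝ, 0 < ε₀ ∧ ∀ ε : ℝ, 0 < ε → ε < ε₀ →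
      ∀ A₀ : L2, MemH N A₀ → sobNorm s A₀ = a → sobNorm N A₀ = b →
      ∀ T : ℝ, 0 ≤ T → T ≤ 2 * freq p k ^ (4 / p - 1) * Tmax →
      ∃ w : L2, Compatible q s p k ε ν T A₀ (packetDatum k ε A₀) w ∧
        controlNorm s p k ε ν A₀ w ≤ 1 / 2 + 1 / (2 * ν ^ 2) := by
  obtain ⟨C₁, hC₁0, hC₁⟩ := exists_integrable_fourier (r := N) (by linarith)
  obtain ⟨Cd, hCd0, hCd⟩ := exists_dispersion_norm_bound hp hk s
  have hω := freq_pos (p := p) hk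
  have hpc : 0 ≤ powCoeff p k := Real.rpow_nonneg hω.le _
  set ω := freq p k with hωdef
  set S : ℝ := C₁ * |b| with hS
  have hS0 : 0 ≤ S := by positivity
  set Tm : ℝ := 2 * ω ^ (4 / p - 1) * Tmax with hTm
  have hTm0 : 0 ≤ Tm := by positivity
  -- The sum of all O(ε) coefficients: dispersion error, power nonlinearity and penalization, in
  -- this order.
  set D : ℝ := Cd * |b| + powCoeff p k * (S ^ (q - 1) * (K * a))
    + ω ^ 2 * (1 + 2 * Tm * (K * S ^ (q - 1))) * a with hD
  have hD0 : 0 ≤ D := by positivity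
  have hρ : 1 < Real.sqrt ((ν ^ 2 + 1) / 2) := by
    rw [Real.lt_sqrt zero_le_one]
    nlinarith
  set ρ := Real.sqrt ((ν ^ 2 + 1) / 2) with hρdef
  have hρ2 : ρ ^ 2 = (ν ^ 2 + 1) / 2 := Real.sq_sqrt (by positivity)
  have hρ1 : 0 < ρ - 1 := by linarith
  refine ⟨min 1 ((ρ - 1) * (ω ^ 2 * a) / (D + 1)), by positivity, fun ε hε hεlt A₀ hA hAs hAN T hT
    hTle => ?_⟩
  have hε1 : ε ≤ 1 := (hεlt.trans_le (min_le_left _ _)).le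
  have hε2 : D * ε ≤ (ρ - 1) * (ω ^ 2 * a) := by
    have := (lt_div_iff₀ (by positivity)).1 (hεlt.trans_le (min_le_right _ _))
    nlinarith
  set z := packetDatum k ε A₀ with hz
  have hb : z = band k z := (band_band k _).symm
  obtain ⟨hint, hintle⟩ := hC₁ A₀ hA
  obtain ⟨hA1, hA1le⟩ := hA.mono (s := s) (by linarith)
  obtain ⟨hA2, hA2le⟩ := hA.mono hN
  have hbabs : sobNorm N A₀ ≤ |b| := hAN ▸ le_abs_self _
  have hzs : ‖Lam s k ε z‖ ≤ a := by
    rw [← hAs]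
    exact norm_multiplier_packetDatum_le k hε hint (m := besselC s k ε) rfl hA1
  have hzs1 : ‖Lam (s + 1) k ε z‖ ≤ |b| :=
    (norm_multiplier_packetDatum_le k hε hint (m := besselC (s + 1) k ε) rfl hA2).trans
      (hA2le.trans hbabs)
  have hzsup : supNorm z ≤ ε * S :=
    (supNorm_packetDatum_le k hε hint).trans (mul_le_mul_of_nonneg_left
      (hintle.trans (mul_le_mul_of_nonneg_left hbabs hC₁0)) hε.le)
  set f := force q p hp k ε z with hf
  set n := penalAt q p k ε (ε ^ 5 * T) z with hn
  have hsup0 := supNorm_nonneg z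
  have hfle : ‖bandOp k (besselC s k ε) f‖ ≤ ω ^ 2 * a + Cd * ε * |b|
      + powCoeff p k * ε ^ 2 * (S ^ (q - 1) * (K * a)) := by
    rw [hf, force, ← hb, map_sub, map_neg]
    refine (norm_sub_le _ _).trans ?_
    rw [norm_neg]
    refine add_le_add ((hCd ε hε z hb).trans (by gcongr)) ?_
    refine (norm_Lam_semilinear_le hk hε (hK ε hε) hb).trans ?_
    gcongr
    rw [div_le_iff₀ hε, mul_comm]
    exact hzsup
  have hnle : ‖bandOp k (besselC s k ε) n‖
      ≤ ω ^ 2 * (ε + 2 * (ε * Tm) * (K * S ^ (q - 1))) * a := by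
    refine (norm_Lam_penalAt_le hε (by positivity) (hK ε hε) hb).trans ?_
    have h1 : ε ^ (q + 4) ≤ ε := pow_le_of_le_one hε.le hε1 (by omega)
    have h2 : ε ^ 5 * T ≤ ε * Tm :=
      mul_le_mul (pow_le_of_le_one hε.le hε1 (by omega)) hTle hT hε.le
    have h3 : supNorm z ^ (q - 1) ≤ S ^ (q - 1) :=
      pow_le_pow_left₀ hsup0 (hzsup.trans (mul_le_of_le_one_left hS0 hε1)) _
    refine mul_le_mul (mul_le_mul_of_nonneg_left (add_le_add h1 ?_) (by positivity)) hzs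
      (norm_nonneg _) (by positivity)
    exact mul_le_mul (mul_le_mul_of_nonneg_left h2 zero_le_two)
      (mul_le_mul_of_nonneg_left h3 hK0) (by positivity) (by positivity)
  have hsum : ‖bandOp k (besselC s k ε) f‖ + ‖bandOp k (besselC s k ε) n‖ ≤ ρ * (ω ^ 2 * a) := by
    have h1 : powCoeff p k * ε ^ 2 * (S ^ (q - 1) * (K * a))
        ≤ powCoeff p k * ε * (S ^ (q - 1) * (K * a)) := by
      gcongr
      exact pow_le_of_le_one hε.le hε1 two_ne_zero
    have h2 : D * ε = Cd * ε * |b| + powCoeff p k * ε * (S ^ (q - 1) * (K * a))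
        + ω ^ 2 * (ε + 2 * (ε * Tm) * (K * S ^ (q - 1))) * a := by
      rw [hD]
      ring
    linarith
  have hM : 0 < ν ^ 2 * ω ^ 4 * a ^ 2 := by positivity
  obtain ⟨l, hl, hfix⟩ := exists_pen_fixedPoint (f := bandOp k (besselC s k ε) f)
    (n := bandOp k (besselC s k ε) n) (c := 1 / 2 + 1 / (2 * ν ^ 2)) hM (by positivity) (by
      refine (pow_le_pow_left₀ (by positivity) hsum 2).trans (le_of_eq ?_)
      rw [mul_pow, hρ2]
      field_simp)
  have hwb : f - ((pen l : ℝ) : ℂ) • n = band k (f - ((pen l : ℝ) : ℂ) • n) := by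
    rw [band_eq_bandOp, map_sub, map_smul, ← band_eq_bandOp, ← band_eq_bandOp, hf, band_force, hn,
      band_penalAt]
  have hcn : controlNorm s p k ε ν A₀ (f - ((pen l : ℝ) : ℂ) • n) = l := by
    rw [controlNorm, Lam_of_band hwb, map_sub, map_smul, hAs]
    exact hfix
  refine ⟨f - ((pen l : ℝ) : ℂ) • n, ?_, hcn.trans_le hl.2⟩
  rw [Compatible, hcn, penal_eq_penalAt q p k ε T 0 hb, mul_zero, zero_add, hf,
    force_eq q hp k ε hb]

end Compatibility

end

end Progenitor

/-! ### Assembly and choice of the constants -/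

theorem mainTheorem3 :
    ∃ 𝒞 : ℝ, 1 < 𝒞 ∧
    ∀ (q : ℕ) (s : ℝ), Odd q → 3 ≤ q → 1 - 2 / ((q : ℝ) - 1) < s →
    ∃ K : ℝ, 0 < K ∧
    ∀ p k : ℝ, 0 < p → 0 < k →
    ∃ t₀ : ℝ → ℝ → ℝ, (∀ ε δ : ℝ, 0 < ε → 0 < δ → 0 < t₀ ε δ) ∧
    ∀ ν Tmax a : ℝ, 1 < ν → ν < 2 → 0 < Tmax → 0 < a →
      -- part (a)
      (∀ N b : ℝ, s + 21 < N → ∃ ε₀ : ℝ, 0 < ε₀ ∧ ∀ ε : ℝ, 0 < ε → ε < ε₀ →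
        ∀ A₀ : L2, MemH N A₀ → sobNorm s A₀ = a → sobNorm N A₀ = b →
        ∀ T₁ 𝒯₁ : ℝ, 0 < T₁ → 0 ≤ 𝒯₁ → T₁ + 𝒯₁ ≤ 2 * freq p k ^ (4 / p - 1) * Tmax →
        ∃ 𝔴₀ : L2,
          Compatible q s p k ε ν (T₁ + 𝒯₁) A₀ (packetDatum k ε A₀) 𝔴₀ ∧
          controlNorm s p k ε ν A₀ 𝔴₀ ≤ 1 / 2 + 1 / (2 * ν ^ 2) ∧
          1 / 2 + 1 / (2 * ν ^ 2) < 1) ∧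
      -- part (b)
      (∃ ε₀ : ℝ, 0 < ε₀ ∧ ∀ ε : ℝ, 0 < ε → ε < ε₀ →
        ∀ (A₀ : L2) (N : ℝ), s + 21 < N → MemH N A₀ → sobNorm s A₀ = a →
        K * freq p k ^ (4 / p - 1) * Tmax * supNorm A₀ ^ (q - 1) ≤ 1 →
        ∀ T₁ 𝒯₁ : ℝ, 0 < T₁ → 0 ≤ 𝒯₁ → T₁ + 𝒯₁ ≤ 2 * freq p k ^ (4 / p - 1) * Tmax →
        ∀ u₀ v₀ w₀ : L2, u₀ = band k u₀ → v₀ = band k v₀ → w₀ = band k w₀ →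
        ‖u₀‖ ≤ 2 * sobNorm s A₀ →
        (freq p k)⁻¹ * ‖v₀‖ ≤ 2 * sobNorm s A₀ →
        (freq p k ^ 2)⁻¹ * ‖w₀‖ ≤ 2 * sobNorm s A₀ →
        supNorm (Lam (-s) k ε u₀) ≤ 2 * ε * supNorm A₀ →
        Compatible q s p k ε ν (T₁ + 𝒯₁) A₀ (Lam (-s) k ε u₀) (Lam (-s) k ε w₀) →
        ∀ lam₀ : ℝ, lam₀ = controlNorm s p k ε ν A₀ (Lam (-s) k ε w₀) →
        lam₀ < 1 → deriv pen lam₀ ≤ 16 / (𝒞 * ε ^ (q + 4)) →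
        ∃ t₁ : ℝ, t₀ ε (1 - lam₀) < t₁ ∧ ∃ z zt ztt : ℝ → L2,
          -- the initial data
          z 0 = Lam (-s) k ε u₀ ∧ zt 0 = Lam (-s) k ε v₀ ∧ ztt 0 = Lam (-s) k ε w₀ ∧
          -- (i)
          IsSolution q s p k ε ν (T₁ + 𝒯₁) A₀ t₁ z zt ztt ∧
          -- (ii)
          (∀ t ∈ Set.Icc 0 t₁,
            z t = band k (z t) ∧ zt t = band k (zt t) ∧ ztt t = band k (ztt t)) ∧
          -- (iii)
          ContinuousOn (fun t => Lam s k ε (z t)) (Set.Icc 0 t₁) ∧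
          ContinuousOn (fun t => Lam s k ε (zt t)) (Set.Icc 0 t₁) ∧
          (∀ t ∈ Set.Icc 0 t₁,
            ‖Lam s k ε (z t)‖ ≤ 3 * sobNorm s A₀ ∧
            (freq p k)⁻¹ * ‖Lam s k ε (zt t)‖ ≤ 3 * sobNorm s A₀) ∧
          -- (iv)
          (∀ t ∈ Set.Icc 0 t₁,
            |controlNorm s p k ε ν A₀ (ztt t) - lam₀| ≤ 1 / 2 * (1 - lam₀))) := by
  -- The bound 1/(2√(1 - λ₀)) ≤ 16/(192ε^(q+4)) is √(1 - λ₀) ≥ 6ε^(q+4), the margin needed for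
  -- nondegeneracy.
  refine ⟨192, by norm_num, fun q s hq hq3 hs => ?_⟩
  have hs0 : 0 < s := by
    have h1 : (3 : ℝ) ≤ q := by exact_mod_cast hq3
    have h2 : 2 / ((q : ℝ) - 1) ≤ 1 := by
      rw [div_le_one (by linarith)]
      linarith
    linarith
  obtain ⟨K, hK1, hK⟩ := exists_tame hq hs0
  have hK0 : 0 ≤ K := zero_le_one.trans hK1
  refine ⟨4 * 2 ^ q * K, by positivity, fun p k hp hk => ?_⟩
  have hsol := fun (ε δ : ℝ) (h : 0 < ε ∧ 0 < δ) =>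
    exists_solution q (by omega) hp hk h.1 h.2 hK0 (hK k ε h.1)
  choose τ hτ0 hτ using hsol
  classical
  -- Half of the existence time makes the inequality for the final time strict; the value 1 only
  -- fills in arguments that are not both positive.
  refine ⟨fun ε δ => if h : 0 < ε ∧ 0 < δ then τ ε δ h / 2 else 1, fun ε δ hε hδ => ?_,
    fun ν Tmax a hν1 hν2 hTmax ha => ⟨fun N b hN => ?_, ?_⟩⟩
  · change 0 < dite _ _ _
    rw [dif_pos (show 0 < ε ∧ 0 < δ from ⟨hε, hδ⟩)]
    exact half_pos (hτ0 ε δ _)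
  · obtain ⟨ε₀, hε₀, H⟩ := exists_compatible q b hs0 hp hk hν1 hTmax ha
      (by linarith : s + 1 ≤ N) hK0 (hK k)
    refine ⟨ε₀, hε₀, fun ε hε hεlt A₀ hA hAs hAN T₁ 𝒯₁ hT₁ h𝒯₁ hT => ?_⟩
    obtain ⟨w, hw1, hw2⟩ := H ε hε hεlt A₀ hA hAs hAN (T₁ + 𝒯₁) (by linarith) hT
    refine ⟨w, hw1, hw2, ?_⟩
    have h1 : 1 / (2 * ν ^ 2) < 1 / 2 := one_div_lt_one_div_of_lt two_pos (by nlinarith)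
    linarith
  -- This threshold is what gives ε ≤ a ≤ 1/ε and 𝐓 ≤ 1/ε, freeing the existence time from a and 𝐓.
  · refine ⟨min a (min (1 / a) (1 / Tmax)), by positivity, fun ε hε hεlt A₀ N _ _ hAs hKT T₁ 𝒯₁ hT₁
      h𝒯₁ hT u₀ v₀ w₀ hu hv hw hun hvn _ hsup hcomp lam₀ hlam hlam1 hder => ?_⟩
    have h1 : ε ≤ a := (hεlt.trans_le (min_le_left _ _)).le
    have h2 : a ≤ 1 / ε := (le_one_div hε ha).1
      (hεlt.trans_le ((min_le_right _ _).trans (min_le_left _ _))).le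
    have h3 : Tmax ≤ 1 / ε := (le_one_div hε hTmax).1
      (hεlt.trans_le ((min_le_right _ _).trans (min_le_right _ _))).le
    have hδ : 0 < 1 - lam₀ := sub_pos.2 hlam1
    refine ⟨τ ε (1 - lam₀) ⟨hε, hδ⟩, ?_, ?_⟩
    · change dite _ _ _ < _
      rw [dif_pos (show 0 < ε ∧ 0 < 1 - lam₀ from ⟨hε, hδ⟩)]
      exact half_lt_self (hτ0 _ _ _)
    · exact hτ ε (1 - lam₀) ⟨hε, hδ⟩ ν Tmax A₀ hν1 hν2 hTmax h3 (hAs.symm ▸ h1) (hAs.symm ▸ h2) hKT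
        (T₁ + 𝒯₁) (by linarith) hT u₀ v₀ w₀ hu hv hw hun hvn hsup hcomp lam₀ hlam rfl hder
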